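/- Identify $\mathbb R^2$ with $\mathbb C$, let $\Sigma_\pi=\{z:\operatorname{Im} z>0\}$ be the open upper half-plane, and for $z\neq\zeta$ in $\Sigma_\pi$ let $$K_\pi(z,\zeta)=\frac1{2\pi}\Big(\frac{z-\zeta}{|z-\zeta|^2}-\frac{z-\overline\zeta}{|z-\overline\zeta|^2}\Big)^{\perp},\qquad (x_1,x_2)^\perp=(-x_2,x_1),$$ be the Biot–Savart kernel of the half-plane. Let $T$ be the singular integral operator whose kernel is the Jacobian matrix $D_zK_\pi(z,\zeta)$, $$Tf(z)=\mathrm{p.v.}\int_{\Sigma_\pi}D_zK_\pi(z,\zeta)\,f(\zeta)\,\mathrm d\zeta=\lim_{\varepsilon\downarrow0}\int_{\{\zeta\in\Sigma_\pi:\,|z-\zeta|>\varepsilon\}}D_zK_\pi(z,\zeta)\,f(\zeta)\,\mathrm d\zeta,\qquad z\in\Sigma_\pi .$$ For $0<\alpha<\pi$ and $2\le p<\infty$ put $$\delta=1-\frac\alpha\pi,\qquad \mathsf w_{p,\delta}(z)=\Big(\frac\pi\alpha|z|^{\delta}\Big)^{2(p-1)},\qquad \varepsilon_\alpha=\operatorname{dist}\big(\alpha,\{0,\tfrac\pi2,\pi\}\big),$$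 and let $L^p(\Sigma_\pi;\mathsf w_{p,\delta})$ be the space with norm $\big(\int_{\Sigma_\pi}|f|^p\,\mathsf w_{p,\delta}\,\mathrm dz\big)^{1/p}$. There is an absolute constant $C>0$ such that for all $2\le p<\infty$ and $0<\alpha<\pi$ the following holds. For every real-valued $f\in L^p(\Sigma_\pi;\mathsf w_{p,\delta})$, the truncated integrals converge absolutely and the principal value $Tf(z)$ exists for almost every $z\in\Sigma_\pi$, $Tf\in L^p(\Sigma_\pi;\mathsf w_{p,\delta})$, and $$\|Tf\|_{L^p(\Sigma_\pi;\mathsf w_{p,\delta})}\le C\,\frac{p}{\delta(1-\delta)}\,\|f\|_{L^p(\Sigma_\pi;\mathsf w_{p,\delta})};$$ moreover, if $\alpha\neq\frac\pi2$, then $\dfrac{p}{\delta(1-\delta)}\le C\,p\,\varepsilon_\alpha^{-1}$. (That is, $\|T\|_{\mathcal L(L^p(\Sigma_\pi;\mathsf w_{p,\delta}))}\lesssim\frac{p}{\delta(1-\delta)}\lesssim p\,\varepsilon_\alpha^{-1}$.) -/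

import Mathlib

open MeasureTheory Filter Topology

noncomputable section

/-- The open half-plane `Σ_π = {ρ e^{iθ} : ρ > 0, 0 < θ < π}`, the plane being identified
with `ℂ`. -/
def halfPlane : Set ℂ := {z | 0 < z.im}

/-- The Biot–Savart kernel of the half-plane,
`K_π(z, ζ) = (2π)⁻¹ ((z - ζ) / |z - ζ|² - (z - ζ̄) / |z - ζ̄|²)^⊥`, where
`(x₁, x₂)^⊥ = (-x₂, x₁)` is multiplication by `i`. -/
def biotSavart (z ζ : ℂ) : ℂ :=
  (((2 * Real.pi)⁻¹ : ℝ) : ℂ) * (Complex.I *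
    ((z - ζ) / ((‖z - ζ‖ ^ 2 : ℝ) : ℂ) -
      (z - starRingEnd ℂ ζ) / ((‖z - starRingEnd ℂ ζ‖ ^ 2 : ℝ) : ℂ)))

/-- The kernel `D_z K_π(z, ζ)`: the (real) Jacobian of `K_π(·, ζ)` at `z`, a real-linear map
of the plane `ℂ ≃ ℝ²`. -/
def biotSavartDeriv (z ζ : ℂ) : ℂ →L[ℝ] ℂ :=
  fderiv ℝ (fun w : ℂ => biotSavart w ζ) z

/-- The truncation at scale `ε` of the singular integral with kernel `D_z K_π`. -/
def truncatedT (f : ℂ → ℝ) (ε : ℝ) (z : ℂ) : ℂ →L[ℝ] ℂ :=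
  ∫ ζ in {ζ | ζ ∈ halfPlane ∧ ε < ‖z - ζ‖}, f ζ • biotSavartDeriv z ζ

/-- The singular integral on the half-plane, as a principal value:
`T f (z) = p.v. ∫_{Σ_π} D_z K_π(z, ζ) f(ζ) dζ`. -/
def singularT (f : ℂ → ℝ) (z : ℂ) : ℂ →L[ℝ] ℂ :=
  limUnder (𝓝[>] (0 : ℝ)) (fun ε => truncatedT f ε z)

/-- The principal value defining `T f (z)` exists: the truncated integrals converge absolutely
and tend to `T f (z)` as the truncation is removed. -/
def PrincipalValueExists (f : ℂ → ℝ) (z : ℂ) : Prop :=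
  (∀ ε : ℝ, 0 < ε →
    IntegrableOn (fun ζ => f ζ • biotSavartDeriv z ζ) {ζ | ζ ∈ halfPlane ∧ ε < ‖z - ζ‖}) ∧
  Tendsto (fun ε => truncatedT f ε z) (𝓝[>] (0 : ℝ)) (𝓝 (singularT f z))

/-- `δ = 1 - α / π`. -/
def cornerDelta (α : ℝ) : ℝ := 1 - α / Real.pi

/-- The weight `w_{p,δ}(z) = ((π / α) |z|^δ)^{2(p-1)}`, with `δ = 1 - α / π`. -/
def cornerWeight (p α : ℝ) (z : ℂ) : ℝ :=
  (Real.pi / α * ‖z‖ ^ cornerDelta α) ^ (2 * (p - 1))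

/-- The measure `w_{p,δ}(z) dz` on the half-plane, so that `L^p(Σ_π; w_{p,δ})` is `L^p` of this
measure. -/
def weightedMeasure (p α : ℝ) : Measure ℂ :=
  (volume.restrict halfPlane).withDensity (fun z => ENNReal.ofReal (cornerWeight p α z))

/-- `ε_α = dist(α, {0, π/2, π})`. -/
def cornerEps (α : ℝ) : ℝ := Metric.infDist α {0, Real.pi / 2, Real.pi}

end

noncomputable section

/-! In complex notation the Biot–Savart kernel is the conjugate of a function holomorphic in `z`, so
its Jacobian acts by `h ↦ -(i/2π) conj (c h)` with `c = (z - ζ)⁻² - (z - ζ̄)⁻²`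
(`biotSavartDeriv_eq`). Extend `f` by zero and reflect oddly across the real axis: integrating `f`
against `c` is then integrating the reflection against `(z - w)⁻²` over the whole plane. Up to a
bounded real-linear map, `T f` is thus the planar Beurling transform of the reflection
(`principalValue_of_oddReflection`). The weight is radial, so reflection respects it. What remains
is a bound for the Beurling transform with weight `|z|ˢ` acting on functions, `s = 2δ(p - 1)/p`.

Unweighted bound. Replace `1/z` by a `C²` function equal to it off the unit disc. Its `∂`-derivative
`beurlingReg` regularises `-1/z²`, and its `∂̄`-derivative `discBump` is a nonnegative compactly
supported bump. The Jacobian is a null Lagrangian (`integral_wirtinger_mul`), so `∂u` and `∂̄u` have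
equal `L²` norms for `u = g * cauchyReg`; this gives the `L²` bound without the Fourier transform. A
Calderón–Zygmund decomposition gives weak type `(1,1)`. Marcinkiewicz interpolation on `(1, 3/2]`
followed by duality gives norm `O(p)` for `p ≥ 3`, and interpolation between `1` and `4` covers `2 ≤
p ≤ 3` (`exists_eLpNorm_convKernel_beurlingReg_le`).

Principal values. The same null-Lagrangian identity shows that `beurlingReg` at scale `s` convolved
with `discBump` at scale `t` is unchanged when `s` and `t` are exchanged. By density and
completeness, each `g` in `Lᵖ` has a partner `V` in `Lᵖ` such that every regularised transform of
`g` is a mollification of `V` (`exists_isBeurlingPair`). Lebesgue differentiation of `V` then gives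
almost everywhere convergence, with no maximal truncation estimate. Sharp truncations differ from
the smooth ones by an approximate identity of mean zero, which disappears at Lebesgue points
(`exists_beurling_principalValue`).

Weight. Moving `|z|ˢ` through the transform leaves a commutator with the absolutely integrable
kernel `|z - ζ|⁻² |(|z|/|ζ|)ˢ - 1|`. A Schur test with the power `|ζ|^(-2/p)` bounds it on `Lᵖ` by
`O(p + 1/κ)` whenever `s + 2/p + κ ≤ 2` (`lintegral_powerCommKernel_rpow_le`). Here `κ = 1 - δ` is
admissible, and `p + 1/(1 - δ)` is at most a multiple of `p/(δ(1 - δ))`. -/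

/-! ### Decaying potentials and the null-Lagrangian identity. -/

/-- `k` is `O((1 + |z|)⁻ᵐ)` on the whole plane. -/
def HasDecay {E : Type*} [NormedAddCommGroup E] (m : ℕ) (k : ℂ → E) : Prop :=
  ∃ C, 0 ≤ C ∧ ∀ z, ‖k z‖ ≤ C * ((1 + ‖z‖) ^ m)⁻¹

namespace HasDecay

variable {E F : Type*} [NormedAddCommGroup E] [NormedAddCommGroup F]

lemma mono {m n : ℕ} {k : ℂ → E} (h : HasDecay m k) (hnm : n ≤ m) : HasDecay n k := by
  obtain ⟨C, hC, h⟩ := h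
  refine ⟨C, hC, fun z => (h z).trans ?_⟩
  gcongr
  linarith [norm_nonneg z]

lemma of_le {m : ℕ} {k : ℂ → E} {l : ℂ → F} (h : HasDecay m k) (A : ℝ) (hA : 0 ≤ A)
    (hl : ∀ z, ‖l z‖ ≤ A * ‖k z‖) : HasDecay m l := by
  obtain ⟨C, hC, h⟩ := h
  refine ⟨A * C, by positivity, fun z => (hl z).trans ?_⟩
  rw [mul_assoc]
  exact mul_le_mul_of_nonneg_left (h z) hA

lemma mul {m n : ℕ} {k l : ℂ → ℂ} (hk : HasDecay m k) (hl : HasDecay n l) :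
    HasDecay (m + n) (fun z => k z * l z) := by
  obtain ⟨C, hC, hk⟩ := hk
  obtain ⟨D, hD, hl⟩ := hl
  refine ⟨C * D, by positivity, fun z => ?_⟩
  rw [norm_mul, pow_add, mul_inv, mul_mul_mul_comm]
  exact mul_le_mul (hk z) (hl z) (norm_nonneg _) (by positivity)

lemma apply {m : ℕ} {k : ℂ → ℂ →L[ℝ] ℂ} (h : HasDecay m k) (v : ℂ) :
    HasDecay m (fun z => k z v) :=
  h.of_le ‖v‖ (norm_nonneg _) fun z => by rw [mul_comm]; exact (k z).le_opNorm v

lemma bounded {m : ℕ} {k : ℂ → E} (h : HasDecay m k) : ∃ C, 0 ≤ C ∧ ∀ z, ‖k z‖ ≤ C := by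
  obtain ⟨C, hC, h⟩ := h
  refine ⟨C, hC, fun z => (h z).trans (mul_le_of_le_one_right hC ?_)⟩
  exact inv_le_one_of_one_le₀ (one_le_pow₀ (by linarith [norm_nonneg z]))

lemma comp_affine {m : ℕ} {k : ℂ → E} (h : HasDecay m k) {s : ℝ} (hs : s ≠ 0) (v : ℂ) :
    HasDecay m (fun z => k (s • z + v)) := by
  obtain ⟨C, hC, h⟩ := h
  have hs' : 0 < |s| := abs_pos.2 hs
  set A := 1 + (1 + ‖v‖) / |s| with hA
  have hA0 : 0 < A := by positivity
  refine ⟨C * A ^ m, by positivity, fun z => (h _).trans ?_⟩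
  rw [mul_assoc]
  gcongr
  rw [← inv_inv (A ^ m), ← mul_inv, ← inv_pow A, ← mul_pow]
  -- `A` is chosen to make `1 + |z|` comparable with `1 + |sz + v|`.
  have key : A⁻¹ * (1 + ‖z‖) ≤ 1 + ‖s • z + v‖ := by
    rw [inv_mul_le_iff₀ hA0]
    have h1 : |s| * ‖z‖ ≤ ‖s • z + v‖ + ‖v‖ := by
      calc |s| * ‖z‖ = ‖s • z‖ := by rw [norm_smul, Real.norm_eq_abs]
        _ = ‖(s • z + v) - v‖ := by simp
        _ ≤ _ := norm_sub_le _ _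
    have h2 : ‖z‖ ≤ (‖s • z + v‖ + ‖v‖) / |s| := by rw [le_div_iff₀ hs']; linarith
    have h3 : (‖s • z + v‖ + ‖v‖) / |s| ≤ (1 + ‖v‖) / |s| * (1 + ‖s • z + v‖) := by
      rw [div_mul_eq_mul_div]
      gcongr
      nlinarith [norm_nonneg v, norm_nonneg (s • z + v)]
    nlinarith [norm_nonneg (s • z + v)]
  gcongr

lemma integrable {m : ℕ} {k : ℂ → E} (h : HasDecay m k) (hm : 3 ≤ m)
    (hk : AEStronglyMeasurable k) : Integrable k := by
  obtain ⟨C, hC, h⟩ := h.mono hm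
  have h0 : Integrable (fun z : ℂ => C * (1 + ‖z‖) ^ (-(3:ℝ))) :=
    (integrable_one_add_norm (by simp [Complex.finrank_real_complex]; norm_num)).const_mul C
  refine h0.mono' hk (Eventually.of_forall fun z => (h z).trans_eq ?_)
  rw [Real.rpow_neg (by positivity)]
  norm_cast

end HasDecay

/-- Wirtinger derivative `∂/∂z` read off a real differential. -/
def wirtinger (L : ℂ →L[ℝ] ℂ) : ℂ := (L 1 - Complex.I * L Complex.I) / 2

/-- Wirtinger derivative `∂/∂z̄` read off a real differential. -/
def wirtingerBar (L : ℂ →L[ℝ] ℂ) : ℂ := (L 1 + Complex.I * L Complex.I) / 2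

lemma norm_wirtinger_le (L : ℂ →L[ℝ] ℂ) : ‖wirtinger L‖ ≤ ‖L‖ := by
  have h1 : ‖L 1‖ ≤ ‖L‖ := by simpa using L.le_opNorm 1
  have h2 : ‖L Complex.I‖ ≤ ‖L‖ := by simpa using L.le_opNorm Complex.I
  have := norm_sub_le (L 1) (Complex.I * L Complex.I)
  simp only [wirtinger, norm_div, norm_mul, Complex.norm_I, one_mul, Complex.norm_ofNat] at *
  linarith

/-- A twice continuously differentiable function whose derivatives of order `0, 1, 2` decay like
those of `1 / z`. -/
structure IsPotential (b : ℂ → ℂ) (b' : ℂ → ℂ →L[ℝ] ℂ) (b'' : ℂ → ℂ →L[ℝ] ℂ →L[ℝ] ℂ) :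
    Prop where
  hasFDerivAt : ∀ z, HasFDerivAt b (b' z) z
  hasFDerivAt' : ∀ z, HasFDerivAt b' (b'' z) z
  continuous'' : Continuous b''
  decay : HasDecay 1 b
  decay' : HasDecay 2 b'
  decay'' : HasDecay 3 b''

namespace IsPotential

variable {a b : ℂ → ℂ} {a' b' : ℂ → ℂ →L[ℝ] ℂ} {a'' b'' : ℂ → ℂ →L[ℝ] ℂ →L[ℝ] ℂ}

lemma continuous (h : IsPotential b b' b'') : Continuous b :=
  continuous_iff_continuousAt.2 fun z => (h.hasFDerivAt z).continuousAt

lemma continuous' (h : IsPotential b b' b'') : Continuous b' :=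
  continuous_iff_continuousAt.2 fun z => (h.hasFDerivAt' z).continuousAt

lemma comp_affine (h : IsPotential b b' b'') {s : ℝ} (hs : s ≠ 0) (v : ℂ) :
    IsPotential (fun z => b (s • z + v)) (fun z => s • b' (s • z + v))
      (fun z => (s * s) • b'' (s • z + v)) where
  hasFDerivAt z := by
    have h1 : HasFDerivAt (fun z : ℂ => s • z + v) (s • ContinuousLinearMap.id ℝ ℂ) z :=
      ((hasFDerivAt_id z).const_smul s).add_const v
    have := (h.hasFDerivAt (s • z + v)).comp z h1
    exact this.congr_fderiv (by ext w; simp)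
  hasFDerivAt' z := by
    have h1 : HasFDerivAt (fun z : ℂ => s • z + v) (s • ContinuousLinearMap.id ℝ ℂ) z :=
      ((hasFDerivAt_id z).const_smul s).add_const v
    have := ((h.hasFDerivAt' (s • z + v)).comp z h1).const_smul s
    exact this.congr_fderiv (by ext w; simp [mul_assoc])
  continuous'' := by
    have := h.continuous''
    fun_prop
  decay := h.decay.comp_affine hs v
  decay' := (h.decay'.comp_affine hs v).of_le |s| (abs_nonneg _) fun z => by
    rw [norm_smul, Real.norm_eq_abs]
  decay'' := (h.decay''.comp_affine hs v).of_le |s * s| (abs_nonneg _) fun z =>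
    ContinuousLinearMap.opNorm_smul_le _ _

lemma const_mul (h : IsPotential b b' b'') (s : ℝ) :
    IsPotential (fun z => s • b z) (fun z => s • b' z) (fun z => s • b'' z) where
  hasFDerivAt z := (h.hasFDerivAt z).const_smul s
  hasFDerivAt' z := (h.hasFDerivAt' z).const_smul s
  continuous'' := h.continuous''.const_smul s
  decay := h.decay.of_le |s| (abs_nonneg _) fun z => by rw [norm_smul, Real.norm_eq_abs]
  decay' := h.decay'.of_le |s| (abs_nonneg _) fun z => by rw [norm_smul, Real.norm_eq_abs]
  decay'' := h.decay''.of_le |s| (abs_nonneg _) fun z => ContinuousLinearMap.opNorm_smul_le _ _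

lemma conj (h : IsPotential b b' b'') :
    IsPotential (fun z => Complex.conjCLE (b z))
      (fun z => (Complex.conjCLE : ℂ →L[ℝ] ℂ).comp (b' z))
      (fun z => (ContinuousLinearMap.compL ℝ ℂ ℂ ℂ (Complex.conjCLE : ℂ →L[ℝ] ℂ)).comp (b'' z))
    where
  hasFDerivAt z := (Complex.conjCLE : ℂ →L[ℝ] ℂ).hasFDerivAt.comp z (h.hasFDerivAt z)
  hasFDerivAt' z :=
    (ContinuousLinearMap.compL ℝ ℂ ℂ ℂ (Complex.conjCLE : ℂ →L[ℝ] ℂ)).hasFDerivAt.comp z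
      (h.hasFDerivAt' z)
  continuous'' := by
    have := h.continuous''
    fun_prop
  decay := h.decay.of_le 1 zero_le_one fun z => by simp
  decay' := h.decay'.of_le ‖(Complex.conjCLE : ℂ →L[ℝ] ℂ)‖ (norm_nonneg _) fun z =>
    ContinuousLinearMap.opNorm_comp_le _ _
  decay'' := h.decay''.of_le
    ‖ContinuousLinearMap.compL ℝ ℂ ℂ ℂ (Complex.conjCLE : ℂ →L[ℝ] ℂ)‖ (norm_nonneg _) fun z =>
    ContinuousLinearMap.opNorm_comp_le _ _

/-- Two integrations by parts move both derivatives onto `b`, where they commute. Every product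
involved decays at least to order `1 + 2 = 3`, so it is integrable in the plane and no boundary term
appears. -/
lemma integral_cross (ha : IsPotential a a' a'') (hb : IsPotential b b' b'') :
    ∫ z, a' z 1 * b' z Complex.I = ∫ z, a' z Complex.I * b' z 1 := by
  have cb : ∀ v, ∀ z, HasFDerivAt (fun z => b' z v) ((b'' z).flip v) z := fun v z =>
    ((ContinuousLinearMap.apply ℝ ℂ v).hasFDerivAt.comp z (hb.hasFDerivAt' z))
  have hm : ∀ v, Continuous (fun z => a' z v) := fun v => by
    have := ha.continuous'; fun_prop
  have hm2 : ∀ v, Continuous (fun z => b' z v) := fun v => by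
    have := hb.continuous'; fun_prop
  have hm3 : ∀ v w, Continuous (fun z => b'' z v w) := fun v w => by
    have := hb.continuous''; fun_prop
  have key : ∀ v w : ℂ, ∫ z, a z * b'' z w v = - ∫ z, a' z w * b' z v := fun v w => by
    refine integral_bilinear_hasFDerivAt_right_eq_neg_left_of_integrable (v := w)
      (B := ContinuousLinearMap.mul ℝ ℂ) (f := a) (f' := a') (g := fun z => b' z v)
      (g' := fun z => (b'' z).flip v) ?_ ?_ ?_ (fun z _ => ha.hasFDerivAt z) (fun z _ => cb v z)
    · exact ((ha.decay'.apply w).mul (hb.decay'.apply v)).integrable (by norm_num)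
        ((hm w).mul (hm2 v)).aestronglyMeasurable
    · have : HasDecay 3 (fun z => b'' z w v) :=
        hb.decay''.of_le (‖w‖ * ‖v‖) (by positivity) fun z => by
          refine ((b'' z).le_opNorm₂ w v).trans_eq (by ring)
      exact (ha.decay.mul this).integrable (by norm_num)
        (ha.continuous.mul (hm3 w v)).aestronglyMeasurable
    · exact (ha.decay.mul (hb.decay'.apply v)).integrable (by norm_num)
        (ha.continuous.mul (hm2 v)).aestronglyMeasurable
  have h1 := key Complex.I 1
  have h2 := key 1 Complex.I
  have : ∀ z, b'' z 1 Complex.I = b'' z Complex.I 1 := fun z =>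
    second_derivative_symmetric hb.hasFDerivAt (hb.hasFDerivAt' z) _ _
  simp only [this] at h1
  rw [h1] at h2
  exact neg_injective h2

/-- The Jacobian is a null Lagrangian. -/
lemma integral_wirtinger_mul (ha : IsPotential a a' a'') (hb : IsPotential b b' b'') :
    ∫ z, wirtinger (a' z) * wirtingerBar (b' z) = ∫ z, wirtingerBar (a' z) * wirtinger (b' z) := by
  have hm : ∀ v, Continuous (fun z => a' z v) := fun v => by
    have := ha.continuous'; fun_prop
  have hm2 : ∀ v, Continuous (fun z => b' z v) := fun v => by
    have := hb.continuous'; fun_prop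
  have hi : ∀ v w, Integrable (fun z => a' z v * b' z w) := fun v w =>
    ((ha.decay'.apply v).mul (hb.decay'.apply w)).integrable (by norm_num)
        ((hm v).mul (hm2 w)).aestronglyMeasurable
  -- The difference of the two integrands is `i/2` times the Jacobian determinant.
  have hd : ∀ (a b c d : ℂ) , (a - Complex.I * b) / 2 * ((c + Complex.I * d) / 2) -
      (a + Complex.I * b) / 2 * ((c - Complex.I * d) / 2) =
      (Complex.I / 2) * (a * d - b * c) := by intros; ring
  have i1 : Integrable (fun z => wirtinger (a' z) * wirtingerBar (b' z)) := by
    have := ((hi 1 1).add ((hi 1 Complex.I).const_mul Complex.I)).sub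
      (((hi Complex.I 1).const_mul Complex.I).add
        ((hi Complex.I Complex.I).const_mul (Complex.I * Complex.I)))
    refine (this.const_mul (1/4)).congr (Eventually.of_forall fun z => ?_)
    simp only [wirtinger, wirtingerBar, Pi.add_apply, Pi.sub_apply]; ring
  have i2 : Integrable (fun z => wirtingerBar (a' z) * wirtinger (b' z)) := by
    have := ((hi 1 1).sub ((hi 1 Complex.I).const_mul Complex.I)).add
      (((hi Complex.I 1).const_mul Complex.I).sub
        ((hi Complex.I Complex.I).const_mul (Complex.I * Complex.I)))
    refine (this.const_mul (1/4)).congr (Eventually.of_forall fun z => ?_)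
    simp only [wirtinger, wirtingerBar, Pi.add_apply, Pi.sub_apply]; ring
  rw [← sub_eq_zero, ← integral_sub i1 i2]
  simp only [wirtinger, wirtingerBar, hd]
  rw [integral_const_mul, integral_sub (hi _ _) (hi _ _), integral_cross ha hb]
  simp

end IsPotential

/-! ### The regularised Cauchy kernel and its Wirtinger derivatives. -/

lemma HasDerivAt.ite_lt {f g : ℝ → ℝ} {f' g' : ℝ → ℝ} {a : ℝ}
    (hf : ∀ t ≤ a, HasDerivAt f (f' t) t) (hg : ∀ t, a ≤ t → HasDerivAt g (g' t) t)
    (h0 : f a = g a) (h1 : f' a = g' a) (t : ℝ) :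
    HasDerivAt (fun t => if t < a then f t else g t) (if t < a then f' t else g' t) t := by
  rcases lt_trichotomy t a with h | h | h
  · rw [if_pos h]
    refine (hf t h.le).congr_of_eventuallyEq ?_
    filter_upwards [Iio_mem_nhds h] with s hs using if_pos hs
  · subst h
    rw [if_neg (lt_irrefl _), ← hasDerivWithinAt_univ, ← Set.Iic_union_Ici (a := t)]
    refine HasDerivWithinAt.union ?_ ?_
    · rw [← h1]
      refine (hf t le_rfl).hasDerivWithinAt.congr (fun s hs => ?_) (by simp [h0])
      rcases (Set.mem_Iic.1 hs).lt_or_eq with h | h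
      · simp [h]
      · simp [h, h0]
    · refine (hg t le_rfl).hasDerivWithinAt.congr (fun s hs => ?_) (by simp)
      simp [not_lt.2 (Set.mem_Ici.1 hs)]
  · rw [if_neg h.not_gt]
    refine (hg t h.le).congr_of_eventuallyEq ?_
    filter_upwards [Ioi_mem_nhds h] with s hs using if_neg (not_lt.2 (le_of_lt hs))

/-- A `C²` modification of `t ↦ 1 / t` near the origin. -/
def radialProfile (t : ℝ) : ℝ := if t < 1 then 3 - 3 * t + t ^ 2 else t⁻¹

/-- The derivative of `radialProfile`. -/
def radialProfileDeriv (t : ℝ) : ℝ := if t < 1 then 2 * t - 3 else -(t ^ 2)⁻¹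

lemma hasDerivAt_radialProfile (t : ℝ) :
    HasDerivAt radialProfile (radialProfileDeriv t) t := by
  refine HasDerivAt.ite_lt (f := fun t => 3 - 3 * t + t ^ 2) (g := fun t => t⁻¹) (a := 1)
    (f' := fun t => 2 * t - 3) (g' := fun t => -(t ^ 2)⁻¹) (fun t _ => ?_) (fun t ht => ?_)
    (by norm_num) (by norm_num) t
  · have := (((hasDerivAt_id t).const_mul 3).const_sub 3).add ((hasDerivAt_id t).pow 2)
    refine this.congr_deriv (by simp; ring)
  · exact hasDerivAt_inv (by linarith)

lemma hasDerivAt_radialProfileDeriv (t : ℝ) :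
    HasDerivAt radialProfileDeriv (if t < 1 then 2 else 2 * (t ^ 3)⁻¹) t := by
  refine HasDerivAt.ite_lt (f := fun t => 2 * t - 3) (g := fun t => -(t ^ 2)⁻¹) (a := 1)
    (f' := fun t => 2) (g' := fun t => 2 * (t ^ 3)⁻¹) (fun t _ => ?_) (fun t ht => ?_)
    (by norm_num) (by norm_num) t
  · exact (((hasDerivAt_id t).const_mul 2).sub_const 3).congr_deriv (by simp)
  · have h0 : t ≠ 0 := by linarith
    have := (((hasDerivAt_id t).pow 2).inv (by simpa using h0)).neg
    refine this.congr_deriv ?_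
    simp; field_simp

lemma contDiff_radialProfileDeriv : ContDiff ℝ 1 radialProfileDeriv := by
  rw [contDiff_one_iff_deriv]
  refine ⟨fun t => (hasDerivAt_radialProfileDeriv t).differentiableAt, ?_⟩
  have : deriv radialProfileDeriv = fun t => if t < 1 then 2 else 2 * (t ^ 3)⁻¹ :=
    funext fun t => (hasDerivAt_radialProfileDeriv t).deriv
  rw [this]
  refine continuous_iff_continuousAt.2 fun t => ?_
  -- Rewriting the case split through `max t 1` makes continuity automatic.
  have h2 : (fun t : ℝ => if t < 1 then (2:ℝ) else 2 * (t ^ 3)⁻¹) =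
      fun t => 2 * ((max t 1) ^ 3)⁻¹ := by
    ext t
    split_ifs with h
    · rw [max_eq_right h.le]; norm_num
    · rw [max_eq_left (not_lt.1 h)]
  rw [h2]
  have : (max t 1) ^ 3 ≠ 0 := by positivity
  fun_prop (disch := assumption)

lemma contDiff_radialProfile : ContDiff ℝ 2 radialProfile := by
  rw [show (2 : WithTop ℕ∞) = 1 + 1 by norm_num, contDiff_succ_iff_deriv]
  refine ⟨fun t => (hasDerivAt_radialProfile t).differentiableAt, by simp, ?_⟩
  rw [show deriv radialProfile = radialProfileDeriv from
    funext fun t => (hasDerivAt_radialProfile t).deriv]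
  exact contDiff_radialProfileDeriv

/-- A `C²` regularisation of `z ↦ 1 / z`, equal to it off the unit disc. -/
def cauchyReg (z : ℂ) : ℂ := starRingEnd ℂ z * (radialProfile (‖z‖ ^ 2) : ℝ)

/-- The Wirtinger derivative `∂/∂z` of `cauchyReg`: a regularisation of `-1 / z²`. -/
def beurlingReg (z : ℂ) : ℂ := starRingEnd ℂ z ^ 2 * (radialProfileDeriv (‖z‖ ^ 2) : ℝ)

/-- The Wirtinger derivative `∂/∂z̄` of `cauchyReg`: a nonnegative bump. -/
def discBump (z : ℂ) : ℝ := radialProfile (‖z‖ ^ 2) + ‖z‖ ^ 2 * radialProfileDeriv (‖z‖ ^ 2)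

lemma cauchyReg_of_one_le {z : ℂ} (hz : 1 ≤ ‖z‖) : cauchyReg z = z⁻¹ := by
  have h : ¬ ‖z‖ ^ 2 < 1 := not_lt.2 (one_le_pow₀ hz)
  rw [cauchyReg, radialProfile, if_neg h, Complex.inv_def, Complex.normSq_eq_norm_sq]

lemma beurlingReg_of_one_le {z : ℂ} (hz : 1 ≤ ‖z‖) : beurlingReg z = -(z ^ 2)⁻¹ := by
  have h : ¬ ‖z‖ ^ 2 < 1 := not_lt.2 (one_le_pow₀ hz)
  rw [beurlingReg, radialProfileDeriv, if_neg h, ← inv_pow z, Complex.inv_def,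
    Complex.normSq_eq_norm_sq]
  push_cast
  ring

lemma discBump_of_one_le {z : ℂ} (hz : 1 ≤ ‖z‖) : discBump z = 0 := by
  have h : ¬ ‖z‖ ^ 2 < 1 := not_lt.2 (one_le_pow₀ hz)
  have h0 : ‖z‖ ≠ 0 := by linarith
  rw [discBump, radialProfileDeriv, radialProfile, if_neg h, if_neg h]
  field_simp
  ring

/-- `3 - 3t + t²` is the second Taylor polynomial of `1/t` at `t = 1`. Multiplied by `t` it is `1 -
(1 - t)³`, whose derivative `3(1 - t)²` is the bump at `t = |z|²`; this is where its positivity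
comes from. -/
lemma discBump_of_lt_one {z : ℂ} (hz : ‖z‖ < 1) : discBump z = 3 * (1 - ‖z‖ ^ 2) ^ 2 := by
  have h : ‖z‖ ^ 2 < 1 := pow_lt_one₀ (norm_nonneg _) hz two_ne_zero
  rw [discBump, radialProfileDeriv, radialProfile, if_pos h, if_pos h]
  ring

lemma discBump_nonneg (z : ℂ) : 0 ≤ discBump z := by
  rcases lt_or_ge ‖z‖ 1 with h | h
  · rw [discBump_of_lt_one h]; positivity
  · rw [discBump_of_one_le h]

/-- Evenness makes the convolution operator its own transpose, as the duality argument needs. -/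
lemma beurlingReg_neg (z : ℂ) : beurlingReg (-z) = beurlingReg z := by
  simp [beurlingReg]

/-- The factor `z̄²` changes sign under a quarter turn. This is the cancellation behind the
vanishing mean on discs. -/
lemma beurlingReg_I_mul (z : ℂ) : beurlingReg (Complex.I * z) = -beurlingReg z := by
  simp [beurlingReg, mul_pow]

lemma contDiff_cauchyReg : ContDiff ℝ 2 cauchyReg := by
  have h1 : ContDiff ℝ 2 (fun z : ℂ => starRingEnd ℂ z) := Complex.conjCLE.contDiff
  have h2 : ContDiff ℝ 2 (fun z : ℂ => (radialProfile (‖z‖ ^ 2) : ℂ)) :=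
    Complex.ofRealCLM.contDiff.comp (contDiff_radialProfile.comp (contDiff_norm_sq ℝ))
  exact h1.mul h2

lemma contDiff_beurlingReg : ContDiff ℝ 1 beurlingReg := by
  have h1 : ContDiff ℝ 1 (fun z : ℂ => starRingEnd ℂ z) := Complex.conjCLE.contDiff
  have h2 : ContDiff ℝ 1 (fun z : ℂ => (radialProfileDeriv (‖z‖ ^ 2) : ℂ)) :=
    Complex.ofRealCLM.contDiff.comp (contDiff_radialProfileDeriv.comp (contDiff_norm_sq ℝ))
  exact (h1.pow 2).mul h2

lemma continuous_discBump : Continuous discBump := by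
  have h1 := contDiff_radialProfile.continuous
  have h2 := contDiff_radialProfileDeriv.continuous
  unfold discBump
  fun_prop

lemma fderiv_cauchyReg_apply (z v : ℂ) :
    fderiv ℝ cauchyReg z v = beurlingReg z * v + discBump z * starRingEnd ℂ v := by
  have h1 : HasFDerivAt (fun z : ℂ => starRingEnd ℂ z) (Complex.conjCLE : ℂ →L[ℝ] ℂ) z :=
    Complex.conjCLE.hasFDerivAt
  have h3 : HasFDerivAt (fun z : ℂ => ‖z‖ ^ 2) (2 • (innerSL ℝ z)) z :=
    (hasStrictFDerivAt_norm_sq z).hasFDerivAt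
  have h4 := (hasDerivAt_radialProfile (‖z‖ ^ 2)).comp_hasFDerivAt z h3
  have h2 := Complex.ofRealCLM.hasFDerivAt.comp z h4
  have h := h1.mul h2
  have h5 : fderiv ℝ cauchyReg z = _ := h.fderiv
  rw [h5]
  have hn : ((‖z‖ : ℂ)) ^ 2 = z * starRingEnd ℂ z := by
    rw [Complex.mul_conj, Complex.normSq_eq_norm_sq]; push_cast; rfl
  have hi : (v.re : ℂ) * z.re + v.im * z.im = (z * starRingEnd ℂ v + starRingEnd ℂ z * v) / 2 := by
    apply Complex.ext <;> simp <;> ring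
  simp [beurlingReg, discBump, hn]
  linear_combination (2 * starRingEnd ℂ z * radialProfileDeriv (‖z‖ ^ 2)) * hi

lemma wirtinger_fderiv_cauchyReg (z : ℂ) : wirtinger (fderiv ℝ cauchyReg z) = beurlingReg z := by
  simp only [wirtinger, fderiv_cauchyReg_apply, map_one, Complex.conj_I]
  linear_combination (-(1/2) * beurlingReg z + 1/2 * discBump z) * Complex.I_sq

lemma wirtingerBar_fderiv_cauchyReg (z : ℂ) :
    wirtingerBar (fderiv ℝ cauchyReg z) = discBump z := by
  simp only [wirtingerBar, fderiv_cauchyReg_apply, map_one, Complex.conj_I]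
  linear_combination ((1/2) * beurlingReg z - 1/2 * discBump z) * Complex.I_sq

/-- Only the exterior of the unit disc matters, by compactness. There the regularised kernels have
closed forms. -/
lemma HasDecay.of_continuous {E : Type*} [NormedAddCommGroup E] {m : ℕ} {k : ℂ → E}
    (hk : Continuous k) {C : ℝ} (hC : 0 ≤ C) (h : ∀ z, 1 < ‖z‖ → ‖k z‖ ≤ C * (‖z‖ ^ m)⁻¹) :
    HasDecay m k := by
  obtain ⟨D, hD⟩ := (isCompact_closedBall (0:ℂ) 1).exists_bound_of_continuousOn hk.continuousOn
  have hD0 : 0 ≤ D := (norm_nonneg _).trans (hD 0 (by simp))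
  refine ⟨(C + D) * 2 ^ m, by positivity, fun z => ?_⟩
  rcases lt_or_ge 1 ‖z‖ with hz | hz
  · refine (h z hz).trans ?_
    rw [mul_assoc]
    have : (‖z‖ ^ m)⁻¹ ≤ 2 ^ m * ((1 + ‖z‖) ^ m)⁻¹ := by
      rw [← inv_inv (2 ^ m : ℝ), ← mul_inv, ← inv_pow (2:ℝ), ← mul_pow]
      gcongr
      linarith
    gcongr
    linarith
  · have h1 : 1 ≤ 2 ^ m * ((1 + ‖z‖) ^ m)⁻¹ := by
      rw [← div_eq_mul_inv, one_le_div (by positivity)]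
      gcongr
      linarith
    have h2 := hD z (by simpa using hz)
    rw [mul_assoc]
    nlinarith

lemma isPotential_cauchyReg :
    IsPotential cauchyReg (fderiv ℝ cauchyReg) (fderiv ℝ (fderiv ℝ cauchyReg)) := by
  have hc := contDiff_cauchyReg
  have hc' : ContDiff ℝ 1 (fderiv ℝ cauchyReg) := hc.fderiv_right (by norm_num)
  have hev : ∀ z : ℂ, 1 < ‖z‖ → cauchyReg =ᶠ[𝓝 z] fun z => z⁻¹ := fun z hz => by
    filter_upwards [(isOpen_lt continuous_const continuous_norm).mem_nhds hz] with w hw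
      using cauchyReg_of_one_le (le_of_lt hw)
  have hf1 : ∀ z : ℂ, 1 < ‖z‖ →
      fderiv ℝ cauchyReg z = (-(z ^ 2)⁻¹) • ContinuousLinearMap.id ℝ ℂ := fun z hz => by
    have h0 : z ≠ 0 := norm_pos_iff.1 (by linarith)
    rw [(hev z hz).fderiv_eq]
    rw [((hasDerivAt_inv h0).hasFDerivAt.restrictScalars ℝ).fderiv]
    ext w; simp [mul_comm]
  have hf2 : ∀ z : ℂ, 1 < ‖z‖ → ‖fderiv ℝ (fderiv ℝ cauchyReg) z‖ ≤ 2 * (‖z‖ ^ 3)⁻¹ := by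
    intro z hz
    have h0 : z ≠ 0 := norm_pos_iff.1 (by linarith)
    have he : fderiv ℝ cauchyReg =ᶠ[𝓝 z]
        fun z => (-(z ^ 2)⁻¹) • ContinuousLinearMap.id ℝ ℂ := by
      filter_upwards [(isOpen_lt continuous_const continuous_norm).mem_nhds hz] with w hw
        using hf1 w hw
    rw [he.fderiv_eq]
    have h1 : HasDerivAt (fun z : ℂ => -(z ^ 2)⁻¹) (2 * (z ^ 3)⁻¹) z := by
      have := (((hasDerivAt_id z).pow 2).inv (by simpa using h0)).neg
      refine this.congr_deriv ?_
      simp; field_simp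
    have h2 := (h1.hasFDerivAt.restrictScalars ℝ).smul_const (ContinuousLinearMap.id ℝ ℂ)
    rw [h2.fderiv]
    refine ContinuousLinearMap.opNorm_le_bound _ (by positivity) fun v => ?_
    refine ContinuousLinearMap.opNorm_le_bound _ (by positivity) fun w => ?_
    simp
    apply le_of_eq; ring
  refine ⟨fun z => (hc.differentiable (by norm_num) z).hasFDerivAt,
    fun z => (hc'.differentiable (by norm_num) z).hasFDerivAt,
    hc'.continuous_fderiv (by norm_num), ?_, ?_, ?_⟩
  · refine HasDecay.of_continuous hc.continuous zero_le_one fun z hz => ?_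
    rw [cauchyReg_of_one_le hz.le]
    simp
  · refine HasDecay.of_continuous hc'.continuous zero_le_one fun z hz => ?_
    rw [hf1 z hz]
    refine ContinuousLinearMap.opNorm_le_bound _ (by positivity) fun v => ?_
    simp
  · exact HasDecay.of_continuous (hc'.continuous_fderiv (by norm_num)) zero_le_two hf2

lemma hasDecay_beurlingReg : HasDecay 2 beurlingReg :=
  isPotential_cauchyReg.decay'.of_le 1 zero_le_one fun z => by
    rw [← wirtinger_fderiv_cauchyReg, one_mul]; exact norm_wirtinger_le _

lemma norm_beurlingReg_le (z : ℂ) : ‖beurlingReg z‖ ≤ 3 := by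
  rw [beurlingReg, norm_mul, norm_pow, RCLike.norm_conj, Complex.norm_real, radialProfileDeriv]
  split_ifs with h
  · have : ‖2 * ‖z‖ ^ 2 - 3‖ ≤ 3 := by
      rw [Real.norm_eq_abs, abs_le]; constructor <;> nlinarith [sq_nonneg ‖z‖]
    nlinarith [sq_nonneg ‖z‖, norm_nonneg (2 * ‖z‖ ^ 2 - 3)]
  · have h1 : 1 ≤ ‖z‖ ^ 2 := not_lt.1 h
    rw [norm_neg, norm_inv, norm_pow, norm_pow, norm_norm]
    rw [← div_eq_mul_inv, div_le_iff₀ (by positivity)]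
    nlinarith

/-! ### Convolutions, the Schur test and Hölder bounds. -/

lemma integrable_smul_of_bounded {E : Type*} [NormedAddCommGroup E] [NormedSpace ℂ E]
    {g : ℂ → ℂ} (hg : Integrable g) {k : ℂ → E} (hk : Continuous k)
    {C : ℝ} (hC : ∀ z, ‖k z‖ ≤ C) (z : ℂ) : Integrable fun w => g w • k (z - w) := by
  have hC0 : 0 ≤ C := (norm_nonneg _).trans (hC 0)
  refine (hg.norm.mul_const C).mono'
    (hg.aestronglyMeasurable.smul (by fun_prop : Continuous _).aestronglyMeasurable)
    (Eventually.of_forall fun w => ?_)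
  rw [norm_smul]
  gcongr
  exact hC _

section Convolution

variable {E : Type*} [NormedAddCommGroup E] [NormedSpace ℝ E] [NormedSpace ℂ E]

/-- The convolution of a scalar density `g` with a kernel `k`. -/
def convKernel (g : ℂ → ℂ) (k : ℂ → E) (z : ℂ) : E := ∫ w, g w • k (z - w)

lemma hasFDerivAt_convKernel [IsScalarTower ℝ ℂ E] [SMulCommClass ℝ ℂ E]
    {g : ℂ → ℂ} (hg : Integrable g) {k : ℂ → E}
    {k' : ℂ → ℂ →L[ℝ] E} (hk : ∀ z, HasFDerivAt k (k' z) z) (hk' : Continuous k') {C D : ℝ}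
    (hC : ∀ z, ‖k z‖ ≤ C) (hD : ∀ z, ‖k' z‖ ≤ D) (z : ℂ) :
    HasFDerivAt (convKernel g k) (convKernel g k' z) z := by
  have hkc : Continuous k := continuous_iff_continuousAt.2 fun z => (hk z).continuousAt
  refine hasFDerivAt_integral_of_dominated_of_fderiv_le (s := Set.univ)
    (F := fun z w => g w • k (z - w)) (F' := fun z w => g w • k' (z - w))
    (bound := fun w => ‖g w‖ * D) univ_mem
    (Eventually.of_forall fun z =>
      (integrable_smul_of_bounded hg hkc hC z).aestronglyMeasurable)
    (integrable_smul_of_bounded hg hkc hC z)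
    (integrable_smul_of_bounded hg hk' hD z).aestronglyMeasurable ?_ (hg.norm.mul_const D) ?_
  · refine Eventually.of_forall fun w z _ => ?_
    rw [norm_smul]
    gcongr
    exact hD _
  · refine Eventually.of_forall fun w z _ => ?_
    have := ((hk (z - w)).comp z ((hasFDerivAt_id z).sub_const w)).const_smul (g w)
    exact this.congr_fderiv (by ext v; simp)

lemma continuous_convKernel {g : ℂ → ℂ} (hg : Integrable g) {k : ℂ → E} (hk : Continuous k)
    {C : ℝ} (hC : ∀ z, ‖k z‖ ≤ C) : Continuous (convKernel g k) := by
  refine continuous_of_dominated (bound := fun w => ‖g w‖ * C)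
    (fun z => (integrable_smul_of_bounded hg hk hC z).aestronglyMeasurable)
    (fun z => Eventually.of_forall fun w => ?_) (hg.norm.mul_const C)
    (Eventually.of_forall fun w => by fun_prop)
  rw [norm_smul]
  gcongr
  exact hC _

lemma hasDecay_convKernel {g : ℂ → ℂ} (hg : Continuous g) (hs : HasCompactSupport g) {m : ℕ}
    {k : ℂ → E} (hk : HasDecay m k) : HasDecay m (convKernel g k) := by
  obtain ⟨C, hC, hk⟩ := hk
  have hi : Integrable (fun w => ‖g w‖ * (1 + ‖w‖) ^ m) :=
    (by fun_prop : Continuous (fun w => ‖g w‖ * (1 + ‖w‖) ^ m)).integrable_of_hasCompactSupport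
      hs.norm.mul_right
  refine ⟨C * ∫ w, ‖g w‖ * (1 + ‖w‖) ^ m,
    mul_nonneg hC (integral_nonneg fun w => by positivity), fun z => ?_⟩
  rw [mul_right_comm, ← integral_const_mul]
  refine norm_integral_le_of_norm_le (hi.const_mul _) (Eventually.of_forall fun w => ?_)
  rw [norm_smul]
  -- Submultiplicativity of `1 + |·|` transfers the decay of `k` to the convolution, at the cost of
  -- a moment of `g`.
  have h1 : 1 + ‖z‖ ≤ (1 + ‖z - w‖) * (1 + ‖w‖) := by
    have := norm_add_le (z - w) w
    rw [sub_add_cancel] at this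
    nlinarith [norm_nonneg w, norm_nonneg (z - w)]
  have h2 : ((1 + ‖z - w‖) ^ m)⁻¹ ≤ ((1 + ‖z‖) ^ m)⁻¹ * (1 + ‖w‖) ^ m := by
    rw [← div_eq_inv_mul, inv_le_iff_one_le_mul₀ (by positivity), div_mul_eq_mul_div,
      one_le_div (by positivity), ← mul_pow]
    gcongr
    linarith
  calc ‖g w‖ * ‖k (z - w)‖ ≤ ‖g w‖ * (C * (((1 + ‖z‖) ^ m)⁻¹ * (1 + ‖w‖) ^ m)) := by
        gcongr
        exact (hk _).trans (by gcongr)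
    _ = _ := by ring

end Convolution

/-- All derivatives fall on the kernel, so the density needs no smoothness. -/
lemma IsPotential.convKernel {b : ℂ → ℂ} {b' : ℂ → ℂ →L[ℝ] ℂ} {b'' : ℂ → ℂ →L[ℝ] ℂ →L[ℝ] ℂ}
    (h : IsPotential b b' b'') {g : ℂ → ℂ} (hg : Continuous g) (hs : HasCompactSupport g) :
    IsPotential (convKernel g b) (convKernel g b') (convKernel g b'') := by
  have hi := hg.integrable_of_hasCompactSupport hs (μ := volume)
  obtain ⟨C0, -, h0⟩ := h.decay.bounded
  obtain ⟨C1, -, h1⟩ := h.decay'.bounded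
  obtain ⟨C2, -, h2⟩ := h.decay''.bounded
  exact ⟨hasFDerivAt_convKernel hi h.hasFDerivAt h.continuous' h0 h1,
    hasFDerivAt_convKernel hi h.hasFDerivAt' h.continuous'' h1 h2,
    continuous_convKernel hi h.continuous'' h2, hasDecay_convKernel hg hs h.decay,
    hasDecay_convKernel hg hs h.decay', hasDecay_convKernel hg hs h.decay''⟩

lemma wirtinger_convKernel {g : ℂ → ℂ} (hg : Integrable g) {k : ℂ → ℂ →L[ℝ] ℂ}
    (hk : Continuous k) {C : ℝ} (hC : ∀ z, ‖k z‖ ≤ C) (z : ℂ) :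
    wirtinger (convKernel g k z) = convKernel g (fun w => wirtinger (k w)) z := by
  have hi := integrable_smul_of_bounded hg hk hC z
  have hv : ∀ v : ℂ, Integrable fun w => g w * k (z - w) v := fun v =>
    (ContinuousLinearMap.apply ℝ ℂ v).integrable_comp hi
  rw [wirtinger, convKernel, ContinuousLinearMap.integral_apply hi,
    ContinuousLinearMap.integral_apply hi, convKernel, ← integral_const_mul, ← integral_sub,
    ← integral_div]
  · refine integral_congr_ae (Eventually.of_forall fun w => ?_)
    simp only [wirtinger, smul_apply, smul_eq_mul]
    ring
  · exact hv 1
  · exact (hv Complex.I).const_mul _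

lemma wirtingerBar_convKernel {g : ℂ → ℂ} (hg : Integrable g) {k : ℂ → ℂ →L[ℝ] ℂ}
    (hk : Continuous k) {C : ℝ} (hC : ∀ z, ‖k z‖ ≤ C) (z : ℂ) :
    wirtingerBar (convKernel g k z) = convKernel g (fun w => wirtingerBar (k w)) z := by
  have hi := integrable_smul_of_bounded hg hk hC z
  have hv : ∀ v : ℂ, Integrable fun w => g w * k (z - w) v := fun v =>
    (ContinuousLinearMap.apply ℝ ℂ v).integrable_comp hi
  rw [wirtingerBar, convKernel, ContinuousLinearMap.integral_apply hi,
    ContinuousLinearMap.integral_apply hi, convKernel, ← integral_const_mul, ← integral_add,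
    ← integral_div]
  · refine integral_congr_ae (Eventually.of_forall fun w => ?_)
    simp only [wirtingerBar, smul_apply, smul_eq_mul]
    ring
  · exact hv 1
  · exact (hv Complex.I).const_mul _

/-- Hölder's inequality behind the Schur test. -/
lemma lintegral_mul_rpow_le {β : Type*} [MeasurableSpace β] {μ : Measure β} {p : ℝ} (hp : 1 < p)
    {k f H G : β → ENNReal} (hk : AEMeasurable k μ) (hf : AEMeasurable f μ)
    (hH : AEMeasurable H μ) (hG : AEMeasurable G μ)
    (h : ∀ᵐ y ∂μ, 1 ≤ H y ^ (p - 1) * G y) :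
    (∫⁻ y, k y * f y ∂μ) ^ p ≤
      (∫⁻ y, k y * H y ∂μ) ^ (p - 1) * ∫⁻ y, k y * (G y * f y ^ p) ∂μ := by
  have hp0 : 0 < p := by linarith
  have hq := (Real.HolderConjugate.conjExponent hp).symm
  set q := p.conjExponent with hqdef
  have hq0 : 0 < q := hq.pos
  have hqp : 1 / q * p = p - 1 := by
    have := hq.sub_one_mul_conj
    rw [hqdef, Real.conjExponent]; field_simp
  have h1 := ENNReal.lintegral_mul_le_Lp_mul_Lq μ hq (f := fun y => (k y * H y) ^ (1 / q))
    (g := fun y => (k y * (G y * f y ^ p)) ^ (1 / p)) (by fun_prop) (by fun_prop)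
  simp only [← ENNReal.rpow_mul, one_div_mul_cancel hq0.ne', one_div_mul_cancel hp0.ne',
    ENNReal.rpow_one] at h1
  have h2 : ∫⁻ y, k y * f y ∂μ ≤ ∫⁻ y, (k y * H y) ^ (1 / q) * (k y * (G y * f y ^ p)) ^ (1 / p) ∂μ := by
    refine lintegral_mono_ae ?_
    filter_upwards [h] with y hy
    rw [ENNReal.mul_rpow_of_nonneg _ _ (by positivity),
      ENNReal.mul_rpow_of_nonneg _ _ (by positivity), ENNReal.mul_rpow_of_nonneg _ _ (by positivity),
      ← ENNReal.rpow_mul, mul_one_div_cancel hp0.ne', ENNReal.rpow_one]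
    have h3 : k y ^ (1 / q) * k y ^ (1 / p) = k y := by
      rw [← ENNReal.rpow_add_of_nonneg _ _ (by positivity) (by positivity)]
      have : 1 / q + 1 / p = 1 := by simpa using hq.inv_add_inv_eq_one
      rw [this, ENNReal.rpow_one]
    -- The `p`-th root of the hypothesis, using `(p - 1)/p = 1/q`.
    have h4 : 1 ≤ H y ^ (1 / q) * G y ^ (1 / p) := by
      have := ENNReal.one_le_rpow hy (z := 1 / p) (by positivity)
      rw [ENNReal.mul_rpow_of_nonneg _ _ (by positivity), ← ENNReal.rpow_mul] at this
      convert this using 3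
      rw [← hqp]; field_simp
    calc k y * f y = k y * 1 * f y := by ring
      _ ≤ (k y ^ (1 / q) * k y ^ (1 / p)) * (H y ^ (1 / q) * G y ^ (1 / p)) * f y := by
          rw [h3]; gcongr
      _ = _ := by ring
  calc (∫⁻ y, k y * f y ∂μ) ^ p
      ≤ ((∫⁻ y, k y * H y ∂μ) ^ (1 / q) * (∫⁻ y, k y * (G y * f y ^ p) ∂μ) ^ (1 / p)) ^ p := by
        gcongr; exact h2.trans h1
    _ = _ := by
        rw [ENNReal.mul_rpow_of_nonneg _ _ hp0.le, ← ENNReal.rpow_mul, ← ENNReal.rpow_mul,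
          one_div_mul_cancel hp0.ne', ENNReal.rpow_one, hqp]

/-- The Schur test with a weight `W` on the target and test functions `H`, `G`. -/
lemma lintegral_schur_le {α β : Type*} [MeasurableSpace α] [MeasurableSpace β] {μ : Measure α}
    {ν : Measure β} [SFinite μ] [SFinite ν] {p : ℝ} (hp : 1 < p) {k : α → β → ENNReal}
    (hk : Measurable (Function.uncurry k)) {f H G B : β → ENNReal} {W A : α → ENNReal}
    (hf : AEMeasurable f ν) (hH : Measurable H) (hG : Measurable G) (hW : Measurable W)
    (hA : Measurable A)
    (h : ∀ᵐ y ∂ν, 1 ≤ H y ^ (p - 1) * G y) (hkA : ∀ᵐ x ∂μ, ∫⁻ y, k x y * H y ∂ν ≤ A x)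
    (hkB : ∀ᵐ y ∂ν, ∫⁻ x, W x * A x ^ (p - 1) * k x y ∂μ ≤ B y) :
    ∫⁻ x, W x * (∫⁻ y, k x y * f y ∂ν) ^ p ∂μ ≤ ∫⁻ y, B y * (G y * f y ^ p) ∂ν := by
  calc ∫⁻ x, W x * (∫⁻ y, k x y * f y ∂ν) ^ p ∂μ
      ≤ ∫⁻ x, ∫⁻ y, W x * A x ^ (p - 1) * k x y * (G y * f y ^ p) ∂ν ∂μ := by
        refine lintegral_mono_ae ?_
        filter_upwards [hkA] with x hx
        have hkx : Measurable (k x) := hk.of_uncurry_left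
        calc W x * (∫⁻ y, k x y * f y ∂ν) ^ p
            ≤ W x * (A x ^ (p - 1) * ∫⁻ y, k x y * (G y * f y ^ p) ∂ν) := by
              gcongr
              refine (lintegral_mul_rpow_le hp hkx.aemeasurable hf hH.aemeasurable
                hG.aemeasurable h).trans ?_
              gcongr
          _ = _ := by
              rw [← mul_assoc, ← lintegral_const_mul'' _ (by fun_prop)]
              simp only [mul_assoc]
    _ = ∫⁻ y, ∫⁻ x, W x * A x ^ (p - 1) * k x y * (G y * f y ^ p) ∂μ ∂ν := by
        rw [lintegral_lintegral_swap]
        have h1 : AEMeasurable (fun z : α × β => f z.2) (μ.prod ν) := hf.comp_snd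
        have h2 : Measurable (fun z : α × β => k z.1 z.2) := hk
        have h3 : AEMeasurable (fun z : α × β => W z.1 * A z.1 ^ (p - 1) * k z.1 z.2 *
          (G z.2 * f z.2 ^ p)) (μ.prod ν) := by fun_prop
        exact h3
    _ ≤ _ := by
        refine lintegral_mono_ae ?_
        filter_upwards [hkB] with y hy
        have hky : Measurable (fun x => k x y) := hk.of_uncurry_right
        rw [lintegral_mul_const _ (by fun_prop)]
        gcongr

lemma eLpNorm_ofReal_rpow {α E : Type*} [MeasurableSpace α] [NormedAddCommGroup E]
    {μ : Measure α} {p : ℝ} (hp : 0 < p) (f : α → E) :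
    eLpNorm f (ENNReal.ofReal p) μ ^ p = ∫⁻ x, ‖f x‖ₑ ^ p ∂μ := by
  rw [eLpNorm_eq_lintegral_rpow_enorm_toReal (by simpa using hp) ENNReal.ofReal_ne_top,
    ENNReal.toReal_ofReal hp.le, ← ENNReal.rpow_mul, one_div_mul_cancel hp.ne', ENNReal.rpow_one]

/-- Decay of order `2` is critical in the plane: it misses `L¹`, but `2q > 2` for each `q > 1`. -/
lemma HasDecay.memLp {k : ℂ → ℂ} (hk : HasDecay 2 k) (hm : AEStronglyMeasurable k) {q : ℝ}
    (hq : 1 < q) : MemLp k (ENNReal.ofReal q) := by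
  obtain ⟨C, hC, hk⟩ := hk
  have h0 : MemLp (fun z : ℂ => C * ((1 + ‖z‖) ^ 2)⁻¹) (ENNReal.ofReal q) := by
    rw [← integrable_norm_rpow_iff (by measurability) (by simp; linarith) ENNReal.ofReal_ne_top,
      ENNReal.toReal_ofReal (by linarith)]
    have : Integrable (fun z : ℂ => C ^ q * (1 + ‖z‖) ^ (-(2 * q))) :=
      (integrable_one_add_norm (by simp [Complex.finrank_real_complex]; linarith)).const_mul _
    refine this.congr (Eventually.of_forall fun z => ?_)
    have h1 : 0 ≤ ((1 + ‖z‖) ^ 2)⁻¹ := by positivity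
    dsimp only
    rw [Real.norm_of_nonneg (by positivity), Real.mul_rpow hC h1, ← Real.rpow_natCast,
      ← Real.rpow_neg (by positivity), ← Real.rpow_mul (by positivity)]
    norm_num
  exact h0.mono hm (Eventually.of_forall fun z => (hk z).trans (le_abs_self _))

section Hoelder

variable {p : ℝ} {f k : ℂ → ℂ}

lemma memLp_comp_sub_left {q : ENNReal} (hk : MemLp k q) (z : ℂ) :
    MemLp (fun w => k (z - w)) q :=
  hk.comp_measurePreserving (Measure.measurePreserving_sub_left volume z)

lemma integrable_smul_of_memLp (hp : 1 < p) (hf : MemLp f (ENNReal.ofReal p))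
    (hk : MemLp k (ENNReal.ofReal p.conjExponent)) (z : ℂ) :
    Integrable fun w => f w • k (z - w) := by
  have : ENNReal.HolderConjugate (ENNReal.ofReal p) (ENNReal.ofReal p.conjExponent) :=
    (Real.HolderConjugate.conjExponent hp).ennrealOfReal
  exact MemLp.integrable_mul hf (memLp_comp_sub_left hk z)

lemma lintegral_enorm_smul_le (hp : 1 < p) (hf : AEStronglyMeasurable f)
    (hk : MemLp k (ENNReal.ofReal p.conjExponent)) (z : ℂ) :
    ∫⁻ w, ‖f w • k (z - w)‖ₑ ≤
      eLpNorm f (ENNReal.ofReal p) * eLpNorm k (ENNReal.ofReal p.conjExponent) := by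
  have : ENNReal.HolderConjugate (ENNReal.ofReal p) (ENNReal.ofReal p.conjExponent) :=
    (Real.HolderConjugate.conjExponent hp).ennrealOfReal
  rw [← eLpNorm_one_eq_lintegral_enorm]
  refine (eLpNorm_smul_le_mul_eLpNorm (p := ENNReal.ofReal p)
    (q := ENNReal.ofReal p.conjExponent) (memLp_comp_sub_left hk z).1 hf).trans ?_
  rw [← eLpNorm_comp_measurePreserving hk.1 (Measure.measurePreserving_sub_left volume z)]
  rfl

lemma enorm_convKernel_le (hp : 1 < p) (hf : AEStronglyMeasurable f)
    (hk : MemLp k (ENNReal.ofReal p.conjExponent)) (z : ℂ) :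
    ‖convKernel f k z‖ₑ ≤
      eLpNorm f (ENNReal.ofReal p) * eLpNorm k (ENNReal.ofReal p.conjExponent) :=
  (enorm_integral_le_lintegral_enorm _).trans (lintegral_enorm_smul_le hp hf hk z)

lemma convKernel_sub (hp : 1 < p) {g : ℂ → ℂ} (hf : MemLp f (ENNReal.ofReal p))
    (hg : MemLp g (ENNReal.ofReal p)) (hk : MemLp k (ENNReal.ofReal p.conjExponent)) (z : ℂ) :
    convKernel (f - g) k z = convKernel f k z - convKernel g k z := by
  rw [convKernel, convKernel, convKernel, ← integral_sub (integrable_smul_of_memLp hp hf hk z)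
    (integrable_smul_of_memLp hp hg hk z)]
  simp only [Pi.sub_apply, sub_smul]

lemma tendsto_convKernel (hp : 1 < p) {ι : Type*} {l : Filter ι} {g : ι → ℂ → ℂ}
    (hf : MemLp f (ENNReal.ofReal p)) (hg : ∀ i, MemLp (g i) (ENNReal.ofReal p))
    (hk : MemLp k (ENNReal.ofReal p.conjExponent))
    (h : Tendsto (fun i => eLpNorm (f - g i) (ENNReal.ofReal p)) l (𝓝 0)) (z : ℂ) :
    Tendsto (fun i => convKernel (g i) k z) l (𝓝 (convKernel f k z)) := by
  rw [tendsto_iff_edist_tendsto_0]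
  have h1 : Tendsto (fun i => eLpNorm (f - g i) (ENNReal.ofReal p) *
      eLpNorm k (ENNReal.ofReal p.conjExponent)) l (𝓝 0) := by
    rw [← zero_mul (eLpNorm k (ENNReal.ofReal p.conjExponent))]
    exact ENNReal.Tendsto.mul_const h (Or.inr hk.2.ne)
  have h2 : ∀ i, edist (convKernel (g i) k z) (convKernel f k z) ≤
      eLpNorm (f - g i) (ENNReal.ofReal p) * eLpNorm k (ENNReal.ofReal p.conjExponent) := fun i => by
    rw [edist_comm, edist_eq_enorm_sub, ← convKernel_sub hp hf (hg i) hk]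
    exact enorm_convKernel_le hp (hf.sub (hg i)).1 hk z
  exact tendsto_of_tendsto_of_tendsto_of_le_of_le tendsto_const_nhds h1 (fun _ => zero_le) h2

/-- An `Lᵖ` bound for a convolution operator extends from `C_c` to `Lᵖ`. -/
lemma eLpNorm_convKernel_le_of_dense (hp : 1 < p)
    (hk : MemLp k (ENNReal.ofReal p.conjExponent)) {A : ENNReal} (hA : A ≠ ⊤)
    (h : ∀ g : ℂ → ℂ, Continuous g → HasCompactSupport g →
      eLpNorm (convKernel g k) (ENNReal.ofReal p) ≤ A * eLpNorm g (ENNReal.ofReal p))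
    (hf : MemLp f (ENNReal.ofReal p)) :
    eLpNorm (convKernel f k) (ENNReal.ofReal p) ≤ A * eLpNorm f (ENNReal.ofReal p) := by
  have hex : ∀ n : ℕ, ∃ g : ℂ → ℂ, HasCompactSupport g ∧
      eLpNorm (f - g) (ENNReal.ofReal p) ≤ ((n : ENNReal) + 1)⁻¹ ∧ Continuous g ∧
      MemLp g (ENNReal.ofReal p) := fun n =>
    hf.exists_hasCompactSupport_eLpNorm_sub_le ENNReal.ofReal_ne_top (by simp)
  choose g hgs hgl hgc hgm using hex
  have h0 : Tendsto (fun n => eLpNorm (f - g n) (ENNReal.ofReal p)) atTop (𝓝 0) := by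
    refine tendsto_of_tendsto_of_tendsto_of_le_of_le tendsto_const_nhds ?_
      (fun _ => zero_le) hgl
    have := (tendsto_add_atTop_iff_nat 1).2 ENNReal.tendsto_inv_nat_nhds_zero
    simpa using this
  have hp1 : (1 : ENNReal) ≤ ENNReal.ofReal p := by simpa using hp.le
  have hmeas : ∀ n, AEStronglyMeasurable (convKernel (g n) k) := fun n => by
    have : AEStronglyMeasurable (fun z : ℂ × ℂ => g n z.2 • k (z.1 - z.2))
        (volume.prod volume) :=
      (hgc n).comp continuous_snd |>.aestronglyMeasurable.smul
        (hk.1.comp_quasiMeasurePreserving (quasiMeasurePreserving_sub volume volume))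
    exact this.integral_prod_right'
  -- Hölder gives convergence at every point, so Fatou transfers the bound directly to the given
  -- convolution integral.
  refine (Lp.eLpNorm_lim_le_liminf_eLpNorm hmeas _
    (Eventually.of_forall fun z => tendsto_convKernel hp hf hgm hk h0 z)).trans ?_
  have h2 : Tendsto (fun n => A * (eLpNorm f (ENNReal.ofReal p) +
      eLpNorm (f - g n) (ENNReal.ofReal p))) atTop
      (𝓝 (A * (eLpNorm f (ENNReal.ofReal p) + 0))) :=
    ENNReal.Tendsto.const_mul (h0.const_add _) (Or.inr hA)
  rw [add_zero] at h2
  rw [← h2.liminf_eq]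
  refine liminf_le_liminf (Eventually.of_forall fun n => (h _ (hgc n) (hgs n)).trans ?_)
  gcongr
  have := eLpNorm_sub_le hf.1 (hf.sub (hgm n)).1 hp1
  simpa using this

end Hoelder

/-! ### The `L²` bound for the regularised Beurling transform. -/

lemma memLp_beurlingReg {q : ℝ} (hq : 1 < q) : MemLp beurlingReg (ENNReal.ofReal q) :=
  hasDecay_beurlingReg.memLp contDiff_beurlingReg.continuous.aestronglyMeasurable hq

/-- Apply the null-Lagrangian identity to `u = g * cauchyReg` and its conjugate: `∂̄ū` is the
conjugate of `∂u`, and vice versa, so both sides become squared norms. This plays the role of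
Plancherel. -/
lemma integral_norm_sq_convKernel {g : ℂ → ℂ} (hg : Continuous g) (hs : HasCompactSupport g) :
    ∫ z, ‖convKernel g beurlingReg z‖ ^ 2 =
      ∫ z, ‖convKernel g (fun w => (discBump w : ℂ)) z‖ ^ 2 := by
  have hi := hg.integrable_of_hasCompactSupport hs (μ := volume)
  have hu := isPotential_cauchyReg.convKernel hg hs
  obtain ⟨C, -, hC⟩ := isPotential_cauchyReg.decay'.bounded
  have h := hu.integral_wirtinger_mul hu.conj
  have h1 : ∀ L : ℂ →L[ℝ] ℂ, wirtingerBar ((Complex.conjCLE : ℂ →L[ℝ] ℂ).comp L) =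
      starRingEnd ℂ (wirtinger L) := fun L => by
    simp [wirtinger, wirtingerBar, Complex.conj_ofNat, sub_eq_add_neg]
  have h2 : ∀ L : ℂ →L[ℝ] ℂ, wirtinger ((Complex.conjCLE : ℂ →L[ℝ] ℂ).comp L) =
      starRingEnd ℂ (wirtingerBar L) := fun L => by
    simp [wirtinger, wirtingerBar, Complex.conj_ofNat, sub_eq_add_neg]
  simp only [h1, h2, Complex.mul_conj, Complex.normSq_eq_norm_sq,
    wirtinger_convKernel hi isPotential_cauchyReg.continuous' hC,
    wirtingerBar_convKernel hi isPotential_cauchyReg.continuous' hC,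
    wirtinger_fderiv_cauchyReg, wirtingerBar_fderiv_cauchyReg] at h
  rw [integral_complex_ofReal, integral_complex_ofReal] at h
  exact_mod_cast h

lemma hasDecay_discBump (m : ℕ) : HasDecay m (fun w => (discBump w : ℂ)) := by
  refine HasDecay.of_continuous (by have := continuous_discBump; fun_prop) le_rfl fun z hz => ?_
  rw [discBump_of_one_le hz.le]
  simp

/-- The total mass of `discBump`. -/
def discMass : ℝ := ∫ z, discBump z

lemma integrable_discBump : Integrable discBump := by
  have := (hasDecay_discBump 3).integrable le_rfl
    (by have := continuous_discBump; fun_prop : Continuous _).aestronglyMeasurable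
  simpa using this.re

lemma discMass_pos : 0 < discMass := by
  refine integral_pos_of_integrable_nonneg_nonzero continuous_discBump integrable_discBump
    discBump_nonneg (x := 0) ?_
  rw [discBump_of_lt_one (by simp)]
  norm_num

/-- Young's inequality, as the Schur test with constant test functions: both marginals of the kernel
equal `discMass`. -/
lemma lintegral_convKernel_discBump_le {g : ℂ → ℂ} (hg : AEMeasurable g) :
    ∫⁻ z, ‖convKernel g (fun w => (discBump w : ℂ)) z‖ₑ ^ (2 : ℝ) ≤
      ENNReal.ofReal discMass ^ 2 * ∫⁻ z, ‖g z‖ₑ ^ (2 : ℝ) := by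
  have hc := continuous_discBump.measurable
  have hm : ∫⁻ z, ENNReal.ofReal (discBump z) = ENNReal.ofReal discMass :=
    (ofReal_integral_eq_lintegral_ofReal integrable_discBump
      (Eventually.of_forall discBump_nonneg)).symm
  have h := lintegral_schur_le (p := 2) (μ := (volume : Measure ℂ)) (ν := (volume : Measure ℂ))
    (by norm_num)
    (k := fun z w => ENNReal.ofReal (discBump (z - w)))
    (f := fun w => ‖g w‖ₑ) (H := 1) (G := 1) (W := 1) (A := fun _ => ENNReal.ofReal discMass)
    (B := fun _ => ENNReal.ofReal discMass ^ 2)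
    (by unfold Function.uncurry; fun_prop) (by fun_prop) (by fun_prop) (by fun_prop)
    (by fun_prop) (by fun_prop) (by simp) ?_ ?_
  · refine le_trans ?_ (h.trans_eq ?_)
    · simp only [Pi.one_apply, one_mul]
      refine lintegral_mono fun z => ?_
      gcongr
      refine (enorm_integral_le_lintegral_enorm _).trans_eq (lintegral_congr fun w => ?_)
      rw [enorm_smul, mul_comm, ← ofReal_norm (discBump _ : ℂ), Complex.norm_real,
        Real.norm_of_nonneg (discBump_nonneg _)]
    · simp only [Pi.one_apply, one_mul]
      rw [lintegral_const_mul'' _ (by fun_prop)]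
  · refine Eventually.of_forall fun z => ?_
    simp only [Pi.one_apply, mul_one]
    rw [← hm, lintegral_sub_left_eq_self (fun w => ENNReal.ofReal (discBump w))]
  · refine Eventually.of_forall fun z => ?_
    simp only [Pi.one_apply, one_mul]
    rw [lintegral_const_mul _ (by fun_prop),
      lintegral_sub_right_eq_self (fun w => ENNReal.ofReal (discBump w)), hm, pow_two]
    norm_num

lemma eLpNorm_two_convKernel_beurlingReg_le {f : ℂ → ℂ} (hf : MemLp f (ENNReal.ofReal 2)) :
    eLpNorm (convKernel f beurlingReg) (ENNReal.ofReal 2) ≤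
      ENNReal.ofReal discMass * eLpNorm f (ENNReal.ofReal 2) := by
  have h2 : (2:ℝ).conjExponent = 2 := by norm_num [Real.conjExponent]
  refine eLpNorm_convKernel_le_of_dense (p := 2) (by norm_num)
    (by rw [h2]; exact memLp_beurlingReg (by norm_num)) ENNReal.ofReal_ne_top
    (fun g hg hs => ?_) hf
  have hK := hasDecay_convKernel hg hs hasDecay_beurlingReg
  have hQ := hasDecay_convKernel hg hs (hasDecay_discBump 2)
  have hi := hg.integrable_of_hasCompactSupport hs (μ := volume)
  obtain ⟨C, -, hC⟩ := hasDecay_beurlingReg.bounded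
  obtain ⟨D, -, hD⟩ := (hasDecay_discBump 2).bounded
  have cK := continuous_convKernel hi contDiff_beurlingReg.continuous hC
  have cQ := continuous_convKernel hi
    (by have := continuous_discBump; fun_prop : Continuous fun w => (discBump w : ℂ)) hD
  have hsq : ∀ F : ℂ → ℂ, HasDecay 2 F → Continuous F →
      ∫⁻ z, ‖F z‖ₑ ^ (2:ℝ) = ENNReal.ofReal (∫ z, ‖F z‖ ^ 2) := fun F hF cF => by
    have := (hF.mul hF).integrable (by norm_num) (cF.mul cF).aestronglyMeasurable
    rw [ofReal_integral_eq_lintegral_ofReal _ (Eventually.of_forall fun z => by positivity)]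
    · refine lintegral_congr fun z => ?_
      rw [ENNReal.ofReal_pow (norm_nonneg _), ofReal_norm]
      norm_cast
    · simpa [pow_two] using this.norm
  refine (ENNReal.rpow_le_rpow_iff (z := 2) (by norm_num)).1 ?_
  rw [ENNReal.mul_rpow_of_nonneg _ _ (by norm_num), eLpNorm_ofReal_rpow (by norm_num),
    eLpNorm_ofReal_rpow (by norm_num), hsq _ hK cK, integral_norm_sq_convKernel hg hs,
    ← hsq _ hQ cQ]
  exact_mod_cast lintegral_convKernel_discBump_le hg.aemeasurable

/-! ### Dyadic squares and the Calderón–Zygmund stopping time. -/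

/-- The half-open square of side `s` with lower left corner `(a s, b s)`. -/
def gridSquare (s : ℝ) (a b : ℤ) : Set ℂ := {z | ⌊z.re / s⌋ = a ∧ ⌊z.im / s⌋ = b}

/-- The centre of `gridSquare s a b`. -/
def gridCenter (s : ℝ) (a b : ℤ) : ℂ := ⟨(a + 1 / 2) * s, (b + 1 / 2) * s⟩

lemma measurableSet_gridSquare (s : ℝ) (a b : ℤ) : MeasurableSet (gridSquare s a b) := by
  have h1 : Measurable fun z : ℂ => ⌊z.re / s⌋ := by fun_prop
  have h2 : Measurable fun z : ℂ => ⌊z.im / s⌋ := by fun_prop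
  exact (h1 (measurableSet_singleton a)).inter (h2 (measurableSet_singleton b))

lemma mem_gridSquare_iff {s : ℝ} (hs : 0 < s) {a b : ℤ} {z : ℂ} :
    z ∈ gridSquare s a b ↔ z.re ∈ Set.Ico (a * s) ((a + 1) * s) ∧
      z.im ∈ Set.Ico (b * s) ((b + 1) * s) := by
  simp only [gridSquare, Set.mem_ofPred_eq, Int.floor_eq_iff, le_div_iff₀ hs, div_lt_iff₀ hs,
    Set.mem_Ico]

lemma volume_gridSquare {s : ℝ} (hs : 0 < s) (a b : ℤ) :
    volume (gridSquare s a b) = ENNReal.ofReal (s ^ 2) := by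
  have h : gridSquare s a b = Complex.measurableEquivRealProd ⁻¹'
      (Set.Ico (a * s) ((a + 1) * s) ×ˢ Set.Ico (b * s) ((b + 1) * s)) := by
    ext z
    simp [mem_gridSquare_iff hs, Complex.measurableEquivRealProd_apply]
  rw [h, Complex.volume_preserving_equiv_real_prod.measure_preimage
    (measurableSet_Ico.prod measurableSet_Ico).nullMeasurableSet, Measure.volume_eq_prod,
    Measure.prod_prod, Real.volume_Ico, Real.volume_Ico,
    ← ENNReal.ofReal_mul (by nlinarith)]
  ring_nf

lemma gridSquare_subset_closedBall {s : ℝ} (hs : 0 < s) (a b : ℤ) :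
    gridSquare s a b ⊆ Metric.closedBall (gridCenter s a b) s := by
  intro z hz
  rw [mem_gridSquare_iff hs] at hz
  obtain ⟨⟨h1, h2⟩, h3, h4⟩ := hz
  rw [mem_closedBall_iff_norm]
  refine (Complex.norm_le_abs_re_add_abs_im _).trans ?_
  simp only [Complex.sub_re, Complex.sub_im, gridCenter]
  have e1 : |z.re - (a + 1 / 2) * s| ≤ s / 2 := by rw [abs_le]; constructor <;> nlinarith
  have e2 : |z.im - (b + 1 / 2) * s| ≤ s / 2 := by rw [abs_le]; constructor <;> nlinarith
  linarith

lemma volume_closedBall_le_gridSquare {s : ℝ} (hs : 0 < s) (a b : ℤ) :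
    volume (Metric.closedBall (gridCenter s a b) (2 * s)) ≤ 16 * volume (gridSquare s a b) := by
  rw [Complex.volume_closedBall, volume_gridSquare hs, mul_comm, ← ENNReal.ofReal_pow (by linarith)]
  -- The disc of radius `2s` has area `4πs²`, hence the factor `16`.
  have h1 : (NNReal.pi : ENNReal) ≤ 4 := by
    have : NNReal.pi ≤ 4 := by
      rw [← NNReal.coe_le_coe]; simpa using Real.pi_le_four
    exact_mod_cast this
  calc (NNReal.pi : ENNReal) * ENNReal.ofReal ((2 * s) ^ 2)
      ≤ 4 * ENNReal.ofReal ((2 * s) ^ 2) := by gcongr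
    _ = 16 * ENNReal.ofReal (s ^ 2) := by
        rw [mul_pow, ENNReal.ofReal_mul (by norm_num), ← mul_assoc]
        norm_num

/-- The side of the dyadic squares of generation `m` when the largest ones have side `L`. -/
def dyadicSide (L : ℝ) (m : ℕ) : ℝ := L / 2 ^ m

lemma dyadicSide_pos {L : ℝ} (hL : 0 < L) (m : ℕ) : 0 < dyadicSide L m := by
  unfold dyadicSide; positivity

/-- The dyadic square of generation `m` containing `z`. -/
def dyadicSquare (L : ℝ) (m : ℕ) (z : ℂ) : Set ℂ :=
  gridSquare (dyadicSide L m) ⌊z.re / dyadicSide L m⌋ ⌊z.im / dyadicSide L m⌋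

lemma mem_dyadicSquare_self (L : ℝ) (m : ℕ) (z : ℂ) : z ∈ dyadicSquare L m z := ⟨rfl, rfl⟩

/-- Nesting of the grids reduces to integer division: the indices of a square determine those of all
its ancestors. -/
lemma floor_div_dyadicSide {L : ℝ} {m n : ℕ} (h : m ≤ n) (x : ℝ) :
    ⌊x / dyadicSide L m⌋ = ⌊x / dyadicSide L n⌋ / ((2 ^ (n - m) : ℕ) : ℤ) := by
  rw [← Int.floor_div_natCast, dyadicSide, dyadicSide]
  obtain ⟨k, rfl⟩ := Nat.exists_eq_add_of_le h
  congr 1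
  rw [Nat.add_sub_cancel_left, pow_add]
  push_cast
  field_simp

lemma dyadicSquare_eq_of_mem {L : ℝ} {m n : ℕ} (h : m ≤ n) {y z : ℂ}
    (hy : y ∈ dyadicSquare L n z) : dyadicSquare L m y = dyadicSquare L m z := by
  rw [dyadicSquare, dyadicSquare, floor_div_dyadicSide h y.re, floor_div_dyadicSide h y.im,
    floor_div_dyadicSide h z.re, floor_div_dyadicSide h z.im, hy.1, hy.2]

/-- Continuity replaces Lebesgue differentiation: if `‖f z‖ > t`, then `‖f‖` exceeds some `u > t` on
a whole small square around `z`, contradicting the bound on its average. The conclusion therefore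
holds at every point. -/
lemma le_of_forall_dyadicSquare {f : ℂ → ℂ} (hf : Continuous f) {L : ℝ} (hL : 0 < L)
    {t : ℝ} (ht : 0 < t) {z : ℂ}
    (h : ∀ m, ∫⁻ w in dyadicSquare L m z, ‖f w‖ₑ ≤
      ENNReal.ofReal t * volume (dyadicSquare L m z)) : ‖f z‖ ≤ t := by
  by_contra! hlt
  obtain ⟨u, hu1, hu2⟩ := exists_between hlt
  obtain ⟨ε, hε, hball⟩ := Metric.mem_nhds_iff.1
    ((isOpen_lt continuous_const hf.norm).mem_nhds (show u < ‖f z‖ from hu2))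
  obtain ⟨m, hm⟩ := exists_pow_lt_of_lt_one (show 0 < ε / (2 * L) by positivity)
    (show (1 / 2 : ℝ) < 1 by norm_num)
  have hs := dyadicSide_pos hL m
  have hs2 : 2 * dyadicSide L m < ε := by
    rw [lt_div_iff₀ (by positivity)] at hm
    calc 2 * dyadicSide L m = (1 / 2) ^ m * (2 * L) := by
          rw [dyadicSide, one_div, inv_pow]; ring
      _ < ε := hm
  have hsub : ∀ w ∈ dyadicSquare L m z, u ≤ ‖f w‖ := fun w hw => by
    have h1 := gridSquare_subset_closedBall hs _ _ hw
    have h2 := gridSquare_subset_closedBall hs _ _ (mem_dyadicSquare_self L m z)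
    refine le_of_lt (hball ?_)
    rw [Metric.mem_ball]
    have := dist_triangle_right w z (gridCenter (dyadicSide L m) ⌊z.re / dyadicSide L m⌋
      ⌊z.im / dyadicSide L m⌋)
    rw [Metric.mem_closedBall] at h1 h2
    linarith
  have hv : volume (dyadicSquare L m z) = ENNReal.ofReal (dyadicSide L m ^ 2) :=
    volume_gridSquare hs _ _
  have h3 : ENNReal.ofReal u * volume (dyadicSquare L m z) ≤
      ∫⁻ w in dyadicSquare L m z, ‖f w‖ₑ := by
    rw [← setLIntegral_const]
    refine setLIntegral_mono' (measurableSet_gridSquare _ _ _) fun w hw => ?_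
    rw [← ofReal_norm]
    exact ENNReal.ofReal_le_ofReal (hsub w hw)
  have h4 := h3.trans (h m)
  rw [hv] at h4
  have h5 := (ENNReal.mul_le_mul_iff_left (by simpa using hs.ne') ENNReal.ofReal_ne_top).1 h4
  rw [ENNReal.ofReal_le_ofReal_iff ht.le] at h5
  linarith

/-- The Calderón–Zygmund stopping-time decomposition of a continuous compactly supported
function at height `t`. -/
theorem exists_calderonZygmund_squares {f : ℂ → ℂ} (hf : Continuous f) (hs : HasCompactSupport f)
    {t : ℝ} (ht : 0 < t) :
    ∃ (ι : Type) (_ : Countable ι) (Q : ι → Set ℂ) (x : ι → ℂ) (r : ι → ℝ),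
      (∀ i, MeasurableSet (Q i)) ∧ Pairwise (Function.onFun Disjoint Q) ∧ (∀ i, 0 < r i) ∧
      (∀ i, volume (Q i) = ENNReal.ofReal (r i ^ 2)) ∧
      (∀ i, Q i ⊆ Metric.closedBall (x i) (r i)) ∧
      (∀ i, volume (Metric.closedBall (x i) (2 * r i)) ≤ 16 * volume (Q i)) ∧
      (∀ i, ENNReal.ofReal t * volume (Q i) ≤ ∫⁻ w in Q i, ‖f w‖ₑ) ∧
      (∀ i, ∫⁻ w in Q i, ‖f w‖ₑ ≤ 4 * ENNReal.ofReal t * volume (Q i)) ∧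
      ∀ z, z ∉ ⋃ i, Q i → ‖f z‖ ≤ t := by
  have hi := hf.integrable_of_hasCompactSupport hs (μ := volume)
  set M := ∫ w, ‖f w‖ with hMdef
  have hM : 0 ≤ M := integral_nonneg fun w => norm_nonneg _
  have hMl : ∫⁻ w, ‖f w‖ₑ = ENNReal.ofReal M := by
    rw [hMdef, ofReal_integral_norm_eq_lintegral_enorm hi]
  -- With so large an initial side no square of generation `0` has average above `t`, so every
  -- selected square has a parent that was rejected.
  obtain ⟨L, hL, hLM⟩ : ∃ L : ℝ, 0 < L ∧ M ≤ t * L ^ 2 := by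
    refine ⟨M / t + 1, by positivity, ?_⟩
    have : 0 ≤ M / t := by positivity
    calc M = t * (M / t) := by field_simp
      _ ≤ t * (M / t + 1) ^ 2 := by gcongr; nlinarith
  set S : ℕ → ℂ → Prop := fun m z => ENNReal.ofReal t * volume (dyadicSquare L m z) <
    ∫⁻ w in dyadicSquare L m z, ‖f w‖ₑ with hS
  have hSc : ∀ {m n : ℕ} {y z : ℂ}, m ≤ n → y ∈ dyadicSquare L n z → (S m y ↔ S m z) := by
    intro m n y z h hy
    simp only [hS, dyadicSquare_eq_of_mem h hy]
  have hS0 : ∀ z, ¬ S 0 z := fun z => by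
    simp only [hS, not_lt]
    calc ∫⁻ w in dyadicSquare L 0 z, ‖f w‖ₑ ≤ ∫⁻ w, ‖f w‖ₑ := setLIntegral_le_lintegral _ _
      _ ≤ ENNReal.ofReal (t * L ^ 2) := by rw [hMl]; exact ENNReal.ofReal_le_ofReal hLM
      _ = _ := by
        rw [dyadicSquare, volume_gridSquare (dyadicSide_pos hL 0), ENNReal.ofReal_mul ht.le]
        simp [dyadicSide]
  -- the selected squares, indexed by generation and position
  let P : ℕ × ℤ × ℤ → Prop := fun i => ∃ z ∈ gridSquare (dyadicSide L i.1) i.2.1 i.2.2,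
    S i.1 z ∧ ∀ m < i.1, ¬ S m z
  let ι := {i : ℕ × ℤ × ℤ // P i}
  let Q : ι → Set ℂ := fun i => gridSquare (dyadicSide L i.1.1) i.1.2.1 i.1.2.2
  have hQz : ∀ (i : ι), ∀ y ∈ Q i, dyadicSquare L i.1.1 y = Q i ∧ S i.1.1 y ∧
      ∀ m < i.1.1, ¬ S m y := by
    rintro ⟨⟨m, a, b⟩, z, hz, hz1, hz2⟩ y hy
    have e : ∀ y ∈ gridSquare (dyadicSide L m) a b, dyadicSquare L m y =
        gridSquare (dyadicSide L m) a b := fun y hy => by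
      rw [dyadicSquare, hy.1, hy.2]
    have hyz : y ∈ dyadicSquare L m z := by rw [e z hz]; exact hy
    exact ⟨e y hy, (hSc le_rfl hyz).2 hz1, fun n hn => (hSc hn.le hyz).not.2 (hz2 n hn)⟩
  have hlow : ∀ i, ENNReal.ofReal t * volume (Q i) ≤ ∫⁻ w in Q i, ‖f w‖ₑ := by
    intro i
    obtain ⟨z, hz, -, -⟩ := i.2
    obtain ⟨h1, h2, -⟩ := hQz i z hz
    simp only [hS, h1] at h2
    exact h2.le
  refine ⟨ι, inferInstance, Q, fun i => gridCenter (dyadicSide L i.1.1) i.1.2.1 i.1.2.2,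
    fun i => dyadicSide L i.1.1, fun i => measurableSet_gridSquare _ _ _, ?_,
    fun i => dyadicSide_pos hL _, fun i => volume_gridSquare (dyadicSide_pos hL _) _ _,
    fun i => gridSquare_subset_closedBall (dyadicSide_pos hL _) _ _,
    fun i => volume_closedBall_le_gridSquare (dyadicSide_pos hL _) _ _, hlow, ?_, ?_⟩
  · intro i j hij
    refine Set.disjoint_left.2 fun y hyi hyj => hij ?_
    obtain ⟨h1, h2, h3⟩ := hQz i y hyi
    obtain ⟨g1, g2, g3⟩ := hQz j y hyj
    have hm : i.1.1 = j.1.1 := by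
      rcases lt_trichotomy i.1.1 j.1.1 with h | h | h
      · exact absurd h2 (g3 _ h)
      · exact h
      · exact absurd g2 (h3 _ h)
    refine Subtype.ext (Prod.ext hm (Prod.ext ?_ ?_))
    · rw [← hyi.1, ← hyj.1, hm]
    · rw [← hyi.2, ← hyj.2, hm]
  · intro i
    obtain ⟨z, hz, -, -⟩ := i.2
    obtain ⟨h1, h2, h3⟩ := hQz i z hz
    obtain ⟨n, hn⟩ : ∃ n, i.1.1 = n + 1 := Nat.exists_eq_succ_of_ne_zero fun h0 => by
      rw [h0] at h2; exact hS0 z h2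
    have h4 := h3 n (by omega)
    simp only [hS, not_lt] at h4
    -- The parent was not selected, so its average is at most `t`. It has four times the area, hence
    -- the factor `4`.
    have hsub : Q i ⊆ dyadicSquare L n z := by
      rw [← h1]
      intro y hy
      rw [← dyadicSquare_eq_of_mem (show n ≤ i.1.1 by omega) hy]
      exact mem_dyadicSquare_self _ _ _
    refine (lintegral_mono_set hsub).trans (h4.trans_eq ?_)
    rw [dyadicSquare, volume_gridSquare (dyadicSide_pos hL n),
      show volume (Q i) = ENNReal.ofReal (dyadicSide L (n + 1) ^ 2) by
        rw [← hn]; exact volume_gridSquare (dyadicSide_pos hL _) _ _]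
    rw [mul_comm 4, mul_assoc]
    congr 1
    rw [show (4 : ENNReal) = ENNReal.ofReal 4 by norm_num, ← ENNReal.ofReal_mul (by norm_num)]
    congr 1
    rw [dyadicSide, dyadicSide, pow_succ]
    field_simp
    ring
  · intro z hz
    refine le_of_forall_dyadicSquare hf hL ht fun m => ?_
    by_contra! hcon
    have hex : ∃ m, S m z := ⟨m, hcon⟩
    classical
    refine hz (Set.mem_iUnion.2 ⟨⟨(Nat.find hex, ⌊z.re / dyadicSide L (Nat.find hex)⌋,
      ⌊z.im / dyadicSide L (Nat.find hex)⌋), z, ⟨rfl, rfl⟩, Nat.find_spec hex,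
      fun k hk => Nat.find_min hex hk⟩, ⟨rfl, rfl⟩⟩)

/-! ### Hörmander's condition and the weak type `(1,1)` inequality. -/

lemma lintegral_rpow_norm_gt {b R : ℝ} (hb : 2 < b) (hR : 0 < R) :
    ∫⁻ w in {w : ℂ | R < ‖w‖}, ENNReal.ofReal (‖w‖ ^ (-b)) =
      ENNReal.ofReal (2 * Real.pi * (R ^ (2 - b) / (b - 2))) := by
  have hv : (volume : Measure ℂ).real (Metric.ball 0 1) = Real.pi := by
    simp [Measure.real, Complex.volume_ball]
  set F : ℝ → ℝ := (Set.Ioi R).indicator fun r => r ^ (-b) with hF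
  have hms : MeasurableSet {w : ℂ | R < ‖w‖} := measurableSet_lt measurable_const measurable_norm
  have e1 : ∫⁻ w in {w : ℂ | R < ‖w‖}, ENNReal.ofReal (‖w‖ ^ (-b)) =
      ∫⁻ w : ℂ, ENNReal.ofReal (F ‖w‖) := by
    rw [← lintegral_indicator hms]
    refine lintegral_congr fun w => ?_
    by_cases h : R < ‖w‖
    · rw [Set.indicator_of_mem (by exact h), hF, Set.indicator_of_mem (by exact h)]
    · rw [Set.indicator_of_notMem (by exact h), hF, Set.indicator_of_notMem (by exact h)]
      simp
  have e2 : ∀ y ∈ Set.Ioi (0:ℝ), y ^ (Module.finrank ℝ ℂ - 1) • F y =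
      (Set.Ioi R).indicator (fun r => r ^ (1 - b)) y := fun y hy => by
    have hy : 0 < y := hy
    simp only [Complex.finrank_real_complex, hF, Set.indicator]
    split_ifs
    · rw [show 1 - b = 1 + -b by ring, Real.rpow_add hy]; simp
    · simp
  have hsub : Set.Ioi R ⊆ Set.Ioi 0 := Set.Ioi_subset_Ioi hR.le
  have i1 : IntegrableOn (fun r : ℝ => r ^ (1 - b)) (Set.Ioi R) :=
    integrableOn_Ioi_rpow_of_lt (by linarith) hR
  have hint : Integrable fun w : ℂ => F ‖w‖ := by
    rw [integrable_fun_norm_addHaar]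
    refine IntegrableOn.congr_fun ?_ (fun y hy => (e2 y hy).symm) measurableSet_Ioi
    exact (i1.integrable_indicator measurableSet_Ioi).integrableOn
  rw [e1, ← ofReal_integral_eq_lintegral_ofReal hint (Eventually.of_forall fun w => by
    simp only [hF]; exact Set.indicator_nonneg (fun r hr =>
      Real.rpow_nonneg (hR.le.trans (le_of_lt hr)) _) _)]
  rw [integral_fun_norm_addHaar, hv, setIntegral_congr_fun measurableSet_Ioi e2,
    setIntegral_indicator measurableSet_Ioi, Set.inter_eq_right.2 hsub,
    integral_Ioi_rpow_of_lt (by linarith) hR]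
  congr 1
  simp only [Complex.finrank_real_complex, nsmul_eq_mul, smul_eq_mul]
  rw [show 1 - b + 1 = 2 - b by ring, show b - 2 = -(2 - b) by ring]
  push_cast
  rw [neg_div, div_neg]
  ring

/-- Mean value inequality for the differential of `cauchyReg`, whose own derivative decays to third
order. On the ball of radius `R/2` about `z - x`, with `R = ‖z - x‖`, every point still has norm at
least `R/2`. -/
lemma norm_beurlingReg_sub_le : ∃ D : ℝ, 0 ≤ D ∧ ∀ (x y z : ℂ) (r : ℝ), 0 < r →
    ‖y - x‖ ≤ r → 2 * r < ‖z - x‖ →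
      ‖beurlingReg (z - y) - beurlingReg (z - x)‖ ≤ D * r * ‖z - x‖ ^ (-(3:ℝ)) := by
  obtain ⟨D, hD, h⟩ := isPotential_cauchyReg.decay''
  refine ⟨D * 8, by positivity, fun x y z r hr hy hz => ?_⟩
  set R := ‖z - x‖ with hR
  have hR0 : 0 < R := by linarith
  have hb : ∀ ξ ∈ Metric.closedBall (z - x) (R / 2),
      ‖fderiv ℝ (fderiv ℝ cauchyReg) ξ‖ ≤ D * ((R / 2) ^ 3)⁻¹ := fun ξ hξ => by
    refine (h ξ).trans ?_
    have : R / 2 ≤ ‖ξ‖ := by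
      rw [mem_closedBall_iff_norm] at hξ
      have := norm_sub_norm_le (z - x) ξ
      rw [norm_sub_rev (z - x) ξ] at this
      linarith
    gcongr
    linarith
  have hm := (convex_closedBall (z - x) (R / 2)).norm_image_sub_le_of_norm_hasFDerivWithin_le
    (fun ξ _ => (isPotential_cauchyReg.hasFDerivAt' ξ).hasFDerivWithinAt) hb
    (Metric.mem_closedBall_self (by positivity))
    (show z - y ∈ Metric.closedBall (z - x) (R / 2) by
      rw [mem_closedBall_iff_norm, show z - y - (z - x) = -(y - x) by ring, norm_neg]; linarith)
  rw [← wirtinger_fderiv_cauchyReg, ← wirtinger_fderiv_cauchyReg]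
  have hl : ∀ L M : ℂ →L[ℝ] ℂ, wirtinger L - wirtinger M = wirtinger (L - M) := fun L M => by
    simp only [wirtinger, sub_apply]; ring
  rw [hl]
  refine (norm_wirtinger_le _).trans (hm.trans ?_)
  rw [show z - y - (z - x) = -(y - x) by ring, norm_neg, Real.rpow_neg hR0.le]
  norm_cast
  calc D * ((R / 2) ^ 3)⁻¹ * ‖y - x‖ ≤ D * ((R / 2) ^ 3)⁻¹ * r := by gcongr
    _ = _ := by field_simp; norm_num

lemma exists_hoermander_bound : ∃ A : ENNReal, A ≠ ⊤ ∧ ∀ (x y : ℂ) (r : ℝ), 0 < r →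
    y ∈ Metric.closedBall x r →
      ∫⁻ z in (Metric.closedBall x (2 * r))ᶜ, ‖beurlingReg (z - y) - beurlingReg (z - x)‖ₑ ≤ A := by
  obtain ⟨D, hD, h⟩ := norm_beurlingReg_sub_le
  -- The tail integral of `|w|⁻³` beyond radius `2r` is `2π/(2r)`, which cancels the factor `r` from
  -- the kernel difference.
  refine ⟨ENNReal.ofReal (D * Real.pi), ENNReal.ofReal_ne_top, fun x y r hr hy => ?_⟩
  have hms : MeasurableSet {w : ℂ | 2 * r < ‖w‖} :=
    measurableSet_lt measurable_const measurable_norm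
  calc ∫⁻ z in (Metric.closedBall x (2 * r))ᶜ, ‖beurlingReg (z - y) - beurlingReg (z - x)‖ₑ
      ≤ ∫⁻ z in (Metric.closedBall x (2 * r))ᶜ,
          ENNReal.ofReal (D * r) * ENNReal.ofReal (‖z - x‖ ^ (-(3:ℝ))) := by
        refine setLIntegral_mono' Metric.isClosed_closedBall.measurableSet.compl fun z hz => ?_
        rw [← ofReal_norm, ← ENNReal.ofReal_mul (by positivity)]
        refine ENNReal.ofReal_le_ofReal (h x y z r hr (by simpa [dist_eq_norm] using hy) ?_)
        simpa [dist_eq_norm] using hz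
    _ = ENNReal.ofReal (D * r) *
          ∫⁻ w in {w : ℂ | 2 * r < ‖w‖}, ENNReal.ofReal (‖w‖ ^ (-(3:ℝ))) := by
        rw [lintegral_const_mul _ (by fun_prop)]
        congr 1
        rw [← lintegral_indicator Metric.isClosed_closedBall.measurableSet.compl,
          ← lintegral_indicator hms,
          ← lintegral_sub_right_eq_self ({w : ℂ | 2 * r < ‖w‖}.indicator _) x]
        refine lintegral_congr fun z => ?_
        simp only [Set.indicator, Set.mem_compl_iff, Metric.mem_closedBall, not_le, dist_eq_norm,
          Set.mem_ofPred_eq]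
    _ = ENNReal.ofReal (D * Real.pi) := by
        rw [lintegral_rpow_norm_gt (by norm_num) (by positivity), ← ENNReal.ofReal_mul (by positivity)]
        congr 1
        rw [show (2:ℝ) - 3 = -1 by norm_num, Real.rpow_neg_one]
        field_simp
        norm_num

/-- The far contribution of the bad part of a Calderón–Zygmund decomposition. -/
lemma setLIntegral_convKernel_bad_le {A : ENNReal} (hA : ∀ (x y : ℂ) (r : ℝ), 0 < r →
    y ∈ Metric.closedBall x r →
      ∫⁻ z in (Metric.closedBall x (2 * r))ᶜ, ‖beurlingReg (z - y) - beurlingReg (z - x)‖ₑ ≤ A)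
    {ι : Type*} [Countable ι] {Q : ι → Set ℂ} {x : ι → ℂ} {r : ι → ℝ}
    (hQm : ∀ i, MeasurableSet (Q i)) (hQd : Pairwise (Function.onFun Disjoint Q))
    (hr : ∀ i, 0 < r i) (hQ : ∀ i, Q i ⊆ Metric.closedBall (x i) (r i)) {b : ℂ → ℂ}
    (hb : Integrable b) (hb0 : ∀ z, z ∉ ⋃ i, Q i → b z = 0) (hbm : ∀ i, ∫ w in Q i, b w = 0) :
    ∫⁻ z in (⋃ i, Metric.closedBall (x i) (2 * r i))ᶜ, ‖convKernel b beurlingReg z‖ₑ ≤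
      A * ∫⁻ w, ‖b w‖ₑ := by
  have hKc := contDiff_beurlingReg.continuous
  have hint : ∀ z, Integrable fun w => b w • beurlingReg (z - w) := fun z =>
    integrable_smul_of_bounded hb hKc norm_beurlingReg_le z
  have hmeas : AEMeasurable (fun p : ℂ × ℂ => ‖b p.2‖ₑ) (volume.prod volume) :=
    hb.aestronglyMeasurable.enorm.comp_snd
  have hpt : ∀ z, ‖convKernel b beurlingReg z‖ₑ ≤ ∑' i, ∫⁻ w in Q i,
      ‖b w‖ₑ * ‖beurlingReg (z - w) - beurlingReg (z - x i)‖ₑ := fun z => by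
    have h1 : convKernel b beurlingReg z = ∫ w in ⋃ i, Q i, b w • beurlingReg (z - w) := by
      rw [convKernel, setIntegral_eq_integral_of_forall_compl_eq_zero]
      intro w hw
      rw [hb0 w hw, zero_smul]
    rw [h1, integral_iUnion hQm hQd (hint z).integrableOn]
    refine (enorm_tsum_le_tsum_enorm).trans (ENNReal.tsum_le_tsum fun i => ?_)
    -- The mean of `b` over each square vanishes, so the kernel frozen at the centre may be
    -- subtracted.
    have h2 : ∫ w in Q i, b w • beurlingReg (z - w) =
        ∫ w in Q i, b w • (beurlingReg (z - w) - beurlingReg (z - x i)) := by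
      simp only [smul_sub]
      rw [integral_sub (hint z).integrableOn (hb.integrableOn.smul_const _),
        integral_smul_const, hbm i, zero_smul, sub_zero]
    rw [h2]
    refine (enorm_integral_le_lintegral_enorm _).trans_eq ?_
    simp only [enorm_smul]
  set Ω := (⋃ i, Metric.closedBall (x i) (2 * r i))ᶜ with hΩ
  have hj : ∀ i, AEMeasurable (fun p : ℂ × ℂ =>
      ‖b p.2‖ₑ * ‖beurlingReg (p.1 - p.2) - beurlingReg (p.1 - x i)‖ₑ) (volume.prod volume) :=
    fun i => hmeas.mul (by fun_prop : Continuous fun p : ℂ × ℂ =>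
      beurlingReg (p.1 - p.2) - beurlingReg (p.1 - x i)).enorm.measurable.aemeasurable
  have hj' : ∀ i, AEMeasurable (fun p : ℂ × ℂ =>
      ‖b p.2‖ₑ * ‖beurlingReg (p.1 - p.2) - beurlingReg (p.1 - x i)‖ₑ)
      ((volume.restrict Ω).prod (volume.restrict (Q i))) := fun i => by
    rw [Measure.prod_restrict]
    exact (hj i).restrict
  calc ∫⁻ z in Ω, ‖convKernel b beurlingReg z‖ₑ
      ≤ ∫⁻ z in Ω, ∑' i, ∫⁻ w in Q i,
          ‖b w‖ₑ * ‖beurlingReg (z - w) - beurlingReg (z - x i)‖ₑ := lintegral_mono hpt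
    _ = ∑' i, ∫⁻ z in Ω, ∫⁻ w in Q i,
          ‖b w‖ₑ * ‖beurlingReg (z - w) - beurlingReg (z - x i)‖ₑ :=
        lintegral_tsum fun i => (hj' i).lintegral_prod_right'
    _ = ∑' i, ∫⁻ w in Q i, ∫⁻ z in Ω,
          ‖b w‖ₑ * ‖beurlingReg (z - w) - beurlingReg (z - x i)‖ₑ := by
        congr 1 with i
        exact lintegral_lintegral_swap (hj' i)
    _ ≤ ∑' i, ∫⁻ w in Q i, A * ‖b w‖ₑ := by
        refine ENNReal.tsum_le_tsum fun i => setLIntegral_mono' (hQm i) fun w hw => ?_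
        rw [lintegral_const_mul _ (by fun_prop), mul_comm]
        gcongr
        refine (lintegral_mono_set ?_).trans (hA (x i) w (r i) (hr i) (hQ i hw))
        rw [hΩ, Set.compl_subset_compl]
        exact Set.subset_iUnion (fun i => Metric.closedBall (x i) (2 * r i)) i
    _ = A * ∑' i, ∫⁻ w in Q i, ‖b w‖ₑ := by
        rw [← ENNReal.tsum_mul_left]
        congr 1 with i
        exact lintegral_const_mul'' _ hb.aestronglyMeasurable.enorm.restrict
    _ ≤ A * ∫⁻ w, ‖b w‖ₑ := by
        rw [← lintegral_iUnion hQm hQd]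
        gcongr
        exact Measure.restrict_le_self

/-- The splitting `f = g + b` attached to a Calderón–Zygmund family of squares. -/
lemma exists_good_bad {f : ℂ → ℂ} (hf : Integrable f) {t : ℝ}
    {ι : Type*} [Countable ι] {Q : ι → Set ℂ} (hQm : ∀ i, MeasurableSet (Q i))
    (hQd : Pairwise (Function.onFun Disjoint Q)) (hQ0 : ∀ i, volume (Q i) ≠ 0)
    (hQt : ∀ i, volume (Q i) ≠ ⊤)
    (hup : ∀ i, ∫⁻ w in Q i, ‖f w‖ₑ ≤ 4 * ENNReal.ofReal t * volume (Q i))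
    (hout : ∀ z, z ∉ ⋃ i, Q i → ‖f z‖ ≤ t) :
    ∃ g : ℂ → ℂ, Integrable g ∧ (∀ z, z ∉ ⋃ i, Q i → f z - g z = 0) ∧
      (∀ i, ∫ w in Q i, (f w - g w) = 0) ∧ ∫⁻ z, ‖g z‖ₑ ≤ ∫⁻ z, ‖f z‖ₑ ∧
      ∫⁻ z, ‖g z‖ₑ ^ (2:ℝ) ≤ 4 * ENNReal.ofReal t * ∫⁻ z, ‖f z‖ₑ := by
  classical
  set m : ι → ℂ := fun i => ⨍ w in Q i, f w with hm
  -- The good part is the average of `f` on each square and `f` itself elsewhere.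
  let g : ℂ → ℂ := fun z => if h : ∃ i, z ∈ Q i then m h.choose else f z
  have hgQ : ∀ i, ∀ z ∈ Q i, g z = m i := fun i z hz => by
    have h : ∃ i, z ∈ Q i := ⟨i, hz⟩
    have : h.choose = i := by
      by_contra hne
      exact Set.disjoint_left.1 (hQd hne) h.choose_spec hz
    simp only [g, dif_pos h, this]
  have hgO : ∀ z, z ∉ ⋃ i, Q i → g z = f z := fun z hz => by
    simp only [Set.mem_iUnion] at hz
    simp only [g, dif_neg hz]
  have hΩ : MeasurableSet (⋃ i, Q i) := MeasurableSet.iUnion hQm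
  have hgm : AEStronglyMeasurable g := by
    rw [← Measure.restrict_univ (μ := (volume : Measure ℂ)), ← Set.union_compl_self (⋃ i, Q i),
      aestronglyMeasurable_union_iff, aestronglyMeasurable_iUnion_iff]
    constructor
    · intro i
      refine (aestronglyMeasurable_const (b := m i)).congr ?_
      filter_upwards [ae_restrict_mem (hQm i)] with z hz using (hgQ i z hz).symm
    · refine hf.aestronglyMeasurable.restrict.congr ?_
      filter_upwards [ae_restrict_mem hΩ.compl] with z hz using (hgO z hz).symm
  have hmn : ∀ i, ‖m i‖ₑ * volume (Q i) ≤ ∫⁻ w in Q i, ‖f w‖ₑ := fun i => by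
    have h1 : volume.real (Q i) • m i = ∫ w in Q i, f w := by
      rw [hm]
      exact measure_smul_setAverage f (hQt i)
    have h2 : ‖m i‖ₑ * volume (Q i) = ‖∫ w in Q i, f w‖ₑ := by
      rw [← h1, enorm_smul, mul_comm]
      congr 1
      rw [Real.enorm_of_nonneg measureReal_nonneg, Measure.real, ENNReal.ofReal_toReal (hQt i)]
    rw [h2]
    exact enorm_integral_le_lintegral_enorm _
  have hm4 : ∀ i, ‖m i‖ₑ ≤ 4 * ENNReal.ofReal t := fun i =>
    (ENNReal.mul_le_mul_iff_left (hQ0 i) (hQt i)).1 ((hmn i).trans (hup i))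
  have hsplit : ∀ F : ℂ → ENNReal, ∫⁻ z, F z = (∑' i, ∫⁻ z in Q i, F z) +
      ∫⁻ z in (⋃ i, Q i)ᶜ, F z := fun F => by
    rw [← lintegral_add_compl F hΩ, lintegral_iUnion hQm hQd]
  have hl1 : ∫⁻ z, ‖g z‖ₑ ≤ ∫⁻ z, ‖f z‖ₑ := by
    rw [hsplit, hsplit fun z => ‖f z‖ₑ]
    refine add_le_add (ENNReal.tsum_le_tsum fun i => ?_) (le_of_eq ?_)
    · refine le_trans (le_of_eq ?_) (hmn i)
      rw [← setLIntegral_const]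
      exact setLIntegral_congr_fun (hQm i) fun z hz => by rw [hgQ i z hz]
    · exact setLIntegral_congr_fun hΩ.compl fun z hz => by rw [hgO z hz]
  have hgi : Integrable g := ⟨hgm, hl1.trans_lt hf.2⟩
  refine ⟨g, hgi, fun z hz => by rw [hgO z hz, sub_self], fun i => ?_, hl1, ?_⟩
  · rw [integral_sub hf.integrableOn hgi.integrableOn,
      setIntegral_congr_fun (hQm i) (g := fun _ => m i) fun z hz => hgQ i z hz,
      setIntegral_const, measure_smul_setAverage f (hQt i), sub_self]
  · have key : ∀ z, ‖g z‖ₑ ^ (2:ℝ) = ‖g z‖ₑ * ‖g z‖ₑ := fun z => by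
      rw [← pow_two]; norm_cast
    -- The good part is bounded by `4t`, so its squared `L²` norm is at most `4t` times its `L¹`
    -- norm.
    have hb : ∀ z, ‖g z‖ₑ ≤ 4 * ENNReal.ofReal t := fun z => by
      by_cases hz : z ∈ ⋃ i, Q i
      · obtain ⟨i, hi⟩ := Set.mem_iUnion.1 hz
        rw [hgQ i z hi]; exact hm4 i
      · rw [hgO z hz, ← ofReal_norm]
        calc ENNReal.ofReal ‖f z‖ ≤ ENNReal.ofReal t := ENNReal.ofReal_le_ofReal (hout z hz)
          _ ≤ 4 * ENNReal.ofReal t := le_mul_of_one_le_left zero_le (by norm_num)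
    calc ∫⁻ z, ‖g z‖ₑ ^ (2:ℝ) ≤ ∫⁻ z, 4 * ENNReal.ofReal t * ‖g z‖ₑ := by
          refine lintegral_mono fun z => ?_
          dsimp only
          rw [key]
          gcongr
          exact hb z
      _ = 4 * ENNReal.ofReal t * ∫⁻ z, ‖g z‖ₑ := lintegral_const_mul'' _ hgm.enorm
      _ ≤ _ := by gcongr

/-- The weak type `(1, 1)` inequality for the regularised Beurling transform. -/
theorem exists_weakType_one_one : ∃ A : ENNReal, A ≠ ⊤ ∧ ∀ f : ℂ → ℂ, Continuous f →
    HasCompactSupport f → ∀ t : ℝ, 0 < t →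
      ENNReal.ofReal t * volume {z | t < ‖convKernel f beurlingReg z‖} ≤ A * ∫⁻ z, ‖f z‖ₑ := by
  obtain ⟨H, hH, hHb⟩ := exists_hoermander_bound
  -- The three terms pay for the good part (Chebyshev in `L²`), for the union of the doubled discs,
  -- and for the bad part outside them.
  refine ⟨16 * ENNReal.ofReal discMass ^ (2:ℝ) + 16 + 4 * H, by finiteness,
    fun f hf hs t ht => ?_⟩
  have hfi := hf.integrable_of_hasCompactSupport hs (μ := volume)
  obtain ⟨ι, _, Q, x, r, hQm, hQd, hr, hQv, hQs, hQ16, hlow, hup, hout⟩ :=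
    exists_calderonZygmund_squares hf hs ht
  have hQ0 : ∀ i, volume (Q i) ≠ 0 := fun i => by
    rw [hQv]; simpa using (hr i).ne'
  have hQt : ∀ i, volume (Q i) ≠ ⊤ := fun i => by rw [hQv]; exact ENNReal.ofReal_ne_top
  obtain ⟨g, hgi, hb0, hbm, hg1, hg2⟩ := exists_good_bad hfi hQm hQd hQ0 hQt hup hout
  have hbi : Integrable fun z => f z - g z := hfi.sub hgi
  have hbad := setLIntegral_convKernel_bad_le hHb hQm hQd hr hQs hbi hb0 hbm
  set N := ∫⁻ z, ‖f z‖ₑ with hN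
  have hb1 : ∫⁻ z, ‖f z - g z‖ₑ ≤ 2 * N := by
    calc ∫⁻ z, ‖f z - g z‖ₑ ≤ ∫⁻ z, (‖f z‖ₑ + ‖g z‖ₑ) :=
          lintegral_mono fun z => enorm_sub_le
      _ = N + ∫⁻ z, ‖g z‖ₑ := lintegral_add_left' hfi.aestronglyMeasurable.enorm _
      _ ≤ 2 * N := by rw [two_mul]; gcongr
  have hKc := contDiff_beurlingReg.continuous
  set Ω := ⋃ i, Metric.closedBall (x i) (2 * r i) with hΩ
  have hΩm : MeasurableSet Ω :=
    MeasurableSet.iUnion fun i => Metric.isClosed_closedBall.measurableSet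
  have cg := continuous_convKernel hgi hKc norm_beurlingReg_le
  have cb := continuous_convKernel hbi hKc norm_beurlingReg_le
  have hT0 : ENNReal.ofReal t ≠ 0 := by simpa using ht
  have hTt : ENNReal.ofReal t ≠ ⊤ := ENNReal.ofReal_ne_top
  have hhalf : ENNReal.ofReal (t / 2) = ENNReal.ofReal t / 2 := by
    rw [ENNReal.ofReal_div_of_pos two_pos]; norm_num
  have hsub : {z | t < ‖convKernel f beurlingReg z‖} ⊆
      {z | ENNReal.ofReal (t / 2) ^ (2:ℝ) ≤ ‖convKernel g beurlingReg z‖ₑ ^ (2:ℝ)} ∪ Ω ∪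
        {z ∈ Ωᶜ | ENNReal.ofReal (t / 2) ≤ ‖convKernel (fun z => f z - g z) beurlingReg z‖ₑ} := by
    intro z hz
    by_cases hzΩ : z ∈ Ω
    · exact Or.inl (Or.inr hzΩ)
    have hsum : convKernel f beurlingReg z = convKernel g beurlingReg z +
        convKernel (fun z => f z - g z) beurlingReg z := by
      rw [convKernel, convKernel, convKernel,
        ← integral_add (integrable_smul_of_bounded hgi hKc norm_beurlingReg_le z)
          (integrable_smul_of_bounded hbi hKc norm_beurlingReg_le z)]
      simp only [sub_smul, add_sub_cancel]
    have hz : t < ‖convKernel f beurlingReg z‖ := hz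
    rw [hsum] at hz
    have h1 := hz.trans_le (norm_add_le _ _)
    rcases le_or_gt (t / 2) ‖convKernel g beurlingReg z‖ with h | h
    · refine Or.inl (Or.inl ?_)
      rw [Set.mem_ofPred_eq, ← ofReal_norm]
      gcongr
    · refine Or.inr ⟨hzΩ, ?_⟩
      rw [← ofReal_norm]
      exact ENNReal.ofReal_le_ofReal (by linarith)
  have e1 : ENNReal.ofReal t *
      volume {z | ENNReal.ofReal (t / 2) ^ (2:ℝ) ≤ ‖convKernel g beurlingReg z‖ₑ ^ (2:ℝ)} ≤
      16 * ENNReal.ofReal discMass ^ (2:ℝ) * N := by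
    have hg2m : MemLp g (ENNReal.ofReal 2) := by
      refine ⟨hgi.aestronglyMeasurable, ?_⟩
      rw [← ENNReal.rpow_lt_top_iff_of_pos (y := 2) (by norm_num), eLpNorm_ofReal_rpow (by norm_num)]
      exact hg2.trans_lt (ENNReal.mul_lt_top (by finiteness) hfi.2)
    have h1 := mul_meas_ge_le_lintegral₀ (μ := volume)
      (f := fun z => ‖convKernel g beurlingReg z‖ₑ ^ (2:ℝ))
      (cg.enorm.measurable.pow_const _).aemeasurable (ENNReal.ofReal (t / 2) ^ (2:ℝ))
    have h2 := ENNReal.rpow_le_rpow (eLpNorm_two_convKernel_beurlingReg_le hg2m)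
      (show (0:ℝ) ≤ 2 by norm_num)
    rw [ENNReal.mul_rpow_of_nonneg _ _ (by norm_num), eLpNorm_ofReal_rpow (by norm_num),
      eLpNorm_ofReal_rpow (by norm_num)] at h2
    set V := volume {z | ENNReal.ofReal (t / 2) ^ (2:ℝ) ≤ ‖convKernel g beurlingReg z‖ₑ ^ (2:ℝ)}
    have h3 : ENNReal.ofReal (t / 2) ^ (2:ℝ) * V ≤
        ENNReal.ofReal discMass ^ (2:ℝ) * (4 * ENNReal.ofReal t * N) :=
      h1.trans (h2.trans (by gcongr))
    have h4 : ENNReal.ofReal t * (ENNReal.ofReal t * V) =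
        4 * (ENNReal.ofReal (t / 2) ^ (2:ℝ) * V) := by
      rw [hhalf, ENNReal.rpow_two, div_eq_mul_inv, mul_pow, ← ENNReal.inv_pow]
      rw [show (2:ENNReal) ^ 2 = 4 by norm_num]
      calc ENNReal.ofReal t * (ENNReal.ofReal t * V)
          = (4 * 4⁻¹) * (ENNReal.ofReal t ^ 2 * V) := by
            rw [ENNReal.mul_inv_cancel (by norm_num) (by norm_num)]; ring
        _ = _ := by ring
    refine (ENNReal.mul_le_mul_iff_right hT0 hTt).1 ?_
    rw [h4]
    calc 4 * (ENNReal.ofReal (t / 2) ^ (2:ℝ) * V)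
        ≤ 4 * (ENNReal.ofReal discMass ^ (2:ℝ) * (4 * ENNReal.ofReal t * N)) := by gcongr
      _ = _ := by ring
  have e2 : ENNReal.ofReal t * volume Ω ≤ 16 * N := by
    calc ENNReal.ofReal t * volume Ω
        ≤ ENNReal.ofReal t * ∑' i, 16 * volume (Q i) := by
          gcongr
          exact (measure_iUnion_le _).trans (ENNReal.tsum_le_tsum hQ16)
      _ = 16 * ∑' i, ENNReal.ofReal t * volume (Q i) := by
          rw [ENNReal.tsum_mul_left, ENNReal.tsum_mul_left]; ring
      _ ≤ 16 * ∑' i, ∫⁻ w in Q i, ‖f w‖ₑ := by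
          gcongr with i
          exact hlow i
      _ ≤ 16 * N := by
          rw [← lintegral_iUnion hQm hQd]
          exact mul_le_mul' le_rfl (setLIntegral_le_lintegral _ _)
  have e3 : ENNReal.ofReal t * volume {z ∈ Ωᶜ | ENNReal.ofReal (t / 2) ≤
      ‖convKernel (fun z => f z - g z) beurlingReg z‖ₑ} ≤ 4 * H * N := by
    have h1 := mul_meas_ge_le_lintegral₀ (μ := volume.restrict Ωᶜ)
      (f := fun z => ‖convKernel (fun z => f z - g z) beurlingReg z‖ₑ)
      cb.enorm.measurable.aemeasurable (ENNReal.ofReal (t / 2))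
    rw [Measure.restrict_apply' hΩm.compl] at h1
    have h2 : {z ∈ Ωᶜ | ENNReal.ofReal (t / 2) ≤
        ‖convKernel (fun z => f z - g z) beurlingReg z‖ₑ} = {z | ENNReal.ofReal (t / 2) ≤
        ‖convKernel (fun z => f z - g z) beurlingReg z‖ₑ} ∩ Ωᶜ := by
      ext z; simp [and_comm]
    rw [h2]
    set V := volume ({z | ENNReal.ofReal (t / 2) ≤
        ‖convKernel (fun z => f z - g z) beurlingReg z‖ₑ} ∩ Ωᶜ)
    calc ENNReal.ofReal t * V = 2 * (ENNReal.ofReal (t / 2) * V) := by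
          rw [hhalf, ← mul_assoc, ENNReal.mul_div_cancel (by norm_num) (by norm_num)]
      _ ≤ 2 * (H * (2 * N)) :=
          mul_le_mul' le_rfl (h1.trans (hbad.trans (mul_le_mul' le_rfl hb1)))
      _ = 4 * H * N := by ring
  calc ENNReal.ofReal t * volume {z | t < ‖convKernel f beurlingReg z‖}
      ≤ ENNReal.ofReal t * (volume {z | ENNReal.ofReal (t / 2) ^ (2:ℝ) ≤
          ‖convKernel g beurlingReg z‖ₑ ^ (2:ℝ)} + volume Ω +
          volume {z ∈ Ωᶜ | ENNReal.ofReal (t / 2) ≤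
            ‖convKernel (fun z => f z - g z) beurlingReg z‖ₑ}) := by
        gcongr
        refine (measure_mono hsub).trans ((measure_union_le _ _).trans ?_)
        gcongr
        exact measure_union_le _ _
    _ ≤ 16 * ENNReal.ofReal discMass ^ (2:ℝ) * N + 16 * N + 4 * H * N := by
        rw [mul_add, mul_add]
        gcongr
    _ = _ := by ring

/-! ### Marcinkiewicz interpolation. -/

/-- The weak-type term of the layer-cake integral. Its factor `1/(p - 1)` turns, after duality, into
linear growth in the exponent. -/
lemma lintegral_rpow_ite_lt {p a : ℝ} (hp : 1 < p) (ha : 0 ≤ a) :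
    ∫⁻ t in Set.Ioi (0:ℝ), ENNReal.ofReal (t ^ (p - 2) * (if t < a then a else 0)) =
      ENNReal.ofReal (a ^ p / (p - 1)) := by
  have e : ∀ t ∈ Set.Ioi (0:ℝ), ENNReal.ofReal (t ^ (p - 2) * (if t < a then a else 0)) =
      (Set.Iio a).indicator (fun t => ENNReal.ofReal (t ^ (p - 2) * a)) t := fun t _ => by
    by_cases h : t < a
    · rw [Set.indicator_of_mem (by exact h), if_pos h]
    · rw [Set.indicator_of_notMem (by exact h), if_neg h]; simp
  rw [setLIntegral_congr_fun measurableSet_Ioi e, lintegral_indicator measurableSet_Iio,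
    Measure.restrict_restrict measurableSet_Iio, Set.Iio_inter_Ioi]
  have hint : IntervalIntegrable (fun t : ℝ => t ^ (p - 2) * a) volume 0 a :=
    (intervalIntegral.intervalIntegrable_rpow' (by linarith)).mul_const a
  rw [← ofReal_integral_eq_lintegral_ofReal
    (((intervalIntegrable_iff_integrableOn_Ioo_of_le ha).1 hint))
    ((ae_restrict_mem measurableSet_Ioo).mono fun t ht =>
      mul_nonneg (Real.rpow_nonneg ht.1.le _) ha),
    ← integral_Ioc_eq_integral_Ioo, ← intervalIntegral.integral_of_le ha,
    intervalIntegral.integral_mul_const, integral_rpow (Or.inl (by linarith)),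
    Real.zero_rpow (by linarith), sub_zero]
  congr 1
  rcases ha.eq_or_lt with rfl | h
  · rw [Real.zero_rpow (by linarith), Real.zero_rpow (by linarith)]; simp
  · rw [show p = (p - 2 + 1) + 1 by ring, Real.rpow_add_one h.ne' (p - 2 + 1)]
    ring_nf

/-- The strong-type term of the layer-cake integral. Below `a` the integrand is `t^(p-1)`, above it
`a^r t^(p-1-r)`; the two pieces give `1/p` and `1/(r - p)`. -/
lemma lintegral_rpow_min_le {p r a : ℝ} (hp : 1 < p) (hpr : p < r) (ha : 0 ≤ a) :
    ∫⁻ t in Set.Ioi (0:ℝ), ENNReal.ofReal (t ^ (p - 1 - r) * min a t ^ r) ≤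
      ENNReal.ofReal (a ^ p * (1 / p + 1 / (r - p))) := by
  rcases ha.eq_or_lt with rfl | ha0
  · rw [setLIntegral_congr_fun measurableSet_Ioi (g := fun _ => 0)]
    · simp
    · intro t ht
      dsimp only
      rw [min_eq_left (le_of_lt ht), Real.zero_rpow (by linarith)]; simp
  rw [← Set.Ioc_union_Ioi_eq_Ioi ha, lintegral_union measurableSet_Ioi
    (Set.Ioc_disjoint_Ioi le_rfl)]
  have e1 : ∫⁻ t in Set.Ioc 0 a, ENNReal.ofReal (t ^ (p - 1 - r) * min a t ^ r) =
      ENNReal.ofReal (a ^ p / p) := by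
    rw [setLIntegral_congr_fun measurableSet_Ioc (g := fun t => ENNReal.ofReal (t ^ (p - 1)))]
    · rw [← ofReal_integral_eq_lintegral_ofReal, ← intervalIntegral.integral_of_le ha,
        integral_rpow (Or.inl (by linarith))]
      · rw [Real.zero_rpow (by linarith)]; simp
      · exact (intervalIntegrable_iff_integrableOn_Ioc_of_le ha).1
          (intervalIntegral.intervalIntegrable_rpow' (by linarith))
      · exact (ae_restrict_mem measurableSet_Ioc).mono fun t ht => Real.rpow_nonneg ht.1.le _
    · intro t ht
      dsimp only
      rw [min_eq_right ht.2, ← Real.rpow_add ht.1]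
      ring_nf
  have e2 : ∫⁻ t in Set.Ioi a, ENNReal.ofReal (t ^ (p - 1 - r) * min a t ^ r) =
      ENNReal.ofReal (a ^ p / (r - p)) := by
    rw [setLIntegral_congr_fun measurableSet_Ioi
      (g := fun t => ENNReal.ofReal (t ^ (p - 1 - r) * a ^ r))]
    · rw [← ofReal_integral_eq_lintegral_ofReal, integral_mul_const,
        integral_Ioi_rpow_of_lt (by linarith) ha0]
      · congr 1
        rw [show p - 1 - r + 1 = p - r by ring, neg_div, ← div_neg, div_mul_eq_mul_div,
          ← Real.rpow_add ha0]
        ring_nf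
      · exact (integrableOn_Ioi_rpow_of_lt (by linarith) ha0).mul_const _
      · exact (ae_restrict_mem measurableSet_Ioi).mono fun t ht =>
          mul_nonneg (Real.rpow_nonneg (ha.trans (le_of_lt ht)) _) (Real.rpow_nonneg ha _)
    · intro t ht
      dsimp only
      rw [min_eq_left (le_of_lt ht)]
  rw [e1, e2, ← ENNReal.ofReal_add (by have := Real.rpow_nonneg ha p; positivity)
    (div_nonneg (Real.rpow_nonneg ha p) (by linarith))]
  exact ENNReal.ofReal_le_ofReal (le_of_eq (by ring))

/-- The truncation of `f` at height `t`. -/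
def truncateAt (t : ℝ) (f : ℂ → ℂ) (z : ℂ) : ℂ := ((t / max t ‖f z‖ : ℝ) : ℂ) * f z

/-- Radial truncation, unlike cutting with an indicator, keeps both pieces in `C_c`, where the two
endpoint bounds are assumed. -/
lemma continuous_truncateAt {t : ℝ} (ht : 0 < t) {f : ℂ → ℂ} (hf : Continuous f) :
    Continuous (truncateAt t f) := by
  have : ∀ z, max t ‖f z‖ ≠ 0 := fun z => by positivity
  unfold truncateAt
  fun_prop (disch := assumption)

lemma norm_truncateAt {t : ℝ} (ht : 0 < t) (f : ℂ → ℂ) (z : ℂ) :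
    ‖truncateAt t f z‖ = min ‖f z‖ t := by
  rw [truncateAt, norm_mul, Complex.norm_real, Real.norm_of_nonneg (by positivity)]
  rcases le_total t ‖f z‖ with h | h
  · rw [max_eq_right h, min_eq_right h]
    have : ‖f z‖ ≠ 0 := by linarith
    field_simp
  · rw [max_eq_left h, min_eq_left h, div_self ht.ne', one_mul]

lemma norm_sub_truncateAt_le {t : ℝ} (ht : 0 < t) (f : ℂ → ℂ) (z : ℂ) :
    ‖f z - truncateAt t f z‖ ≤ if t < ‖f z‖ then ‖f z‖ else 0 := by
  have h0 : f z - truncateAt t f z = ((1 - t / max t ‖f z‖ : ℝ) : ℂ) * f z := by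
    rw [truncateAt]; push_cast; ring
  rw [h0, norm_mul, Complex.norm_real]
  split_ifs with h
  · rw [max_eq_right h.le]
    have h1 : t / ‖f z‖ ≤ 1 := (div_le_one (by linarith)).2 h.le
    have h2 : 0 ≤ t / ‖f z‖ := by positivity
    rw [Real.norm_of_nonneg (by linarith)]
    nlinarith [norm_nonneg (f z)]
  · rw [max_eq_left (not_lt.1 h), div_self ht.ne']; simp

/-- Marcinkiewicz interpolation between weak type `(1, 1)` and strong type `(r, r)` for a
convolution operator on `C_c`. -/
theorem lintegral_rpow_convKernel_le_of_weakType {k : ℂ → ℂ} (hk : Continuous k) {M : ℝ}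
    (hM : ∀ z, ‖k z‖ ≤ M) {p r : ℝ} (hp : 1 < p) (hpr : p < r) {A B : ENNReal}
    (h1 : ∀ f : ℂ → ℂ, Continuous f → HasCompactSupport f → ∀ t : ℝ, 0 < t →
      ENNReal.ofReal t * volume {z | t < ‖convKernel f k z‖} ≤ A * ∫⁻ z, ‖f z‖ₑ)
    (hr : ∀ f : ℂ → ℂ, Continuous f → HasCompactSupport f →
      ∫⁻ z, ‖convKernel f k z‖ₑ ^ r ≤ B * ∫⁻ z, ‖f z‖ₑ ^ r)
    {f : ℂ → ℂ} (hf : Continuous f) (hs : HasCompactSupport f) :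
    ∫⁻ z, ‖convKernel f k z‖ₑ ^ p ≤ ENNReal.ofReal p *
      (2 * A * ENNReal.ofReal (1 / (p - 1)) +
        2 ^ r * B * ENNReal.ofReal (1 / p + 1 / (r - p))) * ∫⁻ z, ‖f z‖ₑ ^ p := by
  have hfi := hf.integrable_of_hasCompactSupport hs (μ := volume)
  have cT := continuous_convKernel hfi hk hM
  have hp0 : 0 < p := by linarith
  have hr0 : 0 < r := by linarith
  have ofr : ∀ (x : ℂ) (q : ℝ), 0 < q → ‖x‖ₑ ^ q = ENNReal.ofReal (‖x‖ ^ q) := fun x q hq => by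
    rw [← ofReal_norm, ENNReal.ofReal_rpow_of_nonneg (norm_nonneg _) hq.le]
  have hlayer := lintegral_rpow_eq_lintegral_meas_lt_mul (volume : Measure ℂ)
    (f := fun z => ‖convKernel f k z‖) (Eventually.of_forall fun z => norm_nonneg _)
    cT.norm.measurable.aemeasurable hp0
  -- At level `t` the function is truncated at the same height `t`: the excess is treated by the
  -- weak type bound and the truncation by the `L^r` bound with Chebyshev, each at level `t/2`.
  have hpt : ∀ t ∈ Set.Ioi (0:ℝ), volume {z | t < ‖convKernel f k z‖} * ENNReal.ofReal (t ^ (p - 1))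
      ≤ (∫⁻ z, 2 * A * ENNReal.ofReal (t ^ (p - 2) * (if t < ‖f z‖ then ‖f z‖ else 0))) +
        ∫⁻ z, 2 ^ r * B * ENNReal.ofReal (t ^ (p - 1 - r) * min ‖f z‖ t ^ r) := by
    intro t ht
    have ht : 0 < t := ht
    have clo := continuous_truncateAt ht hf
    have slo : HasCompactSupport (truncateAt t f) := hs.mul_left
    have chi : Continuous (f - truncateAt t f) := hf.sub clo
    have shi : HasCompactSupport (f - truncateAt t f) := hs.sub slo
    have iSlo := clo.integrable_of_hasCompactSupport slo (μ := volume)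
    have iShi := chi.integrable_of_hasCompactSupport shi (μ := volume)
    have hT2 : ENNReal.ofReal (t / 2) ≠ 0 := by simpa using ht
    have cTlo := continuous_convKernel iSlo hk hM
    have hsub : {z | t < ‖convKernel f k z‖} ⊆
        {z | t / 2 < ‖convKernel (f - truncateAt t f) k z‖} ∪
        {z | t / 2 < ‖convKernel (truncateAt t f) k z‖} := by
      intro z hz
      have hz : t < ‖convKernel f k z‖ := hz
      have hsum : convKernel f k z = convKernel (f - truncateAt t f) k z +
          convKernel (truncateAt t f) k z := by
        rw [convKernel, convKernel, convKernel,
          ← integral_add (integrable_smul_of_bounded iShi hk hM z)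
            (integrable_smul_of_bounded iSlo hk hM z)]
        simp only [Pi.sub_apply, sub_smul, sub_add_cancel]
      rw [hsum] at hz
      have h1 := hz.trans_le (norm_add_le _ _)
      by_contra hcon
      simp only [Set.mem_union, Set.mem_ofPred_eq, not_or, not_lt] at hcon
      linarith [hcon.1, hcon.2]
    have b1 : volume {z | t / 2 < ‖convKernel (f - truncateAt t f) k z‖} *
        ENNReal.ofReal (t ^ (p - 1)) ≤
        ∫⁻ z, 2 * A * ENNReal.ofReal (t ^ (p - 2) * (if t < ‖f z‖ then ‖f z‖ else 0)) := by
      have e1 : ENNReal.ofReal (t ^ (p - 1)) =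
          ENNReal.ofReal (2 * t ^ (p - 2)) * ENNReal.ofReal (t / 2) := by
        rw [← ENNReal.ofReal_mul (by positivity)]
        congr 1
        rw [show p - 1 = p - 2 + 1 by ring, Real.rpow_add_one ht.ne']
        ring
      have hms : Measurable fun z => (if t < ‖f z‖ then ‖f z‖ else 0) :=
        Measurable.ite (measurableSet_lt measurable_const hf.norm.measurable) hf.norm.measurable
          measurable_const
      calc _ = ENNReal.ofReal (2 * t ^ (p - 2)) * (ENNReal.ofReal (t / 2) *
            volume {z | t / 2 < ‖convKernel (f - truncateAt t f) k z‖}) := by rw [e1]; ring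
        _ ≤ ENNReal.ofReal (2 * t ^ (p - 2)) * (A * ∫⁻ z, ‖(f - truncateAt t f) z‖ₑ) :=
            mul_le_mul' le_rfl (h1 _ chi shi _ (by positivity))
        _ ≤ ENNReal.ofReal (2 * t ^ (p - 2)) *
            (A * ∫⁻ z, ENNReal.ofReal (if t < ‖f z‖ then ‖f z‖ else 0)) := by
            gcongr with z
            rw [← ofReal_norm]
            exact ENNReal.ofReal_le_ofReal (norm_sub_truncateAt_le ht f z)
        _ = _ := by
            rw [← mul_assoc, ← lintegral_const_mul _ (by fun_prop)]
            refine lintegral_congr fun z => ?_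
            rw [ENNReal.ofReal_mul (by positivity), ENNReal.ofReal_mul (by positivity)]
            norm_num
            ring
    have b2 : volume {z | t / 2 < ‖convKernel (truncateAt t f) k z‖} *
        ENNReal.ofReal (t ^ (p - 1)) ≤
        ∫⁻ z, 2 ^ r * B * ENNReal.ofReal (t ^ (p - 1 - r) * min ‖f z‖ t ^ r) := by
      have e1 : ENNReal.ofReal (t ^ (p - 1)) =
          ENNReal.ofReal (2 ^ r * t ^ (p - 1 - r)) * ENNReal.ofReal (t / 2) ^ r := by
        rw [ENNReal.ofReal_rpow_of_nonneg (by positivity) hr0.le,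
          ← ENNReal.ofReal_mul (by positivity)]
        congr 1
        rw [Real.div_rpow ht.le (by norm_num), mul_assoc, ← mul_div_assoc, ← Real.rpow_add ht]
        have : (2:ℝ) ^ r ≠ 0 := by positivity
        field_simp
        ring_nf
      have cheb : ENNReal.ofReal (t / 2) ^ r *
          volume {z | t / 2 < ‖convKernel (truncateAt t f) k z‖} ≤
          ∫⁻ z, ‖convKernel (truncateAt t f) k z‖ₑ ^ r := by
        refine le_trans ?_ (mul_meas_ge_le_lintegral₀ (μ := volume)
          (cTlo.enorm.measurable.pow_const r).aemeasurable (ENNReal.ofReal (t / 2) ^ r))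
        gcongr with z
        intro hz
        rw [← ofReal_norm]
        gcongr
      calc _ = ENNReal.ofReal (2 ^ r * t ^ (p - 1 - r)) * (ENNReal.ofReal (t / 2) ^ r *
            volume {z | t / 2 < ‖convKernel (truncateAt t f) k z‖}) := by rw [e1]; ring
        _ ≤ ENNReal.ofReal (2 ^ r * t ^ (p - 1 - r)) *
            (B * ∫⁻ z, ‖truncateAt t f z‖ₑ ^ r) :=
            mul_le_mul' le_rfl (cheb.trans (hr _ clo slo))
        _ = ENNReal.ofReal (2 ^ r * t ^ (p - 1 - r)) *
            (B * ∫⁻ z, ENNReal.ofReal (min ‖f z‖ t ^ r)) := by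
            congr 2
            refine lintegral_congr fun z => ?_
            rw [ofr _ _ hr0, norm_truncateAt ht]
        _ = _ := by
            rw [← mul_assoc, ← lintegral_const_mul _ (by fun_prop)]
            refine lintegral_congr fun z => ?_
            rw [ENNReal.ofReal_mul (by positivity), ENNReal.ofReal_mul (by positivity),
              ← ENNReal.ofReal_rpow_of_nonneg (by norm_num) hr0.le]
            norm_num
            ring
    calc _ ≤ (volume {z | t / 2 < ‖convKernel (f - truncateAt t f) k z‖} +
          volume {z | t / 2 < ‖convKernel (truncateAt t f) k z‖}) *
            ENNReal.ofReal (t ^ (p - 1)) := by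
          gcongr
          exact (measure_mono hsub).trans (measure_union_le _ _)
      _ ≤ _ := by rw [add_mul]; gcongr
  have hm1 : Measurable fun q : ℝ × ℂ =>
      ENNReal.ofReal (q.1 ^ (p - 2) * (if q.1 < ‖f q.2‖ then ‖f q.2‖ else 0)) := by
    have hms : Measurable fun q : ℝ × ℂ => (if q.1 < ‖f q.2‖ then ‖f q.2‖ else 0) :=
      Measurable.ite (measurableSet_lt measurable_fst (by fun_prop)) (by fun_prop)
        measurable_const
    fun_prop
  have hm2 : Measurable fun q : ℝ × ℂ =>
      ENNReal.ofReal (q.1 ^ (p - 1 - r) * min ‖f q.2‖ q.1 ^ r) := by fun_prop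
  have i1 : ∫⁻ t in Set.Ioi (0:ℝ), ∫⁻ z, 2 * A *
      ENNReal.ofReal (t ^ (p - 2) * (if t < ‖f z‖ then ‖f z‖ else 0)) =
      2 * A * ENNReal.ofReal (1 / (p - 1)) * ∫⁻ z, ‖f z‖ₑ ^ p := by
    rw [lintegral_lintegral_swap (hm1.const_mul _).aemeasurable,
      ← lintegral_const_mul _ (hf.enorm.measurable.pow_const p)]
    refine lintegral_congr fun z => ?_
    have hmz : Measurable fun t : ℝ =>
        ENNReal.ofReal (t ^ (p - 2) * (if t < ‖f z‖ then ‖f z‖ else 0)) :=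
      hm1.comp measurable_prodMk_right
    rw [lintegral_const_mul _ hmz,
      lintegral_rpow_ite_lt hp (norm_nonneg _), ofr _ _ hp0, mul_assoc (2 * A),
      ← ENNReal.ofReal_mul (by have : 0 < p - 1 := by linarith
                               positivity)]
    congr 2
    ring
  have i2 : ∫⁻ t in Set.Ioi (0:ℝ), ∫⁻ z, 2 ^ r * B *
      ENNReal.ofReal (t ^ (p - 1 - r) * min ‖f z‖ t ^ r) ≤
      2 ^ r * B * ENNReal.ofReal (1 / p + 1 / (r - p)) * ∫⁻ z, ‖f z‖ₑ ^ p := by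
    rw [lintegral_lintegral_swap (hm2.const_mul _).aemeasurable,
      ← lintegral_const_mul _ (hf.enorm.measurable.pow_const p)]
    refine lintegral_mono fun z => ?_
    dsimp only
    have hmz : Measurable fun t : ℝ => ENNReal.ofReal (t ^ (p - 1 - r) * min ‖f z‖ t ^ r) :=
      hm2.comp measurable_prodMk_right
    rw [lintegral_const_mul _ hmz, mul_assoc (2 ^ r * B)]
    gcongr
    refine (lintegral_rpow_min_le hp hpr (norm_nonneg _)).trans_eq ?_
    rw [ofr _ _ hp0, ← ENNReal.ofReal_mul (by have : 0 < r - p := by linarith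
                                              positivity)]
    congr 1
    ring
  calc ∫⁻ z, ‖convKernel f k z‖ₑ ^ p
      = ∫⁻ z, ENNReal.ofReal (‖convKernel f k z‖ ^ p) := lintegral_congr fun z => ofr _ _ hp0
    _ = _ := hlayer
    _ ≤ ENNReal.ofReal p * ∫⁻ t in Set.Ioi (0:ℝ),
        ((∫⁻ z, 2 * A * ENNReal.ofReal (t ^ (p - 2) * (if t < ‖f z‖ then ‖f z‖ else 0))) +
        ∫⁻ z, 2 ^ r * B * ENNReal.ofReal (t ^ (p - 1 - r) * min ‖f z‖ t ^ r)) := by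
        gcongr 1
        exact setLIntegral_mono' measurableSet_Ioi hpt
    _ ≤ _ := by
        rw [lintegral_add_left (hm1.const_mul _).lintegral_prod_right', i1, mul_assoc (ENNReal.ofReal p), add_mul]
        gcongr

/-! ### Duality and `Lᵖ` bounds growing linearly in `p`. -/

lemma eLpNorm_le_of_lintegral_rpow_le {f g : ℂ → ℂ} {p : ℝ} (hp : 0 < p) {A : ENNReal}
    (h : ∫⁻ z, ‖f z‖ₑ ^ p ≤ A * ∫⁻ z, ‖g z‖ₑ ^ p) :
    eLpNorm f (ENNReal.ofReal p) ≤ A ^ (1 / p) * eLpNorm g (ENNReal.ofReal p) := by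
  refine (ENNReal.rpow_le_rpow_iff hp).1 ?_
  rwa [ENNReal.mul_rpow_of_nonneg _ _ hp.le, ← ENNReal.rpow_mul, one_div_mul_cancel hp.ne',
    ENNReal.rpow_one, eLpNorm_ofReal_rpow hp, eLpNorm_ofReal_rpow hp]

lemma enorm_integral_mul_le {p q : ℝ} (hpq : p.HolderConjugate q) {f g : ℂ → ℂ}
    (hf : AEStronglyMeasurable f) (hg : AEStronglyMeasurable g) :
    ‖∫ w, f w * g w‖ₑ ≤ eLpNorm f (ENNReal.ofReal p) * eLpNorm g (ENNReal.ofReal q) := by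
  have : ENNReal.HolderConjugate (ENNReal.ofReal p) (ENNReal.ofReal q) := hpq.ennrealOfReal
  refine (enorm_integral_le_lintegral_enorm _).trans ?_
  rw [← eLpNorm_one_eq_lintegral_enorm]
  change eLpNorm (f • g) 1 volume ≤ _
  exact eLpNorm_smul_le_mul_eLpNorm hg hf

/-- Duality for convolution with an even kernel. -/
lemma eLpNorm_convKernel_le_of_dual {k : ℂ → ℂ} (hk : Continuous k) (hkd : HasDecay 2 k)
    (hke : ∀ z, k (-z) = k z) {p : ℝ} (hp : 2 ≤ p) {D : ENNReal}
    (h : ∀ g : ℂ → ℂ, MemLp g (ENNReal.ofReal p.conjExponent) →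
      eLpNorm (convKernel g k) (ENNReal.ofReal p.conjExponent) ≤
        D * eLpNorm g (ENNReal.ofReal p.conjExponent))
    {f : ℂ → ℂ} (hf : Continuous f) (hs : HasCompactSupport f) :
    eLpNorm (convKernel f k) (ENNReal.ofReal p) ≤ D * eLpNorm f (ENNReal.ofReal p) := by
  have hp1 : 1 < p := by linarith
  have hp0 : 0 < p := by linarith
  have hpq := Real.HolderConjugate.conjExponent hp1
  set q := p.conjExponent with hq
  have hq1 : 1 < q := hpq.symm.lt
  have hq0 : 0 < q := by linarith
  have hqp : q.conjExponent = p := (hpq.symm.conjExponent_eq)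
  have hpqm : (p - 1) * q = p := hpq.sub_one_mul_conj
  have hfi := hf.integrable_of_hasCompactSupport hs (μ := volume)
  obtain ⟨M, -, hM⟩ := hkd.bounded
  have cF := continuous_convKernel hfi hk hM
  set F := convKernel f k with hF
  have hFd : HasDecay 2 F := hasDecay_convKernel hf hs hkd
  have hFp : MemLp F (ENNReal.ofReal p) := hFd.memLp cF.aestronglyMeasurable hp1
  have hkp : MemLp k (ENNReal.ofReal p) := hkd.memLp hk.aestronglyMeasurable hp1
  set S := ∫⁻ z, ‖F z‖ₑ ^ p with hS
  have hSp : eLpNorm F (ENNReal.ofReal p) ^ p = S := eLpNorm_ofReal_rpow hp0 F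
  have hSt : S ≠ ⊤ := by rw [← hSp]; exact ENNReal.rpow_ne_top_of_nonneg hp0.le hFp.2.ne
  -- The extremal function in Hölder's inequality: `F G = |F|ᵖ` and `|G|^q = |F|ᵖ`.
  let G : ℂ → ℂ := fun z => ((‖F z‖ ^ (p - 2) : ℝ) : ℂ) * starRingEnd ℂ (F z)
  have cG : Continuous G := by
    have h1 : Continuous fun z => ‖F z‖ ^ (p - 2) :=
      cF.norm.rpow_const fun z => Or.inr (by linarith)
    have h2 : Continuous fun z => starRingEnd ℂ (F z) := Complex.continuous_conj.comp cF
    fun_prop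
  have hFG : ∀ z, F z * G z = ((‖F z‖ ^ p : ℝ) : ℂ) := fun z => by
    have h1 : F z * G z = ((‖F z‖ ^ (p - 2) : ℝ) : ℂ) * (F z * starRingEnd ℂ (F z)) := by
      simp only [G]; ring
    rw [h1, Complex.mul_conj, Complex.normSq_eq_norm_sq, ← Complex.ofReal_mul]
    congr 1
    rcases (norm_nonneg (F z)).eq_or_lt with h0 | h0
    · rw [← h0, Real.zero_rpow hp0.ne']; simp
    · rw [← Real.rpow_natCast, ← Real.rpow_add h0]; norm_num
  have hGn : ∀ z, ‖G z‖ₑ ^ q = ‖F z‖ₑ ^ p := fun z => by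
    rw [← ofReal_norm, ← ofReal_norm, ENNReal.ofReal_rpow_of_nonneg (norm_nonneg _) hq0.le,
      ENNReal.ofReal_rpow_of_nonneg (norm_nonneg _) hp0.le]
    congr 1
    simp only [G]
    rw [norm_mul, Complex.norm_real, RCLike.norm_conj,
      Real.norm_of_nonneg (Real.rpow_nonneg (norm_nonneg _) _)]
    rcases (norm_nonneg (F z)).eq_or_lt with h0 | h0
    · rw [← h0, mul_zero, Real.zero_rpow hp0.ne', Real.zero_rpow hq0.ne']
    · rw [← Real.rpow_add_one h0.ne', ← Real.rpow_mul h0.le,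
        show p - 2 + 1 = p - 1 by ring, hpqm]
  have hGS : eLpNorm G (ENNReal.ofReal q) ^ q = S := by
    rw [eLpNorm_ofReal_rpow hq0]; exact lintegral_congr hGn
  have hGq : MemLp G (ENNReal.ofReal q) := by
    refine ⟨cG.aestronglyMeasurable, ?_⟩
    rw [← ENNReal.rpow_lt_top_iff_of_pos hq0, hGS]
    exact hSt.lt_top
  have hprod : Integrable (fun x : ℂ × ℂ => f x.2 * k (x.1 - x.2) * G x.1)
      (volume.prod volume) := by
    refine ⟨(by fun_prop : Continuous _).aestronglyMeasurable, ?_⟩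
    rw [HasFiniteIntegral, lintegral_prod_symm _ (by fun_prop)]
    have hb : ∀ w, ∫⁻ z, ‖f w * k (z - w) * G z‖ₑ ≤ ‖f w‖ₑ *
        (eLpNorm G (ENNReal.ofReal q) * eLpNorm k (ENNReal.ofReal p)) := fun w => by
      calc ∫⁻ z, ‖f w * k (z - w) * G z‖ₑ = ‖f w‖ₑ * ∫⁻ z, ‖G z • k (w - z)‖ₑ := by
            rw [← lintegral_const_mul _ (by fun_prop)]
            refine lintegral_congr fun z => ?_
            rw [← enorm_mul, smul_eq_mul, ← hke (w - z), neg_sub]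
            ring_nf
        _ ≤ _ := by
            gcongr
            have := lintegral_enorm_smul_le (p := q) hq1 hGq.1 (k := k) (by rwa [hqp]) w
            rwa [hqp] at this
    refine (lintegral_mono hb).trans_lt ?_
    rw [lintegral_mul_const _ (by fun_prop)]
    exact ENNReal.mul_lt_top hfi.2 (ENNReal.mul_lt_top hGq.2 hkp.2)
  -- Fubini, with evenness of `k` turning the transposed operator back into convolution with `k`.
  have hswap : ∫ z, F z * G z = ∫ w, f w * convKernel G k w := by
    calc ∫ z, F z * G z = ∫ z, ∫ w, f w * k (z - w) * G z := by
          refine integral_congr_ae (Eventually.of_forall fun z => ?_)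
          dsimp only
          rw [integral_mul_const]
          rfl
      _ = ∫ w, ∫ z, f w * k (z - w) * G z := integral_integral_swap hprod
      _ = _ := by
          refine integral_congr_ae (Eventually.of_forall fun w => ?_)
          dsimp only
          rw [convKernel, ← integral_const_mul]
          refine integral_congr_ae (Eventually.of_forall fun z => ?_)
          dsimp only
          rw [smul_eq_mul, ← hke (w - z), neg_sub]
          ring
  have hSint : S = ‖∫ z, F z * G z‖ₑ := by
    simp only [hFG]
    rw [integral_complex_ofReal, ← ofReal_norm, Complex.norm_real,
      Real.norm_of_nonneg (integral_nonneg fun z => Real.rpow_nonneg (norm_nonneg _) _),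
      integral_eq_lintegral_of_nonneg_ae (Eventually.of_forall fun z =>
        Real.rpow_nonneg (norm_nonneg _) _) (by
          exact (cF.norm.rpow_const fun z => Or.inr hp0.le).aestronglyMeasurable)]
    have : ∀ z, ENNReal.ofReal (‖F z‖ ^ p) = ‖F z‖ₑ ^ p := fun z => by
      rw [← ofReal_norm, ENNReal.ofReal_rpow_of_nonneg (norm_nonneg _) hp0.le]
    simp only [this]
    rw [ENNReal.ofReal_toReal hSt]
  have hmT : AEStronglyMeasurable (convKernel G k) := by
    have : AEStronglyMeasurable (fun z : ℂ × ℂ => G z.2 • k (z.1 - z.2))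
        (volume.prod volume) := (by fun_prop : Continuous _).aestronglyMeasurable
    exact this.integral_prod_right'
  -- The last factor is `S^(1/q)`. As `S` is finite, by the decay of `F`, it can be divided out,
  -- leaving `S^(1/p)`.
  have hmain : S ≤ D * eLpNorm f (ENNReal.ofReal p) * eLpNorm G (ENNReal.ofReal q) := by
    rw [hSint, hswap, mul_comm D, mul_assoc]
    exact (enorm_integral_mul_le hpq hf.aestronglyMeasurable hmT).trans
      (mul_le_mul' le_rfl (h G hGq))
  rcases eq_or_ne S 0 with h0 | h0
  · have : eLpNorm F (ENNReal.ofReal p) = 0 := by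
      rw [h0, ENNReal.rpow_eq_zero_iff_of_pos hp0] at hSp
      exact hSp
    rw [this]; exact zero_le
  · have e1 : eLpNorm F (ENNReal.ofReal p) = S ^ (1 / p) := by
      rw [← hSp, ← ENNReal.rpow_mul, mul_one_div_cancel hp0.ne', ENNReal.rpow_one]
    have e2 : eLpNorm G (ENNReal.ofReal q) = S ^ (1 / q) := by
      rw [← hGS, ← ENNReal.rpow_mul, mul_one_div_cancel hq0.ne', ENNReal.rpow_one]
    rw [e2] at hmain
    rw [e1]
    have h3 : S ^ (1 / q) ≠ 0 := by
      rw [Ne, ENNReal.rpow_eq_zero_iff_of_pos (by positivity)]; exact h0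
    have h4 : S ^ (1 / q) ≠ ⊤ := ENNReal.rpow_ne_top_of_nonneg (by positivity) hSt
    refine (ENNReal.mul_le_mul_iff_left h3 h4).1 ?_
    rwa [← ENNReal.rpow_add_of_nonneg _ _ (by positivity) (by positivity),
      show 1 / p + 1 / q = 1 by simpa using hpq.inv_add_inv_eq_one, ENNReal.rpow_one]

/-- Disposes of the root in the interpolation constant: a bound of at least `1` is not increased by
an exponent in `[0, 1]`. -/
lemma ENNReal.rpow_le_ofReal_of_le {X : ENNReal} {c s : ℝ} (hX : X ≤ ENNReal.ofReal c) (hc : 1 ≤ c)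
    (hs0 : 0 ≤ s) (hs : s ≤ 1) : X ^ s ≤ ENNReal.ofReal c := by
  refine (ENNReal.rpow_le_rpow hX hs0).trans ?_
  rw [ENNReal.ofReal_rpow_of_pos (by linarith)]
  exact ENNReal.ofReal_le_ofReal (Real.rpow_le_self_of_one_le hc hs)

/-- `Lᵖ` bounds, with linear growth of the constant, for the regularised Beurling transform. -/
theorem exists_eLpNorm_convKernel_beurlingReg_le : ∃ C : ℝ, 0 < C ∧ ∀ p : ℝ, 2 ≤ p →
    ∀ f : ℂ → ℂ, MemLp f (ENNReal.ofReal p) →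
      eLpNorm (convKernel f beurlingReg) (ENNReal.ofReal p) ≤
        ENNReal.ofReal (C * p) * eLpNorm f (ENNReal.ofReal p) := by
  obtain ⟨A, hA, hweak⟩ := exists_weakType_one_one
  have hKc := contDiff_beurlingReg.continuous
  have hL2 : ∀ f : ℂ → ℂ, Continuous f → HasCompactSupport f →
      ∫⁻ z, ‖convKernel f beurlingReg z‖ₑ ^ (2:ℝ) ≤
        ENNReal.ofReal discMass ^ (2:ℝ) * ∫⁻ z, ‖f z‖ₑ ^ (2:ℝ) := fun f hf hs => by
    have := ENNReal.rpow_le_rpow (eLpNorm_two_convKernel_beurlingReg_le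
      (hf.memLp_of_hasCompactSupport hs)) (show (0:ℝ) ≤ 2 by norm_num)
    rwa [ENNReal.mul_rpow_of_nonneg _ _ (by norm_num), eLpNorm_ofReal_rpow (by norm_num),
      eLpNorm_ofReal_rpow (by norm_num)] at this
  set a := A.toReal with ha
  have hAa : A = ENNReal.ofReal a := (ENNReal.ofReal_toReal hA).symm
  have ha0 : 0 ≤ a := ENNReal.toReal_nonneg
  have hm0 : 0 < discMass := discMass_pos
  have hm2 : ENNReal.ofReal discMass ^ (2:ℝ) = ENNReal.ofReal (discMass ^ 2) := by
    rw [ENNReal.rpow_two, ENNReal.ofReal_pow hm0.le]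
  have h2r : (2:ENNReal) ^ (2:ℝ) = ENNReal.ofReal (2 ^ 2) := by norm_num
  have h4r : (2:ENNReal) ^ (4:ℝ) = ENNReal.ofReal (2 ^ 4) := by
    rw [ENNReal.ofReal_pow (by norm_num)]; norm_cast
  have hKe := beurlingReg_neg
  have hdual : ∀ p : ℝ, 2 ≤ p → ∀ D : ℝ, (∀ f : ℂ → ℂ, Continuous f → HasCompactSupport f →
      eLpNorm (convKernel f beurlingReg) (ENNReal.ofReal p.conjExponent) ≤
        ENNReal.ofReal D * eLpNorm f (ENNReal.ofReal p.conjExponent)) →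
      ∀ f : ℂ → ℂ, Continuous f → HasCompactSupport f →
      eLpNorm (convKernel f beurlingReg) (ENNReal.ofReal p) ≤
        ENNReal.ofReal D * eLpNorm f (ENNReal.ofReal p) := fun p hp D h f hf hs => by
    have hpq := Real.HolderConjugate.conjExponent (show 1 < p by linarith)
    refine eLpNorm_convKernel_le_of_dual hKc hasDecay_beurlingReg hKe hp (fun g hg => ?_) hf hs
    refine eLpNorm_convKernel_le_of_dense hpq.symm.lt ?_ ENNReal.ofReal_ne_top h hg
    rw [hpq.symm.conjExponent_eq]
    exact memLp_beurlingReg (by linarith)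
  set C₁ := 3 * a + 18 * discMass ^ 2 + 1 with hC₁
  have hC₁1 : 1 ≤ C₁ := by rw [hC₁]; nlinarith [sq_nonneg discMass]
  -- For `p ≥ 3` the dual exponent lies in `(1, 3/2]`, away from the `L²` endpoint. The only
  -- unbounded factor is `1/(q - 1) = p - 1`.
  have hlarge : ∀ p : ℝ, 3 ≤ p → ∀ f : ℂ → ℂ, Continuous f → HasCompactSupport f →
      eLpNorm (convKernel f beurlingReg) (ENNReal.ofReal p) ≤
        ENNReal.ofReal (C₁ * p) * eLpNorm f (ENNReal.ofReal p) := fun p hp => by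
    refine hdual p (by linarith) _ fun f hf hs => ?_
    have hpq := Real.HolderConjugate.conjExponent (show 1 < p by linarith)
    set q := p.conjExponent with hq
    have hq1 : 1 < q := hpq.symm.lt
    have hqe : q = p / (p - 1) := rfl
    have hp1 : 0 < p - 1 := by linarith
    have hq32 : q ≤ 3 / 2 := by rw [hqe, div_le_iff₀ hp1]; linarith
    have hqm : 1 / (q - 1) = p - 1 := by rw [hqe]; field_simp; ring
    have h1 := lintegral_rpow_convKernel_le_of_weakType hKc norm_beurlingReg_le hq1
      (show q < 2 by linarith) hweak hL2 hf hs
    have h2 := eLpNorm_le_of_lintegral_rpow_le (by linarith) h1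
    refine h2.trans ?_
    gcongr
    have hs0 : 0 ≤ 1 / q + 1 / (2 - q) :=
      add_nonneg (by positivity) (one_div_nonneg.2 (by linarith))
    have hp30 : 0 ≤ C₁ * p := by positivity
    refine ENNReal.rpow_le_ofReal_of_le ?_ (by nlinarith) (by positivity)
      ((div_le_one (by linarith)).2 hq1.le)
    rw [hm2, hAa, hqm, h2r, show (2:ENNReal) = ENNReal.ofReal 2 by norm_num,
      ← ENNReal.ofReal_mul (by norm_num), ← ENNReal.ofReal_mul (by positivity),
      ← ENNReal.ofReal_mul (by positivity), ← ENNReal.ofReal_mul (by positivity),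
      ← ENNReal.ofReal_add (by positivity) (by positivity), ← ENNReal.ofReal_mul (by linarith)]
    refine ENNReal.ofReal_le_ofReal ?_
    have e1 : q * (1 / q + 1 / (2 - q)) ≤ 4 := by
      have h3 : q * (1 / (2 - q)) ≤ 3 := by
        rw [mul_one_div, div_le_iff₀ (by linarith)]; linarith
      rw [mul_add, mul_one_div_cancel (by linarith)]
      linarith
    calc q * (2 * a * (p - 1) + 2 ^ 2 * discMass ^ 2 * (1 / q + 1 / (2 - q)))
        = q * (2 * a * (p - 1)) + 4 * discMass ^ 2 * (q * (1 / q + 1 / (2 - q))) := by ring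
      _ ≤ 3 / 2 * (2 * a * (p - 1)) + 4 * discMass ^ 2 * 4 := by gcongr
      _ ≤ C₁ * p := by
        rw [hC₁]
        nlinarith [sq_nonneg discMass, mul_nonneg ha0 (show 0 ≤ p by linarith)]
  -- Interpolating with `L⁴` instead of `L²` avoids the blow-up of the constant as the exponent
  -- approaches `2`.
  set b := (C₁ * 4) ^ 4 with hb
  have hb0 : 0 ≤ b := by positivity
  have hL4 : ∀ f : ℂ → ℂ, Continuous f → HasCompactSupport f →
      ∫⁻ z, ‖convKernel f beurlingReg z‖ₑ ^ (4:ℝ) ≤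
        ENNReal.ofReal b * ∫⁻ z, ‖f z‖ₑ ^ (4:ℝ) := fun f hf hs => by
    have := ENNReal.rpow_le_rpow (hlarge 4 (by norm_num) f hf hs) (show (0:ℝ) ≤ 4 by norm_num)
    rwa [ENNReal.mul_rpow_of_nonneg _ _ (by norm_num), eLpNorm_ofReal_rpow (by norm_num),
      eLpNorm_ofReal_rpow (by norm_num), ENNReal.ofReal_rpow_of_pos (by positivity),
      show (C₁ * 4) ^ (4:ℝ) = b by rw [hb]; norm_cast] at this
  set C₂ := 6 * a + 72 * b + 1 with hC₂
  have hC₂1 : 1 ≤ C₂ := by rw [hC₂]; linarith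
  have hsmall : ∀ p : ℝ, 2 ≤ p → p ≤ 3 → ∀ f : ℂ → ℂ, Continuous f → HasCompactSupport f →
      eLpNorm (convKernel f beurlingReg) (ENNReal.ofReal p) ≤
        ENNReal.ofReal C₂ * eLpNorm f (ENNReal.ofReal p) := fun p hp hp3 f hf hs => by
    have h1 := lintegral_rpow_convKernel_le_of_weakType hKc norm_beurlingReg_le
      (show 1 < p by linarith) (show p < 4 by linarith) hweak hL4 hf hs
    have h2 := eLpNorm_le_of_lintegral_rpow_le (by linarith) h1
    refine h2.trans ?_
    gcongr
    have hp1 : 0 < p - 1 := by linarith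
    have hs0 : 0 ≤ 1 / p + 1 / (4 - p) :=
      add_nonneg (by positivity) (one_div_nonneg.2 (by linarith))
    refine ENNReal.rpow_le_ofReal_of_le ?_ hC₂1 (by positivity)
      ((div_le_one (by linarith)).2 (by linarith))
    rw [hAa, h4r, show (2:ENNReal) = ENNReal.ofReal 2 by norm_num,
      ← ENNReal.ofReal_mul (by norm_num), ← ENNReal.ofReal_mul (by positivity),
      ← ENNReal.ofReal_mul (by positivity), ← ENNReal.ofReal_mul (by positivity),
      ← ENNReal.ofReal_add (by positivity) (by positivity), ← ENNReal.ofReal_mul (by linarith)]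
    refine ENNReal.ofReal_le_ofReal ?_
    have e1 : 1 / (p - 1) ≤ 1 := (div_le_one hp1).2 (by linarith)
    have e2 : 1 / p ≤ 1 / 2 := one_div_le_one_div_of_le (by norm_num) hp
    have e3 : 1 / (4 - p) ≤ 1 := (div_le_one (by linarith)).2 (by linarith)
    calc p * (2 * a * (1 / (p - 1)) + 2 ^ 4 * b * (1 / p + 1 / (4 - p)))
        ≤ 3 * (2 * a * 1 + 2 ^ 4 * b * (1 / 2 + 1)) := by gcongr
      _ ≤ C₂ := by rw [hC₂]; linarith
  refine ⟨C₁ + C₂, by linarith, fun p hp f hf => ?_⟩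
  have hpq := Real.HolderConjugate.conjExponent (show 1 < p by linarith)
  refine eLpNorm_convKernel_le_of_dense hpq.lt (memLp_beurlingReg hpq.symm.lt)
    ENNReal.ofReal_ne_top (fun g hg hs => ?_) hf
  rcases le_total p 3 with h3 | h3
  · refine (hsmall p hp h3 g hg hs).trans ?_
    gcongr
    nlinarith
  · refine (hlarge p h3 g hg hs).trans ?_
    gcongr
    linarith

/-! ### Dilations, the commutation identity and approximate identities. -/

/-- The mass-preserving dilation `s² k(s z)` of a planar kernel. -/
def dilate (s : ℝ) (k : ℂ → ℂ) (z : ℂ) : ℂ := (s ^ 2) • k (s • z)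

lemma lintegral_comp_smul {s : ℝ} (hs : 0 < s) (F : ℂ → ENNReal) :
    ∫⁻ z, F (s • z) = ENNReal.ofReal (s ^ 2)⁻¹ * ∫⁻ z, F z := by
  have e : ∫⁻ z, F (s • z) = ∫⁻ z, F z ∂(Measure.map (fun z : ℂ => s • z) volume) :=
    (lintegral_map_equiv F (Homeomorph.smulOfNeZero s hs.ne').toMeasurableEquiv).symm
  rw [e, Measure.map_addHaar_smul volume hs.ne', lintegral_smul_measure, Complex.finrank_real_complex,
    abs_of_pos (by positivity)]
  rfl

lemma eLpNorm_comp_smul_rpow {s : ℝ} (hs : 0 < s) {p : ℝ} (hp : 0 < p) (f : ℂ → ℂ) :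
    eLpNorm (fun z => f (s • z)) (ENNReal.ofReal p) ^ p =
      ENNReal.ofReal (s ^ 2)⁻¹ * eLpNorm f (ENNReal.ofReal p) ^ p := by
  rw [eLpNorm_ofReal_rpow hp, eLpNorm_ofReal_rpow hp,
    lintegral_comp_smul hs fun z => ‖f z‖ₑ ^ p]

lemma MemLp.comp_smul {s : ℝ} (hs : 0 < s) {p : ℝ} (hp : 0 < p) {f : ℂ → ℂ}
    (hf : MemLp f (ENNReal.ofReal p)) : MemLp (fun z => f (s • z)) (ENNReal.ofReal p) := by
  refine ⟨hf.1.comp_quasiMeasurePreserving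
    (Measure.quasiMeasurePreserving_smul volume hs.ne'), ?_⟩
  rw [← ENNReal.rpow_lt_top_iff_of_pos hp, eLpNorm_comp_smul_rpow hs hp]
  exact ENNReal.mul_lt_top ENNReal.ofReal_lt_top (ENNReal.rpow_lt_top_of_nonneg hp.le hf.2.ne)

lemma convKernel_dilate {s : ℝ} (hs : 0 < s) (f k : ℂ → ℂ) (z : ℂ) :
    convKernel f (dilate s k) z = convKernel (fun w => f (s⁻¹ • w)) k (s • z) := by
  have h := Measure.integral_comp_smul (volume : Measure ℂ)
    (fun v => f (s⁻¹ • v) • k (s • z - v)) s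
  rw [Complex.finrank_real_complex, abs_of_pos (by positivity)] at h
  rw [convKernel, convKernel]
  have h2 : ∫ v, f (s⁻¹ • v) • k (s • z - v) = (s ^ 2) • ∫ w, f (s⁻¹ • s • w) • k (s • z - s • w) := by
    rw [h, smul_smul, mul_inv_cancel₀ (by positivity), one_smul]
  rw [h2, ← integral_smul]
  refine integral_congr_ae (Eventually.of_forall fun w => ?_)
  simp only [dilate]
  rw [smul_smul, inv_mul_cancel₀ hs.ne', one_smul, smul_sub, smul_comm]

/-- `Lᵖ` bounds for convolution operators are invariant under dilation of the kernel. -/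
lemma eLpNorm_convKernel_dilate_le {k : ℂ → ℂ} {p : ℝ} (hp : 0 < p) {D : ENNReal}
    (h : ∀ f : ℂ → ℂ, MemLp f (ENNReal.ofReal p) →
      eLpNorm (convKernel f k) (ENNReal.ofReal p) ≤ D * eLpNorm f (ENNReal.ofReal p))
    {s : ℝ} (hs : 0 < s) {f : ℂ → ℂ} (hf : MemLp f (ENNReal.ofReal p)) :
    eLpNorm (convKernel f (dilate s k)) (ENNReal.ofReal p) ≤
      D * eLpNorm f (ENNReal.ofReal p) := by
  have hs' : 0 < s⁻¹ := inv_pos.2 hs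
  have e : convKernel f (dilate s k) = fun z => convKernel (fun w => f (s⁻¹ • w)) k (s • z) :=
    funext fun z => convKernel_dilate hs f k z
  refine (ENNReal.rpow_le_rpow_iff hp).1 ?_
  rw [e, eLpNorm_comp_smul_rpow hs hp]
  have h1 := ENNReal.rpow_le_rpow (h _ (MemLp.comp_smul hs' hp hf)) hp.le
  calc _ ≤ ENNReal.ofReal (s ^ 2)⁻¹ *
        (D * eLpNorm (fun w => f (s⁻¹ • w)) (ENNReal.ofReal p)) ^ p := by gcongr
    _ = (ENNReal.ofReal (s ^ 2)⁻¹ * ENNReal.ofReal (s⁻¹ ^ 2)⁻¹) *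
        (D ^ p * eLpNorm f (ENNReal.ofReal p) ^ p) := by
        rw [ENNReal.mul_rpow_of_nonneg _ _ hp.le, eLpNorm_comp_smul_rpow hs' hp]; ring
    _ = _ := by
        rw [← ENNReal.ofReal_mul (by positivity), ENNReal.mul_rpow_of_nonneg _ _ hp.le,
          show (s ^ 2)⁻¹ * (s⁻¹ ^ 2)⁻¹ = 1 by field_simp]
        simp

lemma isPotential_dilate {s : ℝ} (hs : 0 < s) :
    IsPotential (fun z => s • cauchyReg (s • z)) (fun z => (s ^ 2) • fderiv ℝ cauchyReg (s • z))
      (fun z => (s ^ 3) • fderiv ℝ (fderiv ℝ cauchyReg) (s • z)) := by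
  have := (isPotential_cauchyReg.comp_affine hs.ne' 0).const_mul s
  simpa only [add_zero, smul_smul, ← pow_two, ← pow_succ', show s * (s * s) = s ^ 3 by ring]
    using this

lemma wirtinger_smul (c : ℝ) (L : ℂ →L[ℝ] ℂ) : wirtinger (c • L) = c • wirtinger L := by
  simp only [wirtinger, smul_apply, Complex.real_smul]; ring

lemma wirtingerBar_smul (c : ℝ) (L : ℂ →L[ℝ] ℂ) : wirtingerBar (c • L) = c • wirtingerBar L := by
  simp only [wirtingerBar, smul_apply, Complex.real_smul]; ring

lemma wirtinger_dilate (s : ℝ) (z : ℂ) :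
    wirtinger ((s ^ 2) • fderiv ℝ cauchyReg (s • z)) = dilate s beurlingReg z := by
  rw [wirtinger_smul, wirtinger_fderiv_cauchyReg, dilate]

lemma wirtingerBar_dilate (s : ℝ) (z : ℂ) :
    wirtingerBar ((s ^ 2) • fderiv ℝ cauchyReg (s • z)) = dilate s (fun w => discBump w) z := by
  rw [wirtingerBar_smul, wirtingerBar_fderiv_cauchyReg, dilate]

/-- The Beurling kernels and the bumps at different scales commute. -/
lemma convKernel_dilate_comm {h : ℂ → ℂ} (hc : Continuous h) (hs : HasCompactSupport h) {s t : ℝ}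
    (hs0 : 0 < s) (ht0 : 0 < t) (z : ℂ) :
    convKernel (convKernel h (dilate t fun w => discBump w)) (dilate s beurlingReg) z =
      convKernel (convKernel h (dilate t beurlingReg)) (dilate s fun w => discBump w) z := by
  have hi := hc.integrable_of_hasCompactSupport hs (μ := volume)
  -- The null-Lagrangian identity is applied to `w ↦ s cauchyReg (s (z - w))` and to `h` convolved
  -- with the Cauchy kernel at scale `t`. The reflection in `w` contributes a sign on both sides,
  -- which cancels.
  have ha := (isPotential_dilate hs0).comp_affine (show (-1:ℝ) ≠ 0 by norm_num) z
  have hb := (isPotential_dilate ht0).convKernel hc hs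
  obtain ⟨C, -, hC⟩ := (isPotential_dilate ht0).decay'.bounded
  have h1 := ha.integral_wirtinger_mul hb
  simp only [wirtinger_convKernel hi (isPotential_dilate ht0).continuous' hC,
    wirtingerBar_convKernel hi (isPotential_dilate ht0).continuous' hC, wirtinger_dilate,
    wirtingerBar_dilate, wirtinger_smul (-1), wirtingerBar_smul (-1)] at h1
  have e : ∀ w : ℂ, -w + z = z - w := fun w => neg_add_eq_sub w z
  simp only [e, neg_smul, one_smul, neg_mul, integral_neg, neg_inj] at h1
  simpa only [convKernel, smul_eq_mul, mul_comm] using h1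

/-- Approximate identities at a Lebesgue point. -/
lemma tendsto_convKernel_dilate {φ : ℂ → ℂ} (hφ : Measurable φ) {M : ℝ} (hM : ∀ z, ‖φ z‖ ≤ M)
    (hφ0 : ∀ z, 1 < ‖z‖ → φ z = 0) {f : ℂ → ℂ} (hf : LocallyIntegrable f) {z : ℂ}
    (hz : Tendsto (fun ε : ℝ => ⨍ y in Metric.closedBall z ε, ‖f y - f z‖) (𝓝[>] 0) (𝓝 0)) :
    Tendsto (fun ε : ℝ => convKernel f (dilate ε⁻¹ φ) z) (𝓝[>] 0) (𝓝 (f z * ∫ w, φ w)) := by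
  have hM0 : 0 ≤ M := (norm_nonneg _).trans (hM 0)
  -- The dilated kernel is at most `M/ε²` and lives on a disc of area `πε²`.
  have hbd : ∀ ε : ℝ, 0 < ε → ‖convKernel f (dilate ε⁻¹ φ) z - f z * ∫ w, φ w‖ ≤
      M * Real.pi * ⨍ y in Metric.closedBall z ε, ‖f y - f z‖ := by
    intro ε hε
    have hms : MeasurableSet (Metric.closedBall z ε) := Metric.isClosed_closedBall.measurableSet
    have hmd : Measurable fun w => dilate ε⁻¹ φ (z - w) := by
      unfold dilate
      fun_prop
    have hdb : ∀ w, ‖dilate ε⁻¹ φ (z - w)‖ ≤ (ε⁻¹) ^ 2 * M := fun w => by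
      rw [dilate, norm_smul, Real.norm_of_nonneg (by positivity)]
      gcongr
      exact hM _
    have hd0 : ∀ w, w ∉ Metric.closedBall z ε → dilate ε⁻¹ φ (z - w) = 0 := fun w hw => by
      rw [dilate, hφ0, smul_zero]
      rw [norm_smul, norm_inv, Real.norm_of_nonneg hε.le, ← div_eq_inv_mul, one_lt_div hε]
      rw [Metric.mem_closedBall, not_le, dist_comm, dist_eq_norm] at hw
      exact hw
    have hfi : IntegrableOn f (Metric.closedBall z ε) :=
      hf.integrableOn_isCompact (isCompact_closedBall z ε)
    have hci : IntegrableOn (fun _ : ℂ => f z) (Metric.closedBall z ε) :=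
      integrableOn_const measure_closedBall_lt_top.ne
    have hmass : ∫ w, dilate ε⁻¹ φ (z - w) = ∫ w, φ w := by
      rw [integral_sub_left_eq_self (dilate ε⁻¹ φ) volume z]
      simp only [dilate]
      rw [integral_smul, Measure.integral_comp_smul, Complex.finrank_real_complex,
        abs_of_pos (by positivity), smul_smul, mul_inv_cancel₀ (by positivity), one_smul]
    have e1 : convKernel f (dilate ε⁻¹ φ) z =
        ∫ w in Metric.closedBall z ε, f w * dilate ε⁻¹ φ (z - w) := by
      rw [convKernel, setIntegral_eq_integral_of_forall_compl_eq_zero]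
      · rfl
      · intro w hw
        rw [hd0 w hw, mul_zero]
    have e2 : f z * ∫ w, φ w = ∫ w in Metric.closedBall z ε, f z * dilate ε⁻¹ φ (z - w) := by
      rw [integral_const_mul, setIntegral_eq_integral_of_forall_compl_eq_zero (fun w hw => hd0 w hw),
        hmass]
    have hmul : ∀ u : ℂ → ℂ, IntegrableOn u (Metric.closedBall z ε) →
        IntegrableOn (fun w => u w * dilate ε⁻¹ φ (z - w)) (Metric.closedBall z ε) := fun u hu =>
      hu.mul_bdd hmd.aestronglyMeasurable (Eventually.of_forall hdb)
    rw [e1, e2, ← integral_sub (hmul _ hfi) (hmul _ hci)]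
    have hvol : volume.real (Metric.closedBall z ε) = Real.pi * ε ^ 2 := by
      rw [Measure.real, Complex.volume_closedBall, ENNReal.toReal_mul, ENNReal.toReal_pow,
        ENNReal.toReal_ofReal hε.le]
      simp [mul_comm]
    calc ‖∫ w in Metric.closedBall z ε, (f w * dilate ε⁻¹ φ (z - w) - f z * dilate ε⁻¹ φ (z - w))‖
        ≤ ∫ w in Metric.closedBall z ε, ‖f w - f z‖ * ((ε⁻¹) ^ 2 * M) := by
          refine norm_integral_le_of_norm_le ((hfi.sub hci).norm.mul_const _)
            (Eventually.of_forall fun w => ?_)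
          rw [← sub_mul, norm_mul]
          gcongr
          exact hdb w
      _ = _ := by
          rw [integral_mul_const, setAverage_eq, hvol, smul_eq_mul]
          field_simp
  rw [tendsto_iff_norm_sub_tendsto_zero]
  have h0 := hz.const_mul (M * Real.pi)
  rw [mul_zero] at h0
  refine squeeze_zero' (Eventually.of_forall fun ε => norm_nonneg _) ?_ h0
  filter_upwards [self_mem_nhdsWithin] with ε hε using hbd ε hε

lemma ae_tendsto_average_closedBall {f : ℂ → ℂ} (hf : LocallyIntegrable f) : ∀ᵐ z,
    Tendsto (fun ε : ℝ => ⨍ y in Metric.closedBall z ε, ‖f y - f z‖) (𝓝[>] 0) (𝓝 0) := by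
  filter_upwards [IsUnifLocDoublingMeasure.ae_tendsto_average_norm_sub volume hf 1] with z hz
  refine hz (fun _ => z) id tendsto_id ?_
  filter_upwards [self_mem_nhdsWithin] with ε hε
  exact Metric.mem_closedBall_self (by simpa using le_of_lt hε)

lemma norm_discBump_le (z : ℂ) : ‖(discBump z : ℂ)‖ ≤ 3 := by
  rw [Complex.norm_real, Real.norm_of_nonneg (discBump_nonneg z)]
  rcases lt_or_ge ‖z‖ 1 with h | h
  · rw [discBump_of_lt_one h]
    have h1 : ‖z‖ ^ 2 ≤ 1 := pow_le_one₀ (norm_nonneg _) h.le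
    nlinarith [sq_nonneg ‖z‖]
  · rw [discBump_of_one_le h]; norm_num

lemma continuous_ofReal_discBump : Continuous fun w => (discBump w : ℂ) := by
  have := continuous_discBump
  fun_prop

lemma integral_ofReal_discBump : ∫ w, (discBump w : ℂ) = discMass := integral_ofReal

lemma ae_tendsto_convKernel_discBump {f : ℂ → ℂ} (hf : LocallyIntegrable f) : ∀ᵐ z,
    Tendsto (fun ε : ℝ => convKernel f (dilate ε⁻¹ fun w => discBump w) z) (𝓝[>] 0)
      (𝓝 (f z * discMass)) := by
  filter_upwards [ae_tendsto_average_closedBall hf] with z hz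
  rw [← integral_ofReal_discBump]
  exact tendsto_convKernel_dilate continuous_ofReal_discBump.measurable norm_discBump_le
    (fun w hw => by rw [discBump_of_one_le hw.le]; simp) hf hz

lemma continuous_dilate {k : ℂ → ℂ} (hk : Continuous k) (s : ℝ) : Continuous (dilate s k) := by
  unfold dilate
  fun_prop

lemma HasDecay.dilate {k : ℂ → ℂ} {m : ℕ} (hk : HasDecay m k) {s : ℝ} (hs : 0 < s) :
    HasDecay m (dilate s k) := by
  have := hk.comp_affine hs.ne' 0
  simp only [add_zero] at this
  exact this.of_le (s ^ 2) (by positivity) fun z => by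
    rw [_root_.dilate, norm_smul, Real.norm_of_nonneg (by positivity)]

/-- Mollification by `discBump` approximates continuous compactly supported functions in `Lᵖ`. -/
lemma exists_eLpNorm_mollify_sub_le {h : ℂ → ℂ} (hc : Continuous h) (hs : HasCompactSupport h)
    {p : ℝ} (hp : 1 < p) {δ : ENNReal} (hδ : δ ≠ 0) :
    ∃ t : ℝ, 0 < t ∧ eLpNorm (h - convKernel (fun w => (discMass : ℂ)⁻¹ * h w)
      (dilate t fun w => discBump w)) (ENNReal.ofReal p) ≤ δ := by
  have hm0 := discMass_pos
  have hmc : (discMass : ℂ) ≠ 0 := by exact_mod_cast hm0.ne'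
  have hi := hc.integrable_of_hasCompactSupport hs (μ := volume)
  obtain ⟨R, hR⟩ := hs.isCompact.isBounded.subset_closedBall (0:ℂ)
  set B := Metric.closedBall (0:ℂ) (R + 1) with hB
  have hh0 : ∀ w, R < ‖w‖ → h w = 0 := fun w hw => by
    by_contra hne
    have := hR (subset_tsupport h (Function.mem_support.2 hne))
    rw [mem_closedBall_zero_iff] at this
    linarith
  -- uniform smallness parameter
  obtain ⟨η, hη, hηδ⟩ : ∃ η : ℝ, 0 < η ∧
      volume B ^ (1 / p) * ENNReal.ofReal η ≤ δ := by
    have hV : volume B ^ (1 / p) ≠ ⊤ :=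
      ENNReal.rpow_ne_top_of_nonneg (by positivity) measure_closedBall_lt_top.ne
    have h1 : Tendsto (fun η : ℝ => volume B ^ (1 / p) * ENNReal.ofReal η) (𝓝[>] 0)
        (𝓝 (volume B ^ (1 / p) * ENNReal.ofReal 0)) :=
      ENNReal.Tendsto.const_mul
        ((ENNReal.continuous_ofReal.tendsto 0).mono_left nhdsWithin_le_nhds) (Or.inr hV)
    rw [ENNReal.ofReal_zero, mul_zero] at h1
    obtain ⟨η, h2, h3⟩ := ((h1.eventually (gt_mem_nhds (pos_iff_ne_zero.2 hδ))).and
      self_mem_nhdsWithin).exists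
    exact ⟨η, h3, h2.le⟩
  obtain ⟨r, hr, hur⟩ := Metric.uniformContinuous_iff.1
    (hs.uniformContinuous_of_continuous hc) η hη
  -- `t ≥ 1` keeps the mollification supported in `B`; `t ≥ 2/r` puts the averaging radius `1/t`
  -- below the modulus of continuity `r`.
  set t := max 1 (2 / r) with ht
  have ht1 : 1 ≤ t := le_max_left _ _
  have ht0 : 0 < t := by linarith
  have htr : 1 / t < r := by
    rw [div_lt_iff₀ ht0]
    have : 2 / r ≤ t := le_max_right _ _
    rw [div_le_iff₀ hr] at this
    linarith
  refine ⟨t, ht0, ?_⟩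
  have hQc := continuous_dilate continuous_ofReal_discBump t
  have hQi : Integrable (dilate t fun w => (discBump w : ℂ)) :=
    ((hasDecay_discBump 3).dilate ht0).integrable le_rfl hQc.aestronglyMeasurable
  have hQn : ∀ w, ‖dilate t (fun w => (discBump w : ℂ)) w‖ = t ^ 2 * discBump (t • w) := fun w => by
    rw [dilate, norm_smul, Complex.norm_real, Real.norm_of_nonneg (discBump_nonneg _),
      Real.norm_of_nonneg (by positivity)]
  have hQ0 : ∀ w, 1 / t < ‖w‖ → dilate t (fun w => (discBump w : ℂ)) w = 0 := fun w hw => by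
    rw [dilate, discBump_of_one_le, Complex.ofReal_zero, smul_zero]
    rw [norm_smul, Real.norm_of_nonneg ht0.le]
    rw [div_lt_iff₀ ht0] at hw
    linarith
  have hmass : ∀ z : ℂ, ∫ w, dilate t (fun w => (discBump w : ℂ)) (z - w) = discMass := fun z => by
    rw [integral_sub_left_eq_self (dilate t _) volume z]
    simp only [dilate]
    rw [integral_smul, Measure.integral_comp_smul _ (fun w => (discBump w : ℂ)),
      Complex.finrank_real_complex, abs_of_pos (by positivity), smul_smul,
      mul_inv_cancel₀ (by positivity), one_smul, integral_ofReal_discBump]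
  have hmassn : ∀ z : ℂ, ∫ w, ‖dilate t (fun w => (discBump w : ℂ)) (z - w)‖ = discMass := fun z => by
    rw [integral_sub_left_eq_self (fun w => ‖dilate t (fun w => (discBump w : ℂ)) w‖) volume z]
    simp only [hQn]
    rw [integral_const_mul, Measure.integral_comp_smul _ discBump,
      Complex.finrank_real_complex, abs_of_pos (by positivity), smul_eq_mul, ← mul_assoc,
      mul_inv_cancel₀ (by positivity), one_mul, discMass]
  obtain ⟨M, -, hM⟩ := ((hasDecay_discBump 3).dilate ht0).bounded
  have hpt : ∀ z, ‖h z - convKernel (fun w => (discMass : ℂ)⁻¹ * h w)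
      (dilate t fun w => discBump w) z‖ ≤ η := fun z => by
    have h1 := integrable_smul_of_bounded (hi.const_mul (discMass : ℂ)⁻¹) hQc hM z
    have e1 : h z = ∫ w, ((discMass : ℂ)⁻¹ * h z) • dilate t (fun w => (discBump w : ℂ)) (z - w) := by
      rw [integral_smul, hmass, smul_eq_mul]
      field_simp
    have h2 : Integrable fun w =>
        ((discMass : ℂ)⁻¹ * h z) • dilate t (fun w => (discBump w : ℂ)) (z - w) :=
      (hQi.comp_sub_left z).smul ((discMass : ℂ)⁻¹ * h z)
    rw [convKernel]
    nth_rewrite 1 [e1]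
    rw [← integral_sub h2 h1]
    calc _ ≤ ∫ w, discMass⁻¹ * η * ‖dilate t (fun w => (discBump w : ℂ)) (z - w)‖ := by
          refine norm_integral_le_of_norm_le ((hQi.comp_sub_left z).norm.const_mul _)
            (Eventually.of_forall fun w => ?_)
          rw [← sub_smul, norm_smul, ← mul_sub, norm_mul, norm_inv, Complex.norm_real,
            Real.norm_of_nonneg hm0.le]
          rcases lt_or_ge (1 / t) ‖z - w‖ with hw | hw
          · rw [hQ0 _ hw]; simp
          · gcongr
            have := hur (a := z) (b := w) (by rw [dist_eq_norm]; linarith)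
            rw [dist_eq_norm] at this
            exact this.le
      _ = η := by
          rw [integral_const_mul, hmassn]
          field_simp
  have hout : ∀ z, z ∉ B → h z - convKernel (fun w => (discMass : ℂ)⁻¹ * h w)
      (dilate t fun w => discBump w) z = 0 := fun z hz => by
    rw [hB, mem_closedBall_zero_iff, not_le] at hz
    rw [hh0 z (by linarith), zero_sub, neg_eq_zero, convKernel]
    refine integral_eq_zero_of_ae (Eventually.of_forall fun w => ?_)
    rcases lt_or_ge R ‖w‖ with hw | hw
    · simp [hh0 w hw]
    · dsimp only
      rw [hQ0 (z - w), smul_zero]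
      · rfl
      have h1 := norm_sub_norm_le z w
      have h2 : 1 / t ≤ 1 := (div_le_one ht0).2 ht1
      linarith
  have hind : h - convKernel (fun w => (discMass : ℂ)⁻¹ * h w) (dilate t fun w => discBump w) =
      B.indicator (h - convKernel (fun w => (discMass : ℂ)⁻¹ * h w)
        (dilate t fun w => discBump w)) := by
    ext z
    by_cases hz : z ∈ B
    · rw [Set.indicator_of_mem hz]
    · rw [Set.indicator_of_notMem hz]; exact hout z hz
  rw [hind, eLpNorm_indicator_eq_eLpNorm_restrict Metric.isClosed_closedBall.measurableSet]
  refine (eLpNorm_le_of_ae_bound (Eventually.of_forall hpt)).trans ?_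
  rw [Measure.restrict_apply_univ, ENNReal.toReal_ofReal (by linarith), ← one_div]
  exact hηδ

/-! ### Beurling pairs and almost everywhere principal values. -/

/-- `V` is (up to the mass of `discBump`) the Beurling transform of `U`, in the weak sense that
the regularizations at every scale agree. -/
structure IsBeurlingPair (p : ℝ) (U V : ℂ → ℂ) : Prop where
  left : MemLp U (ENNReal.ofReal p)
  right : MemLp V (ENNReal.ofReal p)
  eq : ∀ s : ℝ, 0 < s → ∀ z, convKernel U (dilate s beurlingReg) z =
    convKernel V (dilate s fun w => discBump w) z

lemma memLp_dilate_beurlingReg {s : ℝ} (hs : 0 < s) {q : ℝ} (hq : 1 < q) :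
    MemLp (dilate s beurlingReg) (ENNReal.ofReal q) :=
  (hasDecay_beurlingReg.dilate hs).memLp
    (continuous_dilate contDiff_beurlingReg.continuous s).aestronglyMeasurable hq

lemma memLp_dilate_discBump {s : ℝ} (hs : 0 < s) {q : ℝ} (hq : 1 < q) :
    MemLp (dilate s fun w => (discBump w : ℂ)) (ENNReal.ofReal q) :=
  ((hasDecay_discBump 2).dilate hs).memLp
    (continuous_dilate continuous_ofReal_discBump s).aestronglyMeasurable hq

lemma aestronglyMeasurable_convKernel {f k : ℂ → ℂ} (hf : AEStronglyMeasurable f)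
    (hk : AEStronglyMeasurable k) : AEStronglyMeasurable (convKernel f k) := by
  have : AEStronglyMeasurable (fun z : ℂ × ℂ => f z.2 • k (z.1 - z.2)) (volume.prod volume) :=
    hf.comp_snd.smul (hk.comp_quasiMeasurePreserving (quasiMeasurePreserving_sub volume volume))
  exact this.integral_prod_right'

namespace IsBeurlingPair

variable {p : ℝ} {U V U' V' : ℂ → ℂ}

lemma sub (hp : 1 < p) (h : IsBeurlingPair p U V) (h' : IsBeurlingPair p U' V') :
    IsBeurlingPair p (U - U') (V - V') := by
  have hq := (Real.HolderConjugate.conjExponent hp).symm.lt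
  refine ⟨h.left.sub h'.left, h.right.sub h'.right, fun s hs z => ?_⟩
  rw [convKernel_sub hp h.left h'.left (memLp_dilate_beurlingReg hs hq),
    convKernel_sub hp h.right h'.right (memLp_dilate_discBump hs hq), h.eq s hs, h'.eq s hs]

/-- The regularised transforms of `U` are mollifications of `V`, so Lebesgue differentiation of `V`
suffices. -/
lemma ae_tendsto (hp : 1 < p) (h : IsBeurlingPair p U V) : ∀ᵐ z,
    Tendsto (fun ε : ℝ => convKernel U (dilate ε⁻¹ beurlingReg) z) (𝓝[>] 0)
      (𝓝 (V z * discMass)) := by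
  filter_upwards [ae_tendsto_convKernel_discBump
    (h.right.locallyIntegrable (by simpa using hp.le))] with z hz
  refine hz.congr' ?_
  filter_upwards [self_mem_nhdsWithin] with ε hε
  exact (h.eq _ (inv_pos.2 hε) z).symm

/-- Fatou along the scales `1/(n+1)`; dilation invariance makes the same bound `D` valid at each of
them. -/
lemma eLpNorm_le (hp : 1 < p) (h : IsBeurlingPair p U V) {D : ENNReal}
    (hD : ∀ f : ℂ → ℂ, MemLp f (ENNReal.ofReal p) →
      eLpNorm (convKernel f beurlingReg) (ENNReal.ofReal p) ≤ D * eLpNorm f (ENNReal.ofReal p)) :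
    eLpNorm (fun z => V z * discMass) (ENNReal.ofReal p) ≤ D * eLpNorm U (ENNReal.ofReal p) := by
  have h1 : Tendsto (fun n : ℕ => ((n : ℝ) + 1)⁻¹) atTop (𝓝[>] 0) := by
    refine tendsto_nhdsWithin_iff.2 ⟨?_, Eventually.of_forall fun n => ?_⟩
    · simpa using tendsto_one_div_add_atTop_nhds_zero_nat (𝕜 := ℝ)
    · exact Set.mem_Ioi.2 (by positivity)
  refine (Lp.eLpNorm_lim_le_liminf_eLpNorm
    (f := fun n : ℕ => convKernel U (dilate ((n : ℝ) + 1)⁻¹⁻¹ beurlingReg)) (fun n => ?_) _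
    ((h.ae_tendsto hp).mono fun z hz => hz.comp h1)).trans ?_
  · exact aestronglyMeasurable_convKernel h.left.1
      (continuous_dilate contDiff_beurlingReg.continuous _).aestronglyMeasurable
  · refine liminf_le_of_frequently_le' (Frequently.of_forall fun n => ?_)
    exact eLpNorm_convKernel_dilate_le (by linarith) hD (by positivity) h.left

end IsBeurlingPair

/-- Mollified `C_c` functions have an explicit partner: if `U` is a density convolved with the bump
at scale `t`, then `V` is the same density convolved with the Beurling kernel at scale `t`, by the
commutation identity. -/
lemma exists_isBeurlingPair_approx {p : ℝ} (hp : 1 < p) {g : ℂ → ℂ}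
    (hg : MemLp g (ENNReal.ofReal p)) {δ : ENNReal} (hδ : δ ≠ 0) :
    ∃ U V, IsBeurlingPair p U V ∧ eLpNorm (g - U) (ENNReal.ofReal p) ≤ δ := by
  have hδ2 : δ / 2 ≠ 0 := by simpa using hδ
  obtain ⟨h, hs, hgh, hc, hm⟩ :=
    hg.exists_hasCompactSupport_eLpNorm_sub_le ENNReal.ofReal_ne_top hδ2
  obtain ⟨t, ht, hht⟩ := exists_eLpNorm_mollify_sub_le hc hs hp hδ2
  have hc' : Continuous fun w => (discMass : ℂ)⁻¹ * h w := by fun_prop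
  have hs' : HasCompactSupport fun w => (discMass : ℂ)⁻¹ * h w := hs.mul_left
  have hi := hc'.integrable_of_hasCompactSupport hs' (μ := volume)
  have key : ∀ k : ℂ → ℂ, Continuous k → HasDecay 2 k →
      MemLp (convKernel (fun w => (discMass : ℂ)⁻¹ * h w) k) (ENNReal.ofReal p) :=
    fun k hk hd => (hasDecay_convKernel hc' hs' hd).memLp
      (aestronglyMeasurable_convKernel hc'.aestronglyMeasurable hk.aestronglyMeasurable) hp
  have hU := key _ (continuous_dilate continuous_ofReal_discBump t)
    ((hasDecay_discBump 2).dilate ht)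
  refine ⟨_, _, ⟨hU, key _ (continuous_dilate contDiff_beurlingReg.continuous t)
    (hasDecay_beurlingReg.dilate ht), fun s hs0 z => convKernel_dilate_comm hc' hs' hs0 ht z⟩, ?_⟩
  have := eLpNorm_add_le (p := ENNReal.ofReal p) (hg.sub hm).1 (hm.sub hU).1 (by simpa using hp.le)
  rw [sub_add_sub_cancel] at this
  exact this.trans ((add_le_add hgh hht).trans_eq (ENNReal.add_halves δ))

/-- Pairs are stable under differences, so the norm bound makes the partners of an approximating
sequence Cauchy. The pair identity passes to the limit at every point because both kernels lie in
the dual space. -/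
lemma exists_isBeurlingPair {p : ℝ} (hp : 1 < p) {D : ENNReal} (hDt : D ≠ ⊤)
    (hD : ∀ f : ℂ → ℂ, MemLp f (ENNReal.ofReal p) →
      eLpNorm (convKernel f beurlingReg) (ENNReal.ofReal p) ≤ D * eLpNorm f (ENNReal.ofReal p))
    {g : ℂ → ℂ} (hg : MemLp g (ENNReal.ofReal p)) : ∃ V, IsBeurlingPair p g V := by
  have hp1 : 1 ≤ ENNReal.ofReal p := by simpa using hp.le
  have hq := (Real.HolderConjugate.conjExponent hp).symm.lt
  have hm0 := discMass_pos
  have hmc : (discMass : ℂ) ≠ 0 := by exact_mod_cast hm0.ne'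
  choose U V hUV hgU using fun n : ℕ =>
    exists_isBeurlingPair_approx hp hg (δ := (2:ENNReal)⁻¹ ^ n) (by simp)
  have hpow : ∀ N n : ℕ, N ≤ n → (2:ENNReal)⁻¹ ^ n ≤ 2⁻¹ ^ N := fun N n h =>
    pow_le_pow_right_of_le_one' (by simp) h
  set D' := ‖(discMass : ℂ)⁻¹‖ₑ * D with hD'
  have hD't : D' ≠ ⊤ := ENNReal.mul_ne_top enorm_ne_top hDt
  have hVb : ∀ n m, eLpNorm (V n - V m) (ENNReal.ofReal p) ≤
      D' * eLpNorm (U n - U m) (ENNReal.ofReal p) := fun n m => by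
    have h1 := ((hUV n).sub hp (hUV m)).eLpNorm_le hp hD
    have e : V n - V m = (discMass : ℂ)⁻¹ • fun z => (V n - V m) z * (discMass : ℂ) := by
      ext z
      simp only [Pi.smul_apply, smul_eq_mul]
      field_simp
    rw [e, eLpNorm_const_smul, hD', mul_assoc]
    gcongr
  clear_value D'
  -- The estimate proper is `2 D' 2⁻ᴺ`; the larger constant `4 (D' + 1)` makes it strict, even when
  -- `D' = 0`.
  have hcau : ∀ N n m : ℕ, N ≤ n → N ≤ m → eLpNorm (V n - V m) (ENNReal.ofReal p) <
      (D' + 1) * 4 * 2⁻¹ ^ N := fun N n m hn hm => by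
    have h1 : eLpNorm (U n - U m) (ENNReal.ofReal p) ≤ 2 * 2⁻¹ ^ N := by
      have h2 := eLpNorm_sub_le (p := ENNReal.ofReal p) (hg.sub (hUV m).left).1
        (hg.sub (hUV n).left).1 hp1
      rw [sub_sub_sub_cancel_left] at h2
      refine h2.trans ((add_le_add ((hgU m).trans (hpow N m hm))
        ((hgU n).trans (hpow N n hn))).trans_eq (two_mul _).symm)
    have hx0 : (2:ENNReal)⁻¹ ^ N ≠ 0 := by simp
    have hxt : (2:ENNReal)⁻¹ ^ N ≠ ⊤ := ENNReal.pow_ne_top (by simp)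
    refine (hVb n m).trans_lt ?_
    lift D' to NNReal using hD't
    lift (2:ENNReal)⁻¹ ^ N to NNReal using hxt with x
    refine (mul_le_mul_right h1 _).trans_lt ?_
    have hx : 0 < x := pos_iff_ne_zero.2 (by simpa using hx0)
    have : D' * (2 * x) < (D' + 1) * 4 * x := by nlinarith [mul_nonneg (zero_le : 0 ≤ D') hx.le]
    exact_mod_cast this
  obtain ⟨W, hW, hlim⟩ := Lp.cauchy_complete_eLpNorm hp1 (fun n => (hUV n).right) (by
    rw [ENNReal.tsum_mul_left, ENNReal.tsum_geometric]
    exact ENNReal.mul_ne_top (ENNReal.mul_ne_top (by simp [hD't]) (by simp)) (by simp)) hcau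
  refine ⟨W, hg, hW, fun s hs z => ?_⟩
  have hlimU : Tendsto (fun n => eLpNorm (g - U n) (ENNReal.ofReal p)) atTop (𝓝 0) :=
    tendsto_of_tendsto_of_tendsto_of_le_of_le tendsto_const_nhds
      (ENNReal.tendsto_pow_atTop_nhds_zero_of_lt_one (by simp)) (fun _ => zero_le) hgU
  have t1 := tendsto_convKernel hp hg (fun n => (hUV n).left) (memLp_dilate_beurlingReg hs hq)
    hlimU z
  have t2 := tendsto_convKernel hp hW (fun n => (hUV n).right) (memLp_dilate_discBump hs hq)
    (by simpa only [eLpNorm_sub_comm] using hlim) z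
  exact tendsto_nhds_unique (t1.congr fun n => (hUV n).eq s hs z) t2

/-- The mean of the Beurling kernel over the unit disc vanishes. -/
lemma integral_indicator_beurlingReg :
    ∫ w, (Metric.closedBall (0:ℂ) 1).indicator beurlingReg w = 0 := by
  -- A quarter turn preserves the disc and changes the sign of the kernel, so the integral equals
  -- its negative.
  have hmp := (rotation (⟨Complex.I, by simp [Submonoid.unitSphere]⟩ : Circle)).measurePreserving
  have h := hmp.integral_comp (rotation _).toHomeomorph.measurableEmbedding
    ((Metric.closedBall (0:ℂ) 1).indicator beurlingReg)
  have e : ∀ w : ℂ, (Metric.closedBall (0:ℂ) 1).indicator beurlingReg (Complex.I * w) =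
      -(Metric.closedBall (0:ℂ) 1).indicator beurlingReg w := fun w => by
    by_cases hw : ‖w‖ ≤ 1
    · rw [Set.indicator_of_mem (by simpa using hw), Set.indicator_of_mem (by simpa using hw),
        beurlingReg_I_mul]
    · rw [Set.indicator_of_notMem (by simpa using hw), Set.indicator_of_notMem (by simpa using hw),
        neg_zero]
  replace h : ∫ w, (Metric.closedBall (0:ℂ) 1).indicator beurlingReg (Complex.I * w) =
      ∫ w, (Metric.closedBall (0:ℂ) 1).indicator beurlingReg w := h
  simp only [e, integral_neg] at h
  have h2 : (2:ℂ) * ∫ w, (Metric.closedBall (0:ℂ) 1).indicator beurlingReg w = 0 := by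
    linear_combination -h
  simpa using h2

/-- The truncated Beurling transform. -/
def beurlingTrunc (g : ℂ → ℂ) (ε : ℝ) (z : ℂ) : ℂ :=
  ∫ w in {w | ε < ‖z - w‖}, g w * ((z - w) ^ 2)⁻¹

lemma dilate_inv_beurlingReg {ε : ℝ} (hε : 0 < ε) {u : ℂ} (hu : ε ≤ ‖u‖) :
    dilate ε⁻¹ beurlingReg u = -(u ^ 2)⁻¹ := by
  rw [dilate, beurlingReg_of_one_le (by
    rwa [norm_smul, norm_inv, Real.norm_of_nonneg hε.le, ← div_eq_inv_mul, one_le_div hε]),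
    Complex.real_smul, Complex.real_smul]
  have : (ε:ℂ) ≠ 0 := by exact_mod_cast hε.ne'
  push_cast
  rw [mul_pow, mul_inv]
  field_simp

lemma integrableOn_mul_inv_sq {p : ℝ} (hp : 1 < p) {g : ℂ → ℂ}
    (hg : MemLp g (ENNReal.ofReal p)) {ε : ℝ} (hε : 0 < ε) (z : ℂ) :
    IntegrableOn (fun w => g w * ((z - w) ^ 2)⁻¹) {w | ε < ‖z - w‖} := by
  have hq := (Real.HolderConjugate.conjExponent hp).symm.lt
  have hi := integrable_smul_of_memLp hp hg (memLp_dilate_beurlingReg (inv_pos.2 hε) hq) z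
  refine hi.neg.integrableOn.congr_fun (fun w hw => ?_)
    (measurableSet_lt measurable_const (by fun_prop))
  have hw : ε < ‖z - w‖ := hw
  simp [dilate_inv_beurlingReg hε hw.le]

/-- Beyond distance `ε` the regularised kernel is exactly `-(z - w)⁻²`. The remainder is a dilate of
a bounded, compactly supported kernel of mean zero, so it tends to zero at Lebesgue points. -/
lemma convKernel_dilate_beurlingReg_eq {p : ℝ} (hp : 1 < p) {g : ℂ → ℂ}
    (hg : MemLp g (ENNReal.ofReal p)) {ε : ℝ} (hε : 0 < ε) (z : ℂ) :
    convKernel g (dilate ε⁻¹ beurlingReg) z = -beurlingTrunc g ε z +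
      convKernel g (dilate ε⁻¹ ((Metric.closedBall (0:ℂ) 1).indicator beurlingReg)) z := by
  have hq := (Real.HolderConjugate.conjExponent hp).symm.lt
  have hi := integrable_smul_of_memLp hp hg (memLp_dilate_beurlingReg (inv_pos.2 hε) hq) z
  have hms : MeasurableSet {w : ℂ | ε < ‖z - w‖} :=
    measurableSet_lt measurable_const (by fun_prop)
  have hn : ∀ w : ℂ, ‖ε⁻¹ • (z - w)‖ = ‖z - w‖ / ε := fun w => by
    rw [norm_smul, norm_inv, Real.norm_of_nonneg hε.le, div_eq_inv_mul]
  rw [convKernel, ← integral_add_compl hms hi, beurlingTrunc, ← integral_neg]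
  congr 1
  · refine setIntegral_congr_fun hms fun w hw => ?_
    have hw' : ε < ‖z - w‖ := hw
    rw [dilate_inv_beurlingReg hε hw'.le, smul_neg, smul_eq_mul]
  · rw [convKernel, ← integral_indicator hms.compl]
    refine integral_congr_ae (Eventually.of_forall fun w => ?_)
    simp only [dilate]
    by_cases hw : ε < ‖z - w‖
    · rw [Set.indicator_of_notMem (by simpa using hw), Set.indicator_of_notMem]
      · simp
      · rw [mem_closedBall_zero_iff, hn, not_le, one_lt_div hε]; exact hw
    · rw [Set.indicator_of_mem (by simpa using hw), Set.indicator_of_mem]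
      rw [mem_closedBall_zero_iff, hn, div_le_one hε]
      exact not_lt.1 hw

/-- The principal value defining the Beurling transform exists almost everywhere and is bounded
on `Lᵖ` with norm `O(p)`. -/
theorem exists_beurling_principalValue : ∃ C : ℝ, 0 < C ∧ ∀ p : ℝ, 2 ≤ p → ∀ g : ℂ → ℂ,
    MemLp g (ENNReal.ofReal p) → ∃ F : ℂ → ℂ, MemLp F (ENNReal.ofReal p) ∧
      eLpNorm F (ENNReal.ofReal p) ≤ ENNReal.ofReal (C * p) * eLpNorm g (ENNReal.ofReal p) ∧
      ∀ᵐ z, Tendsto (fun ε => beurlingTrunc g ε z) (𝓝[>] 0) (𝓝 (F z)) := by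
  obtain ⟨C, hC, h⟩ := exists_eLpNorm_convKernel_beurlingReg_le
  refine ⟨C, hC, fun p hp g hg => ?_⟩
  have hp1 : 1 < p := by linarith
  obtain ⟨V, hV⟩ := exists_isBeurlingPair hp1 ENNReal.ofReal_ne_top (h p hp) hg
  refine ⟨fun z => -(V z * discMass), (hV.right.mul_const _).neg, ?_, ?_⟩
  · have := hV.eLpNorm_le hp1 (h p hp)
    rwa [← eLpNorm_neg] at this
  · filter_upwards [hV.ae_tendsto hp1,
      ae_tendsto_average_closedBall (hg.locallyIntegrable (by simpa using hp1.le))] with z h1 h2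
    have h3 := tendsto_convKernel_dilate
      (contDiff_beurlingReg.continuous.measurable.indicator
        Metric.isClosed_closedBall.measurableSet) (M := 3) (fun w =>
          (norm_indicator_le_norm_self _ _).trans (norm_beurlingReg_le w))
      (fun w hw => Set.indicator_of_notMem
        (by rw [mem_closedBall_zero_iff, not_le]; exact hw) _)
      (hg.locallyIntegrable (by simpa using hp1.le)) h2
    rw [integral_indicator_beurlingReg, mul_zero] at h3
    have h4 := (h1.sub h3).neg
    rw [sub_zero] at h4
    refine h4.congr' ?_
    filter_upwards [self_mem_nhdsWithin] with ε hε
    rw [convKernel_dilate_beurlingReg_eq hp1 hg hε]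
    ring

/-! ### Power weights: the commutator and its Schur test. -/

lemma lintegral_rpow_norm_le {a R : ℝ} (ha : a < 2) (hR : 0 < R) :
    ∫⁻ w in {w : ℂ | ‖w‖ ≤ R}, ENNReal.ofReal (‖w‖ ^ (-a)) =
      ENNReal.ofReal (2 * Real.pi * (R ^ (2 - a) / (2 - a))) := by
  have hv : (volume : Measure ℂ).real (Metric.ball 0 1) = Real.pi := by
    simp [Measure.real, Complex.volume_ball]
  set F : ℝ → ℝ := (Set.Iic R).indicator fun r => r ^ (-a) with hF
  have hms : MeasurableSet {w : ℂ | ‖w‖ ≤ R} := measurableSet_le measurable_norm measurable_const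
  have e1 : ∫⁻ w in {w : ℂ | ‖w‖ ≤ R}, ENNReal.ofReal (‖w‖ ^ (-a)) =
      ∫⁻ w : ℂ, ENNReal.ofReal (F ‖w‖) := by
    rw [← lintegral_indicator hms]
    refine lintegral_congr fun w => ?_
    by_cases h : ‖w‖ ≤ R
    · rw [Set.indicator_of_mem (by exact h), hF, Set.indicator_of_mem (by exact h)]
    · rw [Set.indicator_of_notMem (by exact h), hF, Set.indicator_of_notMem (by exact h)]
      simp
  have e2 : ∀ y ∈ Set.Ioi (0:ℝ), y ^ (Module.finrank ℝ ℂ - 1) • F y =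
      (Set.Iic R).indicator (fun r => r ^ (1 - a)) y := fun y hy => by
    have hy : 0 < y := hy
    simp only [Complex.finrank_real_complex, hF, Set.indicator]
    split_ifs
    · rw [show 1 - a = 1 + -a by ring, Real.rpow_add hy]; simp
    · simp
  have i1 : IntegrableOn (fun r : ℝ => r ^ (1 - a)) (Set.Ioc 0 R) :=
    (intervalIntegrable_iff_integrableOn_Ioc_of_le hR.le).1
      (intervalIntegral.intervalIntegrable_rpow' (by linarith))
  have hint : Integrable fun w : ℂ => F ‖w‖ := by
    rw [integrable_fun_norm_addHaar]
    refine IntegrableOn.congr_fun ?_ (fun y hy => (e2 y hy).symm) measurableSet_Ioi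
    rwa [IntegrableOn, integrable_indicator_iff measurableSet_Iic, IntegrableOn,
      Measure.restrict_restrict measurableSet_Iic, Set.inter_comm, Set.Ioi_inter_Iic]
  rw [e1, ← ofReal_integral_eq_lintegral_ofReal hint (Eventually.of_forall fun w => by
    simp only [hF, Set.indicator]; split_ifs <;> positivity)]
  rw [integral_fun_norm_addHaar, hv, setIntegral_congr_fun measurableSet_Ioi e2,
    setIntegral_indicator measurableSet_Iic, Set.Ioi_inter_Iic,
    ← intervalIntegral.integral_of_le hR.le, integral_rpow (Or.inl (by linarith)),
    Real.zero_rpow (by linarith)]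
  congr 1
  simp only [Complex.finrank_real_complex, nsmul_eq_mul, smul_eq_mul]
  rw [show 1 - a + 1 = 2 - a by ring]
  push_cast
  ring

/-- Common form of both Schur integrals: a singularity at the origin, a tail, and a `|x - w|⁻¹`
singularity near the diagonal, each bounded by a radial integral. In use `R = ‖x‖` and `‖w‖ ≤ 2R` in
the third region, hence the radius `3R`. -/
lemma lintegral_ofReal_le_of_trichotomy {Φ : ℂ → ℝ} {x : ℂ} {R a d A₁ A₂ A₃ : ℝ} (hR : 0 < R)
    (ha : a < 2) (hd : 2 < d) (hA₁ : 0 ≤ A₁) (hA₂ : 0 ≤ A₂) (hA₃ : 0 ≤ A₃)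
    (h : ∀ w, w ≠ 0 → (‖w‖ ≤ R ∧ Φ w ≤ A₁ * ‖w‖ ^ (-a)) ∨ (R < ‖w‖ ∧ Φ w ≤ A₂ * ‖w‖ ^ (-d)) ∨
      (‖x - w‖ ≤ 3 * R ∧ Φ w ≤ A₃ * ‖x - w‖ ^ (-(1:ℝ)))) :
    ∫⁻ w, ENNReal.ofReal (Φ w) ≤ ENNReal.ofReal (2 * Real.pi *
      (A₁ * (R ^ (2 - a) / (2 - a)) + A₂ * (R ^ (2 - d) / (d - 2)) + A₃ * (3 * R))) := by
  have m1 : MeasurableSet {w : ℂ | ‖w‖ ≤ R} := measurableSet_le measurable_norm measurable_const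
  have m2 : MeasurableSet {w : ℂ | R < ‖w‖} := measurableSet_lt measurable_const measurable_norm
  have m3 : MeasurableSet {w : ℂ | ‖w‖ ≤ 3 * R} :=
    measurableSet_le measurable_norm measurable_const
  set G₁ := {w : ℂ | ‖w‖ ≤ R}.indicator fun w => ENNReal.ofReal (‖w‖ ^ (-a))
  set G₂ := {w : ℂ | R < ‖w‖}.indicator fun w => ENNReal.ofReal (‖w‖ ^ (-d))
  set G₃ := {w : ℂ | ‖w‖ ≤ 3 * R}.indicator fun w => ENNReal.ofReal (‖w‖ ^ (-(1:ℝ)))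
  have hG₁ : Measurable G₁ := Measurable.indicator (by fun_prop) m1
  have hG₂ : Measurable G₂ := Measurable.indicator (by fun_prop) m2
  have hG₃ : Measurable G₃ := Measurable.indicator (by fun_prop) m3
  calc ∫⁻ w, ENNReal.ofReal (Φ w)
      ≤ ∫⁻ w, (ENNReal.ofReal A₁ * G₁ w + ENNReal.ofReal A₂ * G₂ w +
          ENNReal.ofReal A₃ * G₃ (x - w)) := by
        refine lintegral_mono_ae ?_
        filter_upwards [compl_mem_ae_iff.2 (measure_singleton (0:ℂ))] with w hw
        rcases h w hw with ⟨h1, h2⟩ | ⟨h1, h2⟩ | ⟨h1, h2⟩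
        · refine le_trans ?_ (le_self_add.trans le_self_add)
          rw [show G₁ w = _ from Set.indicator_of_mem (by exact h1) _, ← ENNReal.ofReal_mul hA₁]
          exact ENNReal.ofReal_le_ofReal h2
        · refine le_trans ?_ (le_add_self.trans le_self_add)
          rw [show G₂ w = _ from Set.indicator_of_mem (by exact h1) _, ← ENNReal.ofReal_mul hA₂]
          exact ENNReal.ofReal_le_ofReal h2
        · refine le_trans ?_ le_add_self
          rw [show G₃ (x - w) = _ from Set.indicator_of_mem (by exact h1) _,
            ← ENNReal.ofReal_mul hA₃]
          exact ENNReal.ofReal_le_ofReal h2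
    _ = _ := by
        have h2a : 0 < 2 - a := by linarith
        have h2d : 0 < d - 2 := by linarith
        rw [lintegral_add_left (by fun_prop), lintegral_add_left (by fun_prop),
          lintegral_const_mul _ hG₁, lintegral_const_mul _ hG₂,
          lintegral_const_mul _ (by fun_prop), lintegral_sub_left_eq_self G₃ x,
          lintegral_indicator m1, lintegral_indicator m2, lintegral_indicator m3,
          lintegral_rpow_norm_le ha hR, lintegral_rpow_norm_gt hd hR,
          lintegral_rpow_norm_le (by norm_num) (by positivity : 0 < 3 * R),
          ← ENNReal.ofReal_mul hA₁, ← ENNReal.ofReal_mul hA₂, ← ENNReal.ofReal_mul hA₃,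
          ← ENNReal.ofReal_add (by positivity) (by positivity),
          ← ENNReal.ofReal_add (by positivity) (by positivity)]
        congr 1
        norm_num
        ring

/-- The kernel of the commutator of the Beurling transform with `|z|ˢ`, normalized. -/
def powerCommKernel (s : ℝ) (z ζ : ℂ) : ℝ := (‖z - ζ‖ ^ 2)⁻¹ * |(‖z‖ / ‖ζ‖) ^ s - 1|

lemma powerCommKernel_nonneg (s : ℝ) (z ζ : ℂ) : 0 ≤ powerCommKernel s z ζ := by
  unfold powerCommKernel; positivity

/-- Monotonicity of `x^s` in `s` on each side of `x = 1`. Comparison with `s = 2` makes the diagonal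
estimate polynomial and uniform in `s`. -/
lemma abs_rpow_sub_one_le {x s : ℝ} (hx : 0 < x) (hs : 0 ≤ s) (hs2 : s ≤ 2) :
    |x ^ s - 1| ≤ |x ^ 2 - 1| := by
  rcases le_total 1 x with h | h
  · have h1 : 1 ≤ x ^ s := Real.one_le_rpow h hs
    have h2 : x ^ s ≤ x ^ (2:ℝ) := Real.rpow_le_rpow_of_exponent_le h hs2
    rw [Real.rpow_two] at h2
    rw [abs_of_nonneg (by linarith), abs_of_nonneg (by linarith)]
    linarith
  · have h1 : x ^ s ≤ 1 := Real.rpow_le_one hx.le h hs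
    have h2 : x ^ (2:ℝ) ≤ x ^ s := Real.rpow_le_rpow_of_exponent_ge hx h hs2
    rw [Real.rpow_two] at h2
    rw [abs_of_nonpos (by linarith), abs_of_nonpos (by linarith)]
    linarith

/-- The three regimes are `|z| > 2|ζ|`, `|ζ| > 2|z|` and comparable moduli. In the last one, `x² - 1
= (x + 1)(x - 1)` with `x = |z|/|ζ| ≤ 2` gains a factor `|z - ζ|/|ζ|`, making the singularity
integrable. -/
lemma powerCommKernel_le {s : ℝ} (hs : 0 ≤ s) (hs2 : s ≤ 2) {z ζ : ℂ} (hz : z ≠ 0) (hζ : ζ ≠ 0) :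
    (‖ζ‖ < ‖z‖ ∧ powerCommKernel s z ζ ≤ 4 * ‖z‖ ^ (s - 2) * ‖ζ‖ ^ (-s)) ∨
    (‖z‖ < ‖ζ‖ ∧ powerCommKernel s z ζ ≤ 4 * ‖ζ‖ ^ (-(2:ℝ))) ∨
    (‖ζ‖ ≤ 2 * ‖z‖ ∧ ‖z‖ ≤ 2 * ‖ζ‖ ∧
      powerCommKernel s z ζ ≤ 3 * ‖ζ‖⁻¹ * ‖z - ζ‖ ^ (-(1:ℝ))) := by
  have hr : 0 < ‖z‖ := norm_pos_iff.2 hz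
  have hρ : 0 < ‖ζ‖ := norm_pos_iff.2 hζ
  have hx : 0 < ‖z‖ / ‖ζ‖ := by positivity
  rcases lt_or_ge (2 * ‖ζ‖) ‖z‖ with h1 | h1
  · refine Or.inl ⟨by linarith, ?_⟩
    have h2 : ‖z‖ / 2 ≤ ‖z - ζ‖ := by linarith [norm_sub_norm_le z ζ]
    have h3 : 1 ≤ (‖z‖ / ‖ζ‖) ^ s := Real.one_le_rpow ((one_le_div hρ).2 (by linarith)) hs
    rw [powerCommKernel, abs_of_nonneg (by linarith), Real.rpow_sub hr, Real.rpow_two,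
      Real.rpow_neg hρ.le]
    calc (‖z - ζ‖ ^ 2)⁻¹ * ((‖z‖ / ‖ζ‖) ^ s - 1)
        ≤ ((‖z‖ / 2) ^ 2)⁻¹ * (‖z‖ / ‖ζ‖) ^ s := by
          gcongr
          linarith
      _ = _ := by
          rw [Real.div_rpow hr.le hρ.le]
          field_simp
          norm_num
  rcases lt_or_ge (2 * ‖z‖) ‖ζ‖ with h2 | h2
  · refine Or.inr (Or.inl ⟨by linarith, ?_⟩)
    have h3 : ‖ζ‖ / 2 ≤ ‖z - ζ‖ := by
      have := norm_sub_norm_le ζ z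
      rw [norm_sub_rev] at this
      linarith
    have h4 : (‖z‖ / ‖ζ‖) ^ s ≤ 1 :=
      Real.rpow_le_one hx.le ((div_le_one hρ).2 (by linarith)) hs
    have h5 : 0 ≤ (‖z‖ / ‖ζ‖) ^ s := by positivity
    rw [powerCommKernel, Real.rpow_neg hρ.le, Real.rpow_two]
    calc (‖z - ζ‖ ^ 2)⁻¹ * |(‖z‖ / ‖ζ‖) ^ s - 1|
        ≤ ((‖ζ‖ / 2) ^ 2)⁻¹ * 1 := by
          gcongr
          rw [abs_le]; constructor <;> linarith
      _ = _ := by field_simp; norm_num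
  · refine Or.inr (Or.inr ⟨h2, h1, ?_⟩)
    rcases eq_or_ne z ζ with h0 | h0
    · rw [powerCommKernel, h0, sub_self, norm_zero]
      norm_num
    have hd : 0 < ‖z - ζ‖ := norm_pos_iff.2 (sub_ne_zero.2 h0)
    have h3 := abs_rpow_sub_one_le hx hs hs2
    have h4 : |(‖z‖ / ‖ζ‖) ^ 2 - 1| ≤ 3 * (‖z - ζ‖ / ‖ζ‖) := by
      rw [show (‖z‖ / ‖ζ‖) ^ 2 - 1 = (‖z‖ / ‖ζ‖ + 1) * ((‖z‖ - ‖ζ‖) / ‖ζ‖) by field_simp; ring,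
        abs_mul, abs_div, abs_of_pos hρ, abs_of_pos (by positivity)]
      gcongr
      · have : ‖z‖ / ‖ζ‖ ≤ 2 := (div_le_iff₀ hρ).2 h1
        linarith
      · exact abs_norm_sub_norm_le z ζ
    rw [powerCommKernel, Real.rpow_neg_one]
    calc (‖z - ζ‖ ^ 2)⁻¹ * |(‖z‖ / ‖ζ‖) ^ s - 1| ≤ (‖z - ζ‖ ^ 2)⁻¹ * (3 * (‖z - ζ‖ / ‖ζ‖)) := by
          gcongr
          exact h3.trans h4
      _ = _ := by field_simp

lemma rpow_neg_le_four_mul {x y c : ℝ} (hy : 0 < y) (h : y ≤ 2 * x) (hc : 0 ≤ c)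
    (hc2 : c ≤ 2) : x ^ (-c) ≤ 4 * y ^ (-c) := by
  have hx : 0 < x := by linarith
  rw [Real.rpow_neg hx.le, Real.rpow_neg hy.le]
  have h1 : y ^ c ≤ 4 * x ^ c := by
    calc y ^ c ≤ (2 * x) ^ c := by gcongr
      _ = 2 ^ c * x ^ c := Real.mul_rpow (by norm_num) hx.le
      _ ≤ 2 ^ (2:ℝ) * x ^ c := by gcongr; norm_num
      _ = _ := by norm_num
  rw [inv_le_iff_one_le_mul₀ (by positivity)]
  have hy' : 0 < y ^ c := by positivity
  rw [show 4 * (y ^ c)⁻¹ * x ^ c = (4 * x ^ c) / y ^ c by ring, one_le_div hy']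
  exact h1

/-- The Schur constant of `powerCommKernel`. -/
def powerCommBound (p κ : ℝ) : ℝ := 2 * Real.pi * (4 / κ + 2 * p + 36)

/-- The singularity `|ζ|^(-s-2/p)` at the origin costs `4/κ`, the tail `|ζ|^(-2-2/p)` costs `2p`,
and the diagonal costs `12 · 3 = 36`. -/
lemma lintegral_powerCommKernel_mul_le {p s κ : ℝ} (hp : 2 ≤ p) (hs : 0 ≤ s) (hκ : 0 < κ)
    (h : s + 2 / p + κ ≤ 2) {z : ℂ} (hz : z ≠ 0) :
    ∫⁻ ζ, ENNReal.ofReal (powerCommKernel s z ζ * ‖ζ‖ ^ (-(2 / p))) ≤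
      ENNReal.ofReal (powerCommBound p κ * ‖z‖ ^ (-(2 / p))) := by
  have hr : 0 < ‖z‖ := norm_pos_iff.2 hz
  have hb0 : 0 < 2 / p := by positivity
  have hb1 : 2 / p ≤ 1 := (div_le_one (by linarith)).2 hp
  refine (lintegral_ofReal_le_of_trichotomy (x := z) (R := ‖z‖) (a := s + 2 / p) (d := 2 + 2 / p)
    (A₁ := 4 * ‖z‖ ^ (s - 2)) (A₂ := 4) (A₃ := 12 * ‖z‖ ^ (-(1 + 2 / p))) hr (by linarith)
    (by linarith) (by positivity) (by norm_num) (by positivity) fun ζ hζ => ?_).trans ?_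
  · have hρ : 0 < ‖ζ‖ := norm_pos_iff.2 hζ
    have hρb : 0 ≤ ‖ζ‖ ^ (-(2 / p)) := by positivity
    rcases powerCommKernel_le hs (by linarith) hz hζ with ⟨h1, h2⟩ | ⟨h1, h2⟩ | ⟨h1, h1', h2⟩
    · refine Or.inl ⟨h1.le, (mul_le_mul_of_nonneg_right h2 hρb).trans_eq ?_⟩
      rw [neg_add, Real.rpow_add hρ]; ring
    · refine Or.inr (Or.inl ⟨h1, (mul_le_mul_of_nonneg_right h2 hρb).trans_eq ?_⟩)
      rw [neg_add, Real.rpow_add hρ]; ring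
    · refine Or.inr (Or.inr ⟨by linarith [norm_sub_le z ζ],
        (mul_le_mul_of_nonneg_right h2 hρb).trans ?_⟩)
      have h3 : ‖ζ‖⁻¹ * ‖ζ‖ ^ (-(2 / p)) ≤ 4 * ‖z‖ ^ (-(1 + 2 / p)) := by
        rw [← Real.rpow_neg_one, ← Real.rpow_add hρ, ← neg_add]
        exact rpow_neg_le_four_mul hr h1' (by linarith) (by linarith)
      have h4 : 0 ≤ ‖z - ζ‖ ^ (-(1:ℝ)) := by positivity
      nlinarith [mul_le_mul_of_nonneg_right h3 h4]
  · refine ENNReal.ofReal_le_ofReal ?_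
    have hκ' : 0 < 2 - (s + 2 / p) := by linarith
    have e1 : ‖z‖ ^ (s - 2) * ‖z‖ ^ (2 - (s + 2 / p)) = ‖z‖ ^ (-(2 / p)) := by
      rw [← Real.rpow_add hr]; congr 1; ring
    have e3 : ‖z‖ ^ (-(1 + 2 / p)) * ‖z‖ = ‖z‖ ^ (-(2 / p)) := by
      nth_rewrite 2 [← Real.rpow_one ‖z‖]
      rw [← Real.rpow_add hr]; congr 1; ring
    have e2 : (2:ℝ) - (2 + 2 / p) = -(2 / p) := by ring
    have e2' : (2:ℝ) + 2 / p - 2 = 2 / p := by ring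
    have hN : 0 ≤ ‖z‖ ^ (-(2 / p)) := by positivity
    have hle : 4 / (2 - (s + 2 / p)) ≤ 4 / κ := by gcongr; linarith
    rw [e2, e2', powerCommBound]
    calc _ = 2 * Real.pi * (4 / (2 - (s + 2 / p)) *
            (‖z‖ ^ (s - 2) * ‖z‖ ^ (2 - (s + 2 / p))) + 2 * p * ‖z‖ ^ (-(2 / p)) +
            36 * (‖z‖ ^ (-(1 + 2 / p)) * ‖z‖)) := by field_simp; ring
      _ = 2 * Real.pi * (4 / (2 - (s + 2 / p)) + 2 * p + 36) * ‖z‖ ^ (-(2 / p)) := by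
          rw [e1, e3]; ring
      _ ≤ _ := by gcongr

/-- The transposed Schur integral, with the roles exchanged: now the origin costs `2p` and the tail
`4/κ`. -/
lemma lintegral_mul_powerCommKernel_le {p s κ : ℝ} (hp : 2 ≤ p) (hs : 0 ≤ s) (hκ : 0 < κ)
    (h : s + 2 / p + κ ≤ 2) {ζ : ℂ} (hζ : ζ ≠ 0) :
    ∫⁻ z, ENNReal.ofReal (‖z‖ ^ (-(2 - 2 / p)) * powerCommKernel s z ζ) ≤
      ENNReal.ofReal (powerCommBound p κ * ‖ζ‖ ^ (-(2 - 2 / p))) := by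
  have hρ : 0 < ‖ζ‖ := norm_pos_iff.2 hζ
  have hb0 : 0 < 2 / p := by positivity
  have hb1 : 2 / p ≤ 1 := (div_le_one (by linarith)).2 hp
  set c := 2 - 2 / p with hc
  refine (lintegral_ofReal_le_of_trichotomy (x := ζ) (R := ‖ζ‖) (a := c) (d := 2 - s + c)
    (A₁ := 4 * ‖ζ‖ ^ (-(2:ℝ))) (A₂ := 4 * ‖ζ‖ ^ (-s)) (A₃ := 12 * ‖ζ‖ ^ (-(1 + c))) hρ
    (by linarith) (by linarith) (by positivity) (by positivity) (by positivity)
    fun z hz => ?_).trans ?_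
  · have hr : 0 < ‖z‖ := norm_pos_iff.2 hz
    have hrc : 0 ≤ ‖z‖ ^ (-c) := by positivity
    rcases powerCommKernel_le hs (by linarith) hz hζ with ⟨h1, h2⟩ | ⟨h1, h2⟩ | ⟨h1, h1', h2⟩
    · refine Or.inr (Or.inl ⟨h1, (mul_le_mul_of_nonneg_left h2 hrc).trans_eq ?_⟩)
      rw [show -(2 - s + c) = (s - 2) + -c by ring, Real.rpow_add hr]; ring
    · refine Or.inl ⟨h1.le, (mul_le_mul_of_nonneg_left h2 hrc).trans_eq ?_⟩
      ring
    · refine Or.inr (Or.inr ⟨by linarith [norm_sub_le ζ z],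
        (mul_le_mul_of_nonneg_left h2 hrc).trans ?_⟩)
      have h3 : ‖z‖ ^ (-c) ≤ 4 * ‖ζ‖ ^ (-c) :=
        rpow_neg_le_four_mul hρ h1 (by linarith) (by linarith)
      rw [norm_sub_rev ζ z, neg_add, Real.rpow_add hρ, Real.rpow_neg_one ‖ζ‖]
      have h4 : 0 ≤ ‖ζ‖⁻¹ * ‖z - ζ‖ ^ (-(1:ℝ)) := by positivity
      nlinarith [mul_le_mul_of_nonneg_right h3 h4]
  · refine ENNReal.ofReal_le_ofReal ?_
    have hκ' : 0 < c - s := by linarith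
    have e1 : ‖ζ‖ ^ (-(2:ℝ)) * ‖ζ‖ ^ (2 - c) = ‖ζ‖ ^ (-c) := by
      rw [← Real.rpow_add hρ]; congr 1; ring
    have e2 : ‖ζ‖ ^ (-s) * ‖ζ‖ ^ (2 - (2 - s + c)) = ‖ζ‖ ^ (-c) := by
      rw [← Real.rpow_add hρ]; congr 1; ring
    have e3 : ‖ζ‖ ^ (-(1 + c)) * ‖ζ‖ = ‖ζ‖ ^ (-c) := by
      nth_rewrite 2 [← Real.rpow_one ‖ζ‖]
      rw [← Real.rpow_add hρ]; congr 1; ring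
    have hN : 0 ≤ ‖ζ‖ ^ (-c) := by positivity
    have hle : 4 / (c - s) ≤ 4 / κ := by gcongr; linarith
    rw [powerCommBound, show 2 - s + c - 2 = c - s by ring]
    calc _ = 2 * Real.pi * (4 / (2 - c) * (‖ζ‖ ^ (-(2:ℝ)) * ‖ζ‖ ^ (2 - c)) +
            4 / (c - s) * (‖ζ‖ ^ (-s) * ‖ζ‖ ^ (2 - (2 - s + c))) +
            36 * (‖ζ‖ ^ (-(1 + c)) * ‖ζ‖)) := by ring
      _ = 2 * Real.pi * (4 / (c - s) + 2 * p + 36) * ‖ζ‖ ^ (-c) := by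
          rw [e1, e2, e3, show 2 - c = 2 / p by rw [hc]; ring]; field_simp; ring
      _ ≤ _ := by gcongr

lemma measurable_powerCommKernel (s : ℝ) : Measurable (Function.uncurry (powerCommKernel s)) := by
  unfold powerCommKernel Function.uncurry
  fun_prop

lemma lintegral_powerCommKernel_rpow_le {p s κ : ℝ} (hp : 2 ≤ p) (hs : 0 ≤ s) (hκ : 0 < κ)
    (h : s + 2 / p + κ ≤ 2) {f : ℂ → ENNReal} (hf : AEMeasurable f) :
    ∫⁻ z, (∫⁻ ζ, ENNReal.ofReal (powerCommKernel s z ζ) * f ζ) ^ p ≤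
      ENNReal.ofReal (powerCommBound p κ) ^ p * ∫⁻ ζ, f ζ ^ p := by
  have hp0 : 0 < p := by linarith
  have hp1 : 0 < p - 1 := by linarith
  have hM : 0 < powerCommBound p κ := by unfold powerCommBound; positivity
  set M := powerCommBound p κ with hMdef
  have hne : ∀ᵐ z : ℂ, z ≠ 0 := compl_mem_ae_iff.2 (measure_singleton (0:ℂ))
  -- The `(p - 1)`-st power of the test function `|ζ|^(-2/p)` is exactly the power in the transposed
  -- estimate, so the constants combine to `M^(p-1) · M`.
  have hexp : -(2 / p) * (p - 1) = -(2 - 2 / p) := by field_simp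
  have key := lintegral_schur_le (μ := volume) (ν := volume) (p := p) (by linarith)
    (k := fun z ζ => ENNReal.ofReal (powerCommKernel s z ζ))
    (by have := measurable_powerCommKernel s; exact this.ennreal_ofReal) hf
    (H := fun ζ => ENNReal.ofReal (‖ζ‖ ^ (-(2 / p))))
    (G := fun ζ => ENNReal.ofReal (‖ζ‖ ^ (2 - 2 / p)))
    (B := fun ζ => ENNReal.ofReal (M ^ p * ‖ζ‖ ^ (-(2 - 2 / p))))
    (W := fun _ => 1) (A := fun z => ENNReal.ofReal (M * ‖z‖ ^ (-(2 / p))))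
    (by fun_prop) (by fun_prop) (by fun_prop) (by fun_prop) ?_ ?_ ?_
  · simp only [one_mul] at key
    refine key.trans ?_
    rw [← lintegral_const_mul'' _ (by fun_prop)]
    refine lintegral_mono_ae ?_
    filter_upwards [hne] with ζ hζ
    have hρ : 0 < ‖ζ‖ := norm_pos_iff.2 hζ
    rw [← mul_assoc, ← ENNReal.ofReal_mul (by positivity), mul_assoc (M ^ p),
      ← Real.rpow_add hρ, neg_add_cancel, Real.rpow_zero, mul_one,
      ENNReal.ofReal_rpow_of_pos hM]
  · filter_upwards [hne] with ζ hζ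
    have hρ : 0 < ‖ζ‖ := norm_pos_iff.2 hζ
    rw [ENNReal.ofReal_rpow_of_pos (by positivity), ← Real.rpow_mul hρ.le, hexp,
      ← ENNReal.ofReal_mul (by positivity), ← Real.rpow_add hρ, neg_add_cancel, Real.rpow_zero,
      ENNReal.ofReal_one]
  · filter_upwards [hne] with z hz
    refine le_of_eq_of_le (lintegral_congr fun ζ => ?_)
      (lintegral_powerCommKernel_mul_le hp hs hκ h hz)
    rw [ENNReal.ofReal_mul (powerCommKernel_nonneg _ _ _)]
  · filter_upwards [hne] with ζ hζ
    calc _ = ENNReal.ofReal (M ^ (p - 1)) *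
          ∫⁻ z, ENNReal.ofReal (‖z‖ ^ (-(2 - 2 / p)) * powerCommKernel s z ζ) := by
          rw [← lintegral_const_mul' _ _ ENNReal.ofReal_ne_top]
          refine lintegral_congr_ae ?_
          filter_upwards [hne] with z hz
          have hr : 0 < ‖z‖ := norm_pos_iff.2 hz
          rw [one_mul, ENNReal.ofReal_rpow_of_pos (by positivity),
            Real.mul_rpow hM.le (by positivity), ← Real.rpow_mul hr.le, hexp,
            ENNReal.ofReal_mul (by positivity), ENNReal.ofReal_mul (by positivity), mul_assoc]
      _ ≤ ENNReal.ofReal (M ^ (p - 1)) * ENNReal.ofReal (M * ‖ζ‖ ^ (-(2 - 2 / p))) := by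
          gcongr
          exact lintegral_mul_powerCommKernel_le hp hs hκ h hζ
      _ = _ := by
          rw [← ENNReal.ofReal_mul (by positivity), ← mul_assoc, ← Real.rpow_add_one hM.ne',
            sub_add_cancel]

lemma tendsto_setIntegral_norm_sub_gt {E : Type*} [NormedAddCommGroup E] [NormedSpace ℝ E]
    {μ : Measure ℂ} [NullSingletonClass μ] {u : ℂ → E} (hu : Integrable u μ) (z : ℂ) :
    Tendsto (fun ε : ℝ => ∫ w in {w | ε < ‖z - w‖}, u w ∂μ) (𝓝[>] 0) (𝓝 (∫ w, u w ∂μ)) := by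
  have hms : ∀ ε : ℝ, MeasurableSet {w : ℂ | ε < ‖z - w‖} := fun ε =>
    measurableSet_lt measurable_const (by fun_prop)
  simp only [← integral_indicator (hms _)]
  refine tendsto_integral_filter_of_dominated_convergence (fun w => ‖u w‖)
    (Eventually.of_forall fun ε => hu.1.indicator (hms ε))
    (Eventually.of_forall fun ε => Eventually.of_forall fun w => norm_indicator_le_norm_self _ _)
    hu.norm ?_
  filter_upwards [compl_mem_ae_iff.2 (measure_singleton z)] with w hw
  have hw0 : 0 < ‖z - w‖ := norm_pos_iff.2 (sub_ne_zero.2 (Ne.symm hw))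
  refine tendsto_const_nhds.congr' ?_
  filter_upwards [mem_nhdsWithin_of_mem_nhds (Iio_mem_nhds hw0)] with ε hε
  rw [Set.indicator_of_mem (by exact hε)]

/-- The Beurling transform is bounded with a power weight `|z|^{sp}`, with norm
`O(p + 1 / κ)`, `κ` measuring the distance to the critical exponent. -/
theorem exists_beurling_principalValue_weighted : ∃ C : ℝ, 0 < C ∧ ∀ p s κ : ℝ, 2 ≤ p → 0 ≤ s →
    0 < κ → s + 2 / p + κ ≤ 2 → ∀ f : ℂ → ℂ, AEStronglyMeasurable f →
    MemLp (fun w => ‖w‖ ^ s • f w) (ENNReal.ofReal p) →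
    ∃ F : ℂ → ℂ, AEStronglyMeasurable F ∧
      eLpNorm (fun z => ‖z‖ ^ s • F z) (ENNReal.ofReal p) ≤
        ENNReal.ofReal (C * (p + 1 / κ)) *
          eLpNorm (fun w => ‖w‖ ^ s • f w) (ENNReal.ofReal p) ∧
      ∀ᵐ z, (∀ ε : ℝ, 0 < ε → IntegrableOn (fun w => f w * ((z - w) ^ 2)⁻¹) {w | ε < ‖z - w‖}) ∧
        Tendsto (fun ε => beurlingTrunc f ε z) (𝓝[>] 0) (𝓝 (F z)) := by
  obtain ⟨C, hC, hB⟩ := exists_beurling_principalValue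
  refine ⟨C + 40 * Real.pi, by positivity, fun p s κ hp hs hκ hsp f hfm hg => ?_⟩
  have hp0 : 0 < p := by linarith
  have hp1 : 1 < p := by linarith
  set g : ℂ → ℂ := fun w => ‖w‖ ^ s • f w with hgdef
  obtain ⟨B, hBm, hBn, hBt⟩ := hB p hp g hg
  -- Since `|z|ˢ f(w) = g(w) + (|z|ˢ - |w|ˢ) f(w)`, the weighted transform of `f` is the unweighted
  -- transform of `g` plus this commutator, which for almost every `z` converges absolutely and
  -- needs no principal value.
  set n : ℂ → ℂ → ℂ := fun z w => ((‖z‖ ^ s - ‖w‖ ^ s) • f w) * ((z - w) ^ 2)⁻¹ with hn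
  have hM : 0 < powerCommBound p κ := by unfold powerCommBound; positivity
  have hne : ∀ᵐ z : ℂ, z ≠ 0 := compl_mem_ae_iff.2 (measure_singleton (0:ℂ))
  have hnm : AEStronglyMeasurable (Function.uncurry n) (volume.prod volume) := by
    have h1 : Measurable fun x : ℂ × ℂ => ‖x.1‖ ^ s - ‖x.2‖ ^ s := by fun_prop
    have h2 : Measurable fun x : ℂ × ℂ => ((x.1 - x.2) ^ 2)⁻¹ := by fun_prop
    exact (h1.aestronglyMeasurable.smul hfm.comp_snd).mul h2.aestronglyMeasurable
  have hnz : ∀ z, AEStronglyMeasurable (n z) := fun z => by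
    have h1 : Measurable fun w : ℂ => ‖z‖ ^ s - ‖w‖ ^ s := by fun_prop
    have h2 : Measurable fun w : ℂ => ((z - w) ^ 2)⁻¹ := by fun_prop
    exact (h1.aestronglyMeasurable.smul hfm).mul h2.aestronglyMeasurable
  have hnorm : ∀ z w, w ≠ 0 → ‖n z w‖ₑ = ENNReal.ofReal (powerCommKernel s z w) * ‖g w‖ₑ :=
    fun z w hw => by
      have hw' : 0 < ‖w‖ := norm_pos_iff.2 hw
      rw [← ofReal_norm, ← ofReal_norm,
        ← ENNReal.ofReal_mul (powerCommKernel_nonneg _ _ _)]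
      congr 1
      simp only [hn, hgdef, powerCommKernel]
      rw [norm_mul, norm_smul, norm_smul, norm_inv, norm_pow, Real.norm_eq_abs,
        Real.norm_of_nonneg (by positivity : 0 ≤ ‖w‖ ^ s), Real.div_rpow (norm_nonneg _) hw'.le,
        show ‖z‖ ^ s - ‖w‖ ^ s = (‖z‖ ^ s / ‖w‖ ^ s - 1) * ‖w‖ ^ s by field_simp, abs_mul,
        abs_of_nonneg (by positivity : 0 ≤ ‖w‖ ^ s)]
      ring
  have hnint : ∀ z, ∫⁻ w, ‖n z w‖ₑ =
      ∫⁻ w, ENNReal.ofReal (powerCommKernel s z w) * ‖g w‖ₑ := fun z =>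
    lintegral_congr_ae (hne.mono fun w hw => hnorm z w hw)
  have hschur := lintegral_powerCommKernel_rpow_le hp hs hκ hsp hg.1.enorm
  simp only [← hnint] at hschur
  rw [← eLpNorm_ofReal_rpow hp0] at hschur
  have hfin : ∀ᵐ z, Integrable (n z) := by
    have h1 : AEMeasurable fun z => (∫⁻ w, ‖n z w‖ₑ) ^ p :=
      (hnm.enorm.lintegral_prod_right').pow_const p
    have h2 := ae_lt_top' h1 (hschur.trans_lt (ENNReal.mul_lt_top
      (ENNReal.rpow_lt_top_of_nonneg hp0.le ENNReal.ofReal_ne_top)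
      (ENNReal.rpow_lt_top_of_nonneg hp0.le hg.2.ne))).ne
    filter_upwards [h2] with z hz
    exact ⟨hnz z, (ENNReal.rpow_lt_top_iff_of_pos hp0).1 hz⟩
  set N : ℂ → ℂ := fun z => ∫ w, n z w with hN
  have hNm : AEStronglyMeasurable N := hnm.integral_prod_right'
  have hNn : eLpNorm N (ENNReal.ofReal p) ≤
      ENNReal.ofReal (powerCommBound p κ) * eLpNorm g (ENNReal.ofReal p) := by
    rw [← ENNReal.rpow_le_rpow_iff hp0, ENNReal.mul_rpow_of_nonneg _ _ hp0.le,
      eLpNorm_ofReal_rpow hp0]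
    refine le_trans (lintegral_mono fun z => ?_) hschur
    exact ENNReal.rpow_le_rpow (enorm_integral_le_lintegral_enorm _) hp0.le
  have hrs : Measurable fun z : ℂ => (‖z‖ ^ s)⁻¹ := by fun_prop
  refine ⟨fun z => (‖z‖ ^ s)⁻¹ • (B z + N z),
    hrs.aestronglyMeasurable.smul (hBm.1.add hNm), ?_, ?_⟩
  · have e : (fun z : ℂ => ‖z‖ ^ s • (‖z‖ ^ s)⁻¹ • (B z + N z)) =ᵐ[volume] B + N := by
      filter_upwards [hne] with z hz
      have hz' : 0 < ‖z‖ ^ s := Real.rpow_pos_of_pos (norm_pos_iff.2 hz) s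
      rw [smul_smul, mul_inv_cancel₀ hz'.ne', one_smul, Pi.add_apply]
    rw [eLpNorm_congr_ae e]
    refine (eLpNorm_add_le hBm.1 hNm (by simpa using hp1.le)).trans
      ((add_le_add hBn hNn).trans ?_)
    rw [← add_mul, ← ENNReal.ofReal_add (by positivity) hM.le]
    gcongr
    rw [powerCommBound, add_mul]
    have h1 : C * p ≤ C * (p + 1 / κ) := by
      gcongr
      exact le_add_of_nonneg_right (by positivity)
    have h2 : 4 / κ + 2 * p + 36 ≤ 20 * (p + 1 / κ) := by
      have : 4 / κ = 4 * (1 / κ) := by ring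
      have h3 : 0 < 1 / κ := by positivity
      linarith
    have h3 : 2 * Real.pi * (4 / κ + 2 * p + 36) ≤ 2 * Real.pi * (20 * (p + 1 / κ)) := by
      gcongr
    linarith
  · filter_upwards [hBt, hfin, hne] with z hzB hzn hz0
    have hz' : 0 < ‖z‖ ^ s := Real.rpow_pos_of_pos (norm_pos_iff.2 hz0) s
    have e : ∀ w, f w * ((z - w) ^ 2)⁻¹ =
        (‖z‖ ^ s)⁻¹ • (g w * ((z - w) ^ 2)⁻¹ + n z w) := fun w => by
      simp only [hgdef, hn]
      rw [← add_mul, ← add_smul, add_sub_cancel, ← smul_mul_assoc, smul_smul,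
        inv_mul_cancel₀ hz'.ne', one_smul]
    have hgi := fun (ε : ℝ) (hε : 0 < ε) => integrableOn_mul_inv_sq hp1 hg hε z
    refine ⟨fun ε hε => ?_, ?_⟩
    · simp only [e]
      exact ((hgi ε hε).add hzn.integrableOn).smul (‖z‖ ^ s)⁻¹
    · refine ((hzB.add (tendsto_setIntegral_norm_sub_gt hzn z)).const_smul (‖z‖ ^ s)⁻¹).congr' ?_
      filter_upwards [self_mem_nhdsWithin] with ε hε
      simp only [beurlingTrunc, e]
      rw [integral_smul, integral_add (hgi ε hε) hzn.integrableOn]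

/-! ### Reduction of the half-plane operator to the plane. -/

/-- The real-linear map `h ↦ -(i / 2π) conj (c h)`. -/
def antilinearMap : ℂ →L[ℝ] (ℂ →L[ℝ] ℂ) :=
  (ContinuousLinearMap.compL ℝ ℂ ℂ ℂ (((ContinuousLinearMap.mul ℝ ℂ)
    (-((((2 * Real.pi)⁻¹ : ℝ) : ℂ) * Complex.I))).comp (Complex.conjCLE : ℂ →L[ℝ] ℂ))).comp
    (ContinuousLinearMap.mul ℝ ℂ)

lemma antilinearMap_apply (c h : ℂ) : antilinearMap c h =
    -((((2 * Real.pi)⁻¹ : ℝ) : ℂ) * Complex.I) * starRingEnd ℂ (c * h) := rfl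

lemma norm_antilinearMap_le (c : ℂ) : ‖antilinearMap c‖ ≤ ‖c‖ := by
  refine ContinuousLinearMap.opNorm_le_bound _ (norm_nonneg _) fun h => ?_
  have h1 : (2 * Real.pi)⁻¹ ≤ 1 := inv_le_one_of_one_le₀ (by linarith [Real.pi_gt_three])
  have h0 : 0 ≤ (2 * Real.pi)⁻¹ := by positivity
  rw [antilinearMap_apply, norm_mul, norm_neg, norm_mul, Complex.norm_I, Complex.norm_real,
    RCLike.norm_conj, norm_mul, mul_one, Real.norm_of_nonneg h0]
  exact mul_le_of_le_one_left (by positivity) h1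

lemma div_norm_sq_eq (x : ℂ) : x / ((‖x‖ ^ 2 : ℝ) : ℂ) = starRingEnd ℂ x⁻¹ := by
  rw [Complex.inv_def, map_mul, Complex.conj_conj, Complex.normSq_eq_norm_sq, Complex.conj_ofReal,
    div_eq_mul_inv, Complex.ofReal_inv]

/-- As `x/|x|²` is the conjugate of `1/x`, the kernel is `i/2π` times the conjugate of a function
holomorphic in `z`, and the chain rule gives a conjugate-linear differential. -/
lemma biotSavartDeriv_eq {z ζ : ℂ} (h1 : z ≠ ζ) (h2 : z ≠ starRingEnd ℂ ζ) :
    biotSavartDeriv z ζ =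
      antilinearMap (((z - ζ) ^ 2)⁻¹ - ((z - starRingEnd ℂ ζ) ^ 2)⁻¹) := by
  have hd : ∀ a : ℂ, z ≠ a → HasFDerivAt (𝕜 := ℝ) (fun w : ℂ => starRingEnd ℂ (w - a)⁻¹)
      ((Complex.conjCLE : ℂ →L[ℝ] ℂ).comp
        ((ContinuousLinearMap.mul ℝ ℂ) (-((z - a) ^ 2)⁻¹))) z := fun a ha => by
    have h := ((hasDerivAt_id z).sub_const a).inv (sub_ne_zero.2 ha)
    have h' := (Complex.conjCLE : ℂ →L[ℝ] ℂ).hasFDerivAt.comp z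
      (h.hasFDerivAt.restrictScalars ℝ)
    refine h'.congr_fderiv ?_
    ext
    simp [div_eq_mul_inv, mul_comm]
  have hB : (fun w : ℂ => biotSavart w ζ) = fun w => ((((2 * Real.pi)⁻¹ : ℝ) : ℂ) * Complex.I) *
      (starRingEnd ℂ (w - ζ)⁻¹ - starRingEnd ℂ (w - starRingEnd ℂ ζ)⁻¹) := by
    ext w
    rw [biotSavart, div_norm_sq_eq, div_norm_sq_eq, mul_assoc]
  rw [biotSavartDeriv, hB]
  refine (((hd ζ h1).sub (hd _ h2)).const_mul
    ((((2 * Real.pi)⁻¹ : ℝ) : ℂ) * Complex.I)).fderiv.trans ?_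
  ext h
  all_goals
    rw [antilinearMap_apply]
    simp
    ring

lemma measurableSet_halfPlane : MeasurableSet halfPlane :=
  measurableSet_lt measurable_const Complex.measurable_im

lemma conj_notMem_halfPlane {z : ℂ} (hz : z ∈ halfPlane) : starRingEnd ℂ z ∉ halfPlane := by
  have hz : 0 < z.im := hz
  simp only [halfPlane, Set.mem_ofPred_eq, Complex.conj_im]
  linarith

lemma measurePreserving_conj : MeasurePreserving (starRingEnd ℂ : ℂ → ℂ) :=
  Complex.conjLIE.measurePreserving

/-- The extension of a density on the half-plane by odd reflection. -/
def oddReflection (f : ℂ → ℝ) (z : ℂ) : ℂ := f z - f (starRingEnd ℂ z)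

/-- At each point where the principal value of the Beurling transform of the odd reflection
exists, so does that of the half-plane operator. -/
lemma principalValue_of_oddReflection {f : ℂ → ℝ} (hf : ∀ z, z ∉ halfPlane → f z = 0) {z c : ℂ}
    (hz : z ∈ halfPlane)
    (hi : ∀ ε : ℝ, 0 < ε →
      IntegrableOn (fun w => oddReflection f w * ((z - w) ^ 2)⁻¹) {w | ε < ‖z - w‖})
    (hc : Tendsto (fun ε => beurlingTrunc (oddReflection f) ε z) (𝓝[>] 0) (𝓝 c)) :
    PrincipalValueExists f z ∧ singularT f z = antilinearMap c := by
  have hz0 : 0 < z.im := hz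
  have hms : ∀ ε : ℝ, MeasurableSet {w : ℂ | ε < ‖z - w‖} := fun ε =>
    measurableSet_lt measurable_const (by fun_prop)
  have hset : ∀ ε : ℝ, {ζ | ζ ∈ halfPlane ∧ ε < ‖z - ζ‖} = halfPlane ∩ {ζ | ε < ‖z - ζ‖} :=
    fun ε => rfl
  set u₁ : ℂ → ℂ := fun w => f w * ((z - w) ^ 2)⁻¹ with hu₁
  set v : ℂ → ℂ := fun w => f (starRingEnd ℂ w) * ((z - w) ^ 2)⁻¹ with hv
  set u₂ : ℂ → ℂ := fun w => f w * ((z - starRingEnd ℂ w) ^ 2)⁻¹ with hu₂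
  have hodd : ∀ w, oddReflection f w * ((z - w) ^ 2)⁻¹ = u₁ w - v w := fun w => by
    simp only [oddReflection, hu₁, hv]; ring
  have hu₁0 : ∀ w, w ∉ halfPlane → u₁ w = 0 := fun w hw => by simp [hu₁, hf w hw]
  have hu₂0 : ∀ w, w ∉ halfPlane → u₂ w = 0 := fun w hw => by simp [hu₂, hf w hw]
  have hv0 : ∀ w, w ∈ halfPlane → v w = 0 := fun w hw => by
    simp [hv, hf _ (conj_notMem_halfPlane hw)]
  have hi₁ : ∀ ε : ℝ, 0 < ε → IntegrableOn u₁ {w | ε < ‖z - w‖} := fun ε hε => by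
    have e : u₁ = halfPlane.indicator fun w => oddReflection f w * ((z - w) ^ 2)⁻¹ := by
      ext w
      by_cases hw : w ∈ halfPlane
      · rw [Set.indicator_of_mem hw, hodd, hv0 w hw, sub_zero]
      · rw [Set.indicator_of_notMem hw, hu₁0 w hw]
    rw [e]
    exact Integrable.indicator (hi ε hε) measurableSet_halfPlane
  have hiv : ∀ ε : ℝ, 0 < ε → IntegrableOn v {w | ε < ‖z - w‖} := fun ε hε => by
    have := (hi₁ ε hε).sub (hi ε hε)
    refine this.congr (Eventually.of_forall fun w => ?_)
    simp only [Pi.sub_apply, hodd, sub_sub_cancel]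
  -- The reflected density vanishes within distance `Im z` of `z`, so the image term is not singular
  -- there.
  have hv1 : ∀ ε : ℝ, ε < z.im → ∀ w, w ∉ {w : ℂ | ε < ‖z - w‖} → v w = 0 := fun ε hε w hw => by
    refine hv0 w ?_
    have h1 : ‖z - w‖ ≤ ε := not_lt.1 hw
    have h2 := (le_abs_self _).trans (Complex.abs_im_le_norm (z - w))
    rw [Complex.sub_im] at h2
    have : 0 < w.im := by linarith
    exact this
  have hvi : Integrable v :=
    (integrableOn_iff_integrable_of_support_subset fun w hw => by
      by_contra hne
      exact hw (hv1 (z.im / 2) (by linarith) w hne)).1 (hiv (z.im / 2) (by positivity))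
  have huv : u₂ = v ∘ (starRingEnd ℂ : ℂ → ℂ) := by
    ext w
    simp [hu₂, hv]
  have hi₂ : Integrable u₂ := by
    rw [huv]
    exact measurePreserving_conj.integrable_comp_of_integrable hvi
  have hint₂ : ∫ w, u₂ w = ∫ w, v w := by
    rw [huv]
    exact measurePreserving_conj.integral_comp
      Complex.conjLIE.toHomeomorph.measurableEmbedding v
  have hker : ∀ ε : ℝ, 0 < ε → ∀ ζ ∈ {ζ | ζ ∈ halfPlane ∧ ε < ‖z - ζ‖},
      f ζ • biotSavartDeriv z ζ = antilinearMap (u₁ ζ - u₂ ζ) := fun ε hε ζ hζ => by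
    have h1 : z ≠ ζ := by
      rintro rfl
      have := hζ.2
      rw [sub_self, norm_zero] at this
      linarith
    have h2 : z ≠ starRingEnd ℂ ζ := by
      rintro rfl
      exact conj_notMem_halfPlane hζ.1 hz
    rw [biotSavartDeriv_eq h1 h2, ← map_smul, Complex.real_smul, mul_sub]
  have hmsε : ∀ ε : ℝ, MeasurableSet {ζ | ζ ∈ halfPlane ∧ ε < ‖z - ζ‖} := fun ε =>
    measurableSet_halfPlane.inter (hms ε)
  have hid : ∀ ε : ℝ, 0 < ε → IntegrableOn (fun ζ => u₁ ζ - u₂ ζ)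
      {ζ | ζ ∈ halfPlane ∧ ε < ‖z - ζ‖} := fun ε hε =>
    ((hi₁ ε hε).sub hi₂.integrableOn).mono_set fun ζ hζ => hζ.2
  have htr : ∀ ε : ℝ, 0 < ε → truncatedT f ε z =
      antilinearMap ((∫ w in {w | ε < ‖z - w‖}, u₁ w) - ∫ w in {w | ε < ‖z - w‖}, u₂ w) :=
    fun ε hε => by
      rw [truncatedT, setIntegral_congr_fun (hmsε ε) (hker ε hε),
        antilinearMap.integral_comp_comm (hid ε hε), ← integral_sub (hi₁ ε hε) hi₂.integrableOn]
      congr 1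
      refine (setIntegral_eq_of_subset_of_forall_sdiff_eq_zero (hms ε) (fun ζ hζ => hζ.2)
        fun ζ hζ => ?_).symm
      have : ζ ∉ halfPlane := fun h => hζ.2 ⟨h, hζ.1⟩
      rw [hu₁0 ζ this, hu₂0 ζ this, sub_zero]
  have hBT : ∀ ε : ℝ, 0 < ε → ε < z.im → beurlingTrunc (oddReflection f) ε z =
      (∫ w in {w | ε < ‖z - w‖}, u₁ w) - ∫ w, u₂ w := fun ε hε hε' => by
    simp only [beurlingTrunc, hodd]
    rw [integral_sub (hi₁ ε hε) (hiv ε hε),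
      setIntegral_eq_integral_of_forall_compl_eq_zero (hv1 ε hε'), hint₂]
  -- The two truncations do not match: the half-plane operator cuts the image term by the distance
  -- to `ζ`, the planar one by the distance to `ζ̄`. Since `u₂` is integrable, the discrepancy tends
  -- to zero.
  have hlim : Tendsto (fun ε => truncatedT f ε z) (𝓝[>] 0) (𝓝 (antilinearMap c)) := by
    have h1 := (hc.add_const (∫ w, u₂ w)).sub (tendsto_setIntegral_norm_sub_gt hi₂ z)
    rw [add_sub_cancel_right] at h1
    refine ((antilinearMap.continuous.tendsto c).comp h1).congr' ?_
    filter_upwards [self_mem_nhdsWithin, mem_nhdsWithin_of_mem_nhds (Iio_mem_nhds hz0)]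
      with ε hε hε'
    rw [Function.comp_apply, htr ε hε, hBT ε hε hε', sub_add_cancel]
  have hs : singularT f z = antilinearMap c := hlim.limUnder_eq
  refine ⟨⟨fun ε hε => ?_, hs ▸ hlim⟩, hs⟩
  exact (antilinearMap.integrable_comp (hid ε hε)).congr
    ((ae_restrict_iff' (hmsε ε)).2 (Eventually.of_forall fun ζ hζ => (hker ε hε ζ hζ).symm))

lemma truncatedT_congr {f g : ℂ → ℝ} (h : f =ᵐ[volume.restrict halfPlane] g) (ε : ℝ) (z : ℂ) :
    truncatedT f ε z = truncatedT g ε z := by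
  refine integral_congr_ae ?_
  filter_upwards [ae_mono (Measure.restrict_mono (fun ζ hζ => hζ.1) le_rfl) h] with ζ hζ
  rw [hζ]

lemma singularT_congr {f g : ℂ → ℝ} (h : f =ᵐ[volume.restrict halfPlane] g) (z : ℂ) :
    singularT f z = singularT g z := by
  simp only [singularT, truncatedT_congr h]

lemma PrincipalValueExists.congr {f g : ℂ → ℝ} (h : f =ᵐ[volume.restrict halfPlane] g) {z : ℂ}
    (hf : PrincipalValueExists f z) : PrincipalValueExists g z := by
  refine ⟨fun ε hε => (hf.1 ε hε).congr ?_, ?_⟩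
  · filter_upwards [ae_mono (Measure.restrict_mono (fun ζ hζ => hζ.1) le_rfl) h] with ζ hζ
    rw [hζ]
  · simpa only [truncatedT_congr h, singularT_congr h] using hf.2

/-! ### The corner weight, its exponents and the conclusion. -/

lemma measurable_cornerWeight (p α : ℝ) : Measurable (cornerWeight p α) := by
  unfold cornerWeight
  fun_prop

lemma cornerWeight_pos {α : ℝ} (hα : 0 < α) (p : ℝ) {z : ℂ} (hz : z ∈ halfPlane) :
    0 < cornerWeight p α z := by
  have hz' : 0 < z.im := hz
  have : 0 < ‖z‖ := norm_pos_iff.2 fun h => by rw [h] at hz'; simp at hz'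
  unfold cornerWeight
  positivity

lemma weightedMeasure_absolutelyContinuous (p α : ℝ) :
    weightedMeasure p α ≪ volume.restrict halfPlane := withDensity_absolutelyContinuous _ _

lemma absolutelyContinuous_weightedMeasure {α : ℝ} (hα : 0 < α) (p : ℝ) :
    volume.restrict halfPlane ≪ weightedMeasure p α := by
  refine withDensity_absolutelyContinuous'
    (measurable_cornerWeight p α).ennreal_ofReal.aemeasurable ?_
  filter_upwards [ae_restrict_mem measurableSet_halfPlane] with z hz
  simpa using cornerWeight_pos hα p hz

/-- The exponent `2δ(p - 1) / p` with which the weight acts on functions. -/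
def cornerExponent (p α : ℝ) : ℝ := 2 * cornerDelta α * (p - 1) / p

/-- The constant factor of the weight, acting on functions. -/
def cornerConst (p α : ℝ) : ENNReal := ENNReal.ofReal ((Real.pi / α) ^ (2 * (p - 1))) ^ (1 / p)

/-- Separates the power of `|z|` from the factor built from `π/α`. The latter appears on both sides
of the operator bound and has no effect on it. -/
lemma eLpNorm_weightedMeasure {E : Type*} [NormedAddCommGroup E] [NormedSpace ℝ E] {p α : ℝ}
    (hp : 0 < p) (hα : 0 < α) (u : ℂ → E) :
    eLpNorm u (ENNReal.ofReal p) (weightedMeasure p α) = cornerConst p α *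
      eLpNorm (fun z => ‖z‖ ^ cornerExponent p α • u z) (ENNReal.ofReal p)
        (volume.restrict halfPlane) := by
  refine ENNReal.rpow_left_injective hp.ne' ?_
  dsimp only
  have hpa : 0 < Real.pi / α := by positivity
  rw [ENNReal.mul_rpow_of_nonneg _ _ hp.le, eLpNorm_ofReal_rpow hp, eLpNorm_ofReal_rpow hp,
    cornerConst, ← ENNReal.rpow_mul, one_div_mul_cancel hp.ne', ENNReal.rpow_one,
    weightedMeasure, lintegral_withDensity_eq_lintegral_mul_non_measurable _
      (measurable_cornerWeight p α).ennreal_ofReal (Eventually.of_forall fun z =>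
        ENNReal.ofReal_lt_top), ← lintegral_const_mul' _ _ ENNReal.ofReal_ne_top]
  refine lintegral_congr fun z => ?_
  have hzs : 0 ≤ ‖z‖ ^ cornerExponent p α := by positivity
  rw [Pi.mul_apply, enorm_smul, ENNReal.mul_rpow_of_nonneg _ _ hp.le, ← mul_assoc]
  congr 1
  rw [Real.enorm_of_nonneg hzs, ENNReal.ofReal_rpow_of_nonneg hzs hp.le,
    ← ENNReal.ofReal_mul (by positivity), cornerWeight,
    Real.mul_rpow hpa.le (by positivity), ← Real.rpow_mul (norm_nonneg _),
    ← Real.rpow_mul (norm_nonneg _), cornerExponent]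
  congr 3
  field_simp

lemma cornerDelta_mem {α : ℝ} (h0 : 0 < α) (h1 : α < Real.pi) :
    0 < cornerDelta α ∧ cornerDelta α < 1 := by
  have hπ := Real.pi_pos
  have h2 : α / Real.pi < 1 := (div_lt_one hπ).2 h1
  have h3 : 0 < α / Real.pi := by positivity
  unfold cornerDelta
  constructor <;> linarith

/-- The distances from `α` to `0` and `π` are `π(1 - δ)` and `πδ`, and `min(δ, 1 - δ) ≤ 2δ(1 - δ)`.
The point `π/2` can only lower `ε_α`; excluding it keeps `ε_α` positive. -/
lemma le_cornerEps_inv {p α : ℝ} (hp : 0 ≤ p) (h0 : 0 < α) (h1 : α < Real.pi)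
    (h2 : α ≠ Real.pi / 2) :
    p / (cornerDelta α * (1 - cornerDelta α)) ≤ 2 * Real.pi * (p * (cornerEps α)⁻¹) := by
  have hπ := Real.pi_pos
  obtain ⟨hδ0, hδ1⟩ := cornerDelta_mem h0 h1
  have hα : Real.pi * (1 - cornerDelta α) = α := by
    unfold cornerDelta; field_simp; ring
  have he0 : 0 < cornerEps α := by
    have hcl : IsClosed ({0, Real.pi / 2, Real.pi} : Set ℝ) := (Set.toFinite _).isClosed
    refine (hcl.notMem_iff_infDist_pos ⟨0, by simp⟩).1 ?_
    simp [h0.ne', h1.ne, h2]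
  have he1 : cornerEps α ≤ Real.pi * (1 - cornerDelta α) := by
    rw [hα]
    have := Metric.infDist_le_dist_of_mem (x := α) (s := {0, Real.pi / 2, Real.pi}) (y := 0)
      (by simp)
    rwa [Real.dist_eq, sub_zero, abs_of_pos h0] at this
  have he2 : cornerEps α ≤ Real.pi * cornerDelta α := by
    have := Metric.infDist_le_dist_of_mem (x := α) (s := {0, Real.pi / 2, Real.pi}) (y := Real.pi)
      (by simp)
    rw [Real.dist_eq, abs_of_neg (by linarith)] at this
    have e : Real.pi * cornerDelta α = Real.pi - α := by linarith
    rw [e]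
    exact this.trans (by linarith)
  set δ := cornerDelta α
  have key : cornerEps α ≤ 2 * Real.pi * (δ * (1 - δ)) := by
    rcases le_total δ (1 / 2) with h | h
    · nlinarith [mul_nonneg hπ.le hδ0.le]
    · nlinarith [mul_nonneg hπ.le (sub_nonneg.2 hδ1.le)]
  have hpos : 0 < δ * (1 - δ) := mul_pos hδ0 (by linarith)
  rw [div_le_iff₀ hpos, show 2 * Real.pi * (p * (cornerEps α)⁻¹) * (δ * (1 - δ)) =
    p * ((2 * Real.pi * (δ * (1 - δ))) / cornerEps α) by ring]
  exact le_mul_of_one_le_right hp ((one_le_div he0).2 key)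

/-- The gap to the critical exponent is `2 - s - 2/p = 2(1 - 1/p)(1 - δ)`, which is at least `1 - δ`
because `p ≥ 2`. -/
lemma cornerExponent_add_le {p α : ℝ} (hp : 2 ≤ p) (h0 : 0 < α) (h1 : α < Real.pi) :
    0 ≤ cornerExponent p α ∧ cornerExponent p α + 2 / p + (1 - cornerDelta α) ≤ 2 := by
  obtain ⟨hδ0, hδ1⟩ := cornerDelta_mem h0 h1
  have hp0 : 0 < p := by linarith
  unfold cornerExponent
  refine ⟨div_nonneg (mul_nonneg (by linarith) (by linarith)) hp0.le, ?_⟩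
  have h2 : 2 / p ≤ 1 := (div_le_one hp0).2 hp
  have e : 2 * cornerDelta α * (p - 1) / p + 2 / p + (1 - cornerDelta α) =
      1 + cornerDelta α + 2 / p * (1 - cornerDelta α) := by field_simp; ring
  rw [e]
  nlinarith

lemma eLpNorm_sub_comp_conj_le {h : ℂ → ℝ} {p : ENNReal} (hp : 1 ≤ p)
    (hf : AEStronglyMeasurable h) :
    eLpNorm (fun z => h z - h (starRingEnd ℂ z)) p ≤ 2 * eLpNorm h p := by
  have hc := hf.comp_measurePreserving measurePreserving_conj
  refine (eLpNorm_sub_le hf hc hp).trans ?_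
  rw [eLpNorm_comp_measurePreserving hf measurePreserving_conj, two_mul]

/-- The weight depends only on `|z|`, which conjugation preserves, so it commutes with the
reflection. -/
lemma eLpNorm_oddReflection_le {f : ℂ → ℝ} {s : ℝ} {p : ENNReal} (hp : 1 ≤ p)
    (hf : AEStronglyMeasurable fun z => ‖z‖ ^ s • f z) :
    eLpNorm (fun z => ‖z‖ ^ s • oddReflection f z) p ≤
      2 * eLpNorm (fun z => ‖z‖ ^ s • f z) p := by
  refine le_of_eq_of_le (eLpNorm_congr_norm_ae (Eventually.of_forall fun z => ?_))
    (eLpNorm_sub_comp_conj_le hp hf)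
  simp only [oddReflection]
  rw [RCLike.norm_conj, ← smul_sub, norm_smul, norm_smul, ← Complex.ofReal_sub, Complex.norm_real]

lemma exists_singularT_bound : ∃ C : ℝ, 0 < C ∧ ∀ p α : ℝ, 2 ≤ p → 0 < α → α < Real.pi →
    ∀ f : ℂ → ℝ, MemLp f (ENNReal.ofReal p) (weightedMeasure p α) →
      (∀ᵐ z ∂(volume.restrict halfPlane), PrincipalValueExists f z) ∧
      AEStronglyMeasurable (singularT f) (weightedMeasure p α) ∧
      eLpNorm (singularT f) (ENNReal.ofReal p) (weightedMeasure p α) ≤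
        ENNReal.ofReal (C * (p / (cornerDelta α * (1 - cornerDelta α)))) *
          eLpNorm f (ENNReal.ofReal p) (weightedMeasure p α) := by
  obtain ⟨C, hC, hB⟩ := exists_beurling_principalValue_weighted
  refine ⟨4 * C, by positivity, fun p α hp h0 h1 f hf => ?_⟩
  obtain ⟨hδ0, hδ1⟩ := cornerDelta_mem h0 h1
  obtain ⟨hs0, hs⟩ := cornerExponent_add_le hp h0 h1
  have hp0 : 0 < p := by linarith
  have hp1 : 1 ≤ ENNReal.ofReal p := by simp; linarith
  set s := cornerExponent p α with hsdef
  set δ := cornerDelta α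
  have hfm : AEStronglyMeasurable f (volume.restrict halfPlane) :=
    hf.1.mono_ac (absolutelyContinuous_weightedMeasure h0 p)
  -- The odd reflection needs a function measurable on the plane and zero off the half-plane. The
  -- operator sees only the almost everywhere class on the half-plane, so this replacement is
  -- harmless.
  set f₁ : ℂ → ℝ := halfPlane.indicator (hfm.mk f) with hf₁
  have hf₁m : Measurable f₁ :=
    hfm.stronglyMeasurable_mk.measurable.indicator measurableSet_halfPlane
  have hff₁ : f₁ =ᵐ[volume.restrict halfPlane] f := by
    filter_upwards [hfm.ae_eq_mk, ae_restrict_mem measurableSet_halfPlane] with z hz hz'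
    rw [hf₁, Set.indicator_of_mem hz', hz]
  have hf₁0 : ∀ z, z ∉ halfPlane → f₁ z = 0 := fun z hz => Set.indicator_of_notMem hz _
  have hsm : Measurable fun z : ℂ => ‖z‖ ^ s := by fun_prop
  have hgm : Measurable fun z => ‖z‖ ^ s • f₁ z := hsm.smul hf₁m
  set c := cornerConst p α
  have hc0 : eLpNorm f (ENNReal.ofReal p) (weightedMeasure p α) =
      c * eLpNorm (fun z => ‖z‖ ^ s • f₁ z) (ENNReal.ofReal p) := by
    rw [eLpNorm_weightedMeasure hp0 h0]
    congr 1
    have e : (fun z => ‖z‖ ^ s • f₁ z) = halfPlane.indicator fun z => ‖z‖ ^ s • f₁ z := by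
      ext z
      by_cases hz : z ∈ halfPlane
      · rw [Set.indicator_of_mem hz]
      · rw [Set.indicator_of_notMem hz, hf₁0 z hz, smul_zero]
    rw [e, eLpNorm_indicator_eq_eLpNorm_restrict measurableSet_halfPlane]
    refine eLpNorm_congr_ae ?_
    filter_upwards [hff₁] with z hz
    rw [hz]
  have hcne : c ≠ 0 := by
    have : 0 < (Real.pi / α) ^ (2 * (p - 1)) := by positivity
    simp only [c, cornerConst]
    rw [ENNReal.ofReal_rpow_of_pos this]
    exact (ENNReal.ofReal_pos.2 (by positivity)).ne'
  have hfin : eLpNorm (fun z => ‖z‖ ^ s • f₁ z) (ENNReal.ofReal p) < ⊤ := by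
    have h2 := hf.2
    rw [hc0] at h2
    exact lt_top_iff_ne_top.2 fun h => by
      rw [h, ENNReal.mul_top hcne] at h2
      exact lt_irrefl _ h2
  have hom : Measurable (oddReflection f₁) := by
    have : Measurable fun z => f₁ (starRingEnd ℂ z) := hf₁m.comp measurePreserving_conj.measurable
    unfold oddReflection
    fun_prop
  have hodd := eLpNorm_oddReflection_le (s := s) hp1 hgm.aestronglyMeasurable
  obtain ⟨F, hFm, hFn, hFt⟩ := hB p s (1 - δ) hp hs0 (by linarith) hs (oddReflection f₁)
    hom.aestronglyMeasurable ⟨(hsm.smul hom).aestronglyMeasurable,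
      hodd.trans_lt (ENNReal.mul_lt_top (by simp) hfin)⟩
  have hpv : ∀ᵐ z ∂(volume.restrict halfPlane),
      PrincipalValueExists f₁ z ∧ singularT f₁ z = antilinearMap (F z) := by
    filter_upwards [ae_restrict_of_ae hFt, ae_restrict_mem measurableSet_halfPlane] with z hz hz'
    exact principalValue_of_oddReflection hf₁0 hz' hz.1 hz.2
  have hT : singularT f =ᵐ[volume.restrict halfPlane] fun z => antilinearMap (F z) := by
    filter_upwards [hpv] with z hz
    rw [← singularT_congr hff₁, hz.2]
  refine ⟨hpv.mono fun z hz => hz.1.congr hff₁, ?_, ?_⟩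
  · refine AEStronglyMeasurable.mono_ac (weightedMeasure_absolutelyContinuous p α) ?_
    exact (antilinearMap.continuous.comp_aestronglyMeasurable hFm.restrict).congr hT.symm
  · have hT1 : eLpNorm (fun z => ‖z‖ ^ s • singularT f z) (ENNReal.ofReal p)
        (volume.restrict halfPlane) ≤ eLpNorm (fun z => ‖z‖ ^ s • F z) (ENNReal.ofReal p) := by
      refine le_trans (eLpNorm_mono_ae ?_) (eLpNorm_mono_measure _ Measure.restrict_le_self)
      filter_upwards [hT] with z hz
      rw [hz, norm_smul, norm_smul]
      gcongr
      exact norm_antilinearMap_le _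
    -- The argument yields `p + 1/(1 - δ)`, with a factor `2` from the reflection. Each of the two
    -- summands is at most `p/(δ(1 - δ))`.
    have hconst : C * (p + 1 / (1 - δ)) * 2 ≤ 4 * C * (p / (δ * (1 - δ))) := by
      have hδ1' : 0 < 1 - δ := by linarith
      have hd : 0 < δ * (1 - δ) := mul_pos hδ0 hδ1'
      have i1 : p ≤ p / (δ * (1 - δ)) := by
        rw [le_div_iff₀ hd]
        have : δ * (1 - δ) ≤ 1 := by nlinarith
        nlinarith
      have i2 : 1 / (1 - δ) ≤ p / (δ * (1 - δ)) := by
        rw [div_le_div_iff₀ hδ1' hd]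
        nlinarith
      nlinarith
    rw [hc0, eLpNorm_weightedMeasure hp0 h0, mul_left_comm]
    refine mul_le_mul_right (hT1.trans (hFn.trans ((mul_le_mul_right hodd _).trans ?_))) c
    rw [← mul_assoc]
    refine mul_le_mul_left ?_ _
    rw [show (2:ENNReal) = ENNReal.ofReal 2 by norm_num, ← ENNReal.ofReal_mul' (by norm_num)]
    exact ENNReal.ofReal_le_ofReal hconst

theorem lemma3p3 :
    ∃ C : ℝ, 0 < C ∧ ∀ p α : ℝ, 2 ≤ p → 0 < α → α < Real.pi →
      (∀ f : ℂ → ℝ, MemLp f (ENNReal.ofReal p) (weightedMeasure p α) →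
        (∀ᵐ z ∂(volume.restrict halfPlane), PrincipalValueExists f z) ∧
        MemLp (singularT f) (ENNReal.ofReal p) (weightedMeasure p α) ∧
        eLpNorm (singularT f) (ENNReal.ofReal p) (weightedMeasure p α) ≤
          ENNReal.ofReal (C * (p / (cornerDelta α * (1 - cornerDelta α)))) *
            eLpNorm f (ENNReal.ofReal p) (weightedMeasure p α)) ∧
      (α ≠ Real.pi / 2 →
        p / (cornerDelta α * (1 - cornerDelta α)) ≤ C * (p * (cornerEps α)⁻¹)) := by
  obtain ⟨C, hC, hT⟩ := exists_singularT_bound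
  refine ⟨C + 2 * Real.pi, by positivity, fun p α hp h0 h1 => ⟨fun f hf => ?_, fun h2 => ?_⟩⟩
  · obtain ⟨hδ0, hδ1⟩ := cornerDelta_mem h0 h1
    obtain ⟨hpv, hm, hn⟩ := hT p α hp h0 h1 f hf
    have hd : 0 < cornerDelta α * (1 - cornerDelta α) := mul_pos hδ0 (by linarith)
    refine ⟨hpv, ⟨hm, hn.trans_lt (ENNReal.mul_lt_top ENNReal.ofReal_lt_top hf.2)⟩,
      hn.trans ?_⟩
    gcongr
    linarith [Real.pi_pos]
  · refine (le_cornerEps_inv (by linarith) h0 h1 h2).trans ?_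
    have : 0 ≤ cornerEps α := Metric.infDist_nonneg
    gcongr
    linarith

end
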